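/- **Theorem ($b^m$-Darboux theorem).** Let $n,m\ge 1$, let $M$ be a smooth manifold of dimension $2n$ without boundary, and let $Z=x^{-1}(0)\subset M$ be a hypersurface, where $x\in C^\infty(M)$ has $0$ as a regular value. Let ${}^{b^m}TM$ be the vector bundle over $M$ with fibres ${}^{b^m}T_qM=\{(v,c)\in T_qM\times\mathbb R : dx_q(v)=x(q)^m c\}$; its smooth sections are the vector fields $v$ on $M$ such that $dx(v)=x^m c$ for a smooth function $c$, and $\frac{dx}{x^m}$ denotes the smooth section $(v,c)\mapsto c$ of its dual bundle ${}^{b^m}T^*M$. A *$b^m$-form of degree $k$* is a smooth section of $\Lambda^k({}^{b^m}T^*M)$, that is, locally a sum $\frac{dx}{x^m}\wedge\alpha+\beta$ with $\alpha,\beta$ smooth differential forms (of degrees $k-1$ and $k$). It is *closed* if its restriction to $M\setminus Z$, which is an ordinary differential form, is closed. A *$b^m$-symplectic form* on $(M,Z)$ is a closed $b^m$-form of degree $2$ that is nondegenerate on ${}^{b^m}T_qM$ for every $q\in M$. Let $\omega$ be a $b^m$-symplectic form on $(M,Z)$ and let $p\in Z$. Then there is a smooth coordinate chart $(U,x_1,y_1,\dots,x_n,y_n)$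 of $M$ centered at $p$ such that $Z\cap U=\{q\in U : x_1(q)=0\}$, the form $\frac{dx_1}{x_1^m}$ on $U\setminus Z$ extends to a $b^m$-form of degree $1$ on $U$, and $$\omega=\frac{dx_1}{x_1^m}\wedge dy_1+\sum_{i=2}^n dx_i\wedge dy_i$$ as $b^m$-forms on $U$ (in particular as ordinary differential forms on $U\setminus Z$). -/

import Mathlib

open Set Filter Topology
open scoped Manifold ContDiff

noncomputable section

/-- `x` is a (global) defining function of the hypersurface `Z ⊆ M`: it is smooth, `0` is a regular
value of `x`, and `Z = x⁻¹(0)`. -/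
structure IsDefiningFunction {d : ℕ} {M : Type*} [TopologicalSpace M]
    [ChartedSpace (EuclideanSpace ℝ (Fin d)) M] (x : M → ℝ) (Z : Set M) : Prop where
  smooth : ContMDiff (𝓡 d) 𝓘(ℝ, ℝ) ∞ x
  regular : ∀ q, x q = 0 → mfderiv (𝓡 d) 𝓘(ℝ, ℝ) x q ≠ 0
  zero_set : Z = x ⁻¹' {0}

/-- The differential at `q` of a real function `f` on `M`, as a linear form on `T_q M`. -/
def dAt (d : ℕ) {M : Type*} [TopologicalSpace M] [ChartedSpace (EuclideanSpace ℝ (Fin d)) M]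
    (f : M → ℝ) (q : M) : TangentSpace (𝓡 d) q →L[ℝ] ℝ :=
  mfderiv (𝓡 d) 𝓘(ℝ, ℝ) f q

/-- The fibre at `q` of the `b^m`-tangent bundle of `(M, Z, x)`, realised inside `T_q M × ℝ` as
`{(v, c) | dx(v) = x(q)^m c}`. The bundle map to `T M` is `(v, c) ↦ v`, and the canonical `b^m`
one-form `dx / x^m` is `(v, c) ↦ c`. Its smooth sections are the vector fields `v` for which
`dx(v) = x^m c` with `c` smooth, that is, those spanned locally by `x^m ∂/∂x` and by the fields
that annihilate `x`. For `q ∉ Z` the fibre is `T_q M`, for `q ∈ Z` (and `m ≥ 1`) it is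
`T_q Z ⊕ ℝ`, the vector `(0, 1)` being the class of `x^m ∂/∂x`. -/
def BmTangent (d : ℕ) {M : Type*} [TopologicalSpace M]
    [ChartedSpace (EuclideanSpace ℝ (Fin d)) M] (x : M → ℝ) (m : ℕ) (q : M) :
    Submodule ℝ (TangentSpace (𝓡 d) q × ℝ) where
  carrier := {e | dAt d x q e.1 = x q ^ m * e.2}
  add_mem' := by
    intro a b ha hb
    simp only [mem_ofPred_eq, Prod.fst_add, Prod.snd_add, map_add] at *
    rw [ha, hb, mul_add]
  zero_mem' := by simp
  smul_mem' := by
    intro r a ha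
    simp only [mem_ofPred_eq, Prod.smul_fst, Prod.smul_snd, map_smul, smul_eq_mul] at *
    rw [ha]; ring

/-- A (not necessarily smooth) `b^m`-form of degree `k` on `(M, Z, x)`: a section of the `k`-th
exterior power of the `b^m`-cotangent bundle. -/
abbrev BmForm (d : ℕ) {M : Type*} [TopologicalSpace M]
    [ChartedSpace (EuclideanSpace ℝ (Fin d)) M] (x : M → ℝ) (m k : ℕ) : Type _ :=
  ∀ q : M, (BmTangent d x m q) [⋀^Fin k]→L[ℝ] ℝ

/-- The `b^m`-form `σ` is smooth on the open set `U`: around each point of `U` there is a chart in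
which `σ` is the restriction to the `b^m`-tangent bundle of a smooth `k`-form `Ω` on the ambient
bundle `T M × ℝ`. As an alternating form on `T M × ℝ` is of the shape `c ∧ α + β`, with `α`, `β`
forms on `T M`, this says that locally `σ = (dx / x^m) ∧ α + β` with smooth forms `α` and `β`. -/
def BmForm.SmoothOn {d : ℕ} {M : Type*} [TopologicalSpace M]
    [ChartedSpace (EuclideanSpace ℝ (Fin d)) M] {x : M → ℝ} {m k : ℕ}
    (σ : BmForm d x m k) (U : Set M) : Prop :=
  ∀ p ∈ U, ∃ φ ∈ IsManifold.maximalAtlas (𝓡 d) ∞ M, p ∈ φ.source ∧ φ.source ⊆ U ∧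
    ∃ Ω : EuclideanSpace ℝ (Fin d) → (EuclideanSpace ℝ (Fin d) × ℝ) [⋀^Fin k]→L[ℝ] ℝ,
      ContDiffOn ℝ ∞ Ω φ.target ∧
      ∀ q ∈ φ.source, ∀ e : Fin k → BmTangent d x m q,
        σ q e = Ω (φ q) (fun i => (mfderiv (𝓡 d) (𝓡 d) φ q (e i).1.1, (e i).1.2))

/-- Off the hypersurface, every tangent vector `v` is a `b^m`-tangent vector in a unique way. -/
def bmLift (d : ℕ) {M : Type*} [TopologicalSpace M]
    [ChartedSpace (EuclideanSpace ℝ (Fin d)) M] (x : M → ℝ) (m : ℕ) (q : M) (hq : x q ≠ 0) :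
    TangentSpace (𝓡 d) q →L[ℝ] BmTangent d x m q :=
  ((ContinuousLinearMap.id ℝ (TangentSpace (𝓡 d) q)).prod
    ((x q ^ m)⁻¹ • dAt d x q)).codRestrict (BmTangent d x m q) (by
      intro v
      change dAt d x q v = x q ^ m * ((x q ^ m)⁻¹ * dAt d x q v)
      rw [mul_inv_cancel_left₀ (pow_ne_zero m hq)])

open Classical in
/-- The restriction of a `b^m`-form to `M \ Z`, which is an ordinary differential form there,
written in the chart `φ`, i.e. pulled back by `φ⁻¹` (with the value `0` on `φ(Z)`). -/
def BmForm.inChart {d : ℕ} {M : Type*} [TopologicalSpace M]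
    [ChartedSpace (EuclideanSpace ℝ (Fin d)) M] {x : M → ℝ} {m k : ℕ} (σ : BmForm d x m k)
    (φ : OpenPartialHomeomorph M (EuclideanSpace ℝ (Fin d))) (z : EuclideanSpace ℝ (Fin d)) :
    EuclideanSpace ℝ (Fin d) [⋀^Fin k]→L[ℝ] ℝ :=
  if h : x (φ.symm z) ≠ 0 then
    (σ (φ.symm z)).compContinuousLinearMap
      ((bmLift d x m (φ.symm z) h).comp (mfderiv (𝓡 d) (𝓡 d) φ.symm z))
  else 0

/-- The smooth `b^m`-form `σ` is closed. The exterior derivative of a smooth `b^m`-form is the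
unique `b^m`-form that restricts to the usual exterior derivative on the dense open set `M \ Z`,
so it vanishes if and only if the exterior derivative vanishes on `M \ Z`. -/
def BmForm.Closed {d : ℕ} {M : Type*} [TopologicalSpace M]
    [ChartedSpace (EuclideanSpace ℝ (Fin d)) M] {x : M → ℝ} {m k : ℕ}
    (σ : BmForm d x m k) : Prop :=
  ∀ φ ∈ IsManifold.maximalAtlas (𝓡 d) ∞ M, ∀ z ∈ φ.target, x (φ.symm z) ≠ 0 →
    extDeriv (σ.inChart φ) z = 0

/-- A `b^m`-symplectic form: a smooth closed `b^m`-form of degree two which has maximal rank, as a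
form on the `b^m`-tangent space, at every point. -/
structure IsBmSymplectic {d : ℕ} {M : Type*} [TopologicalSpace M]
    [ChartedSpace (EuclideanSpace ℝ (Fin d)) M] {x : M → ℝ} {m : ℕ}
    (σ : BmForm d x m 2) : Prop where
  smooth : σ.SmoothOn univ
  closed : σ.Closed
  nondegenerate : ∀ q, ∀ e : BmTangent d x m q, (∀ e', σ q ![e, e'] = 0) → e = 0

/-- The position of `x_{i+1}` in the list of coordinates `(x_1, y_1, …, x_n, y_n)`. -/
def xIdx {n : ℕ} (i : Fin n) : Fin (2 * n) := ⟨2 * i.val, by omega⟩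

/-- The position of `y_{i+1}` in the list of coordinates `(x_1, y_1, …, x_n, y_n)`. -/
def yIdx {n : ℕ} (i : Fin n) : Fin (2 * n) := ⟨2 * i.val + 1, by omega⟩

/-- The exterior product of two linear forms, `(a ∧ b)(v, w) = a(v) b(w) - a(w) b(v)`. -/
def wedgeEval {V : Type*} (a b : V → ℝ) (v w : V) : ℝ := a v * b w - a w * b v

/-- The differential at `q` of the function `f` on `M`, regarded as a `b^m`-form of degree one. -/
def bmDiff (d : ℕ) {M : Type*} [TopologicalSpace M]
    [ChartedSpace (EuclideanSpace ℝ (Fin d)) M] (x : M → ℝ) (m : ℕ) (f : M → ℝ) (q : M)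
    (e : BmTangent d x m q) : ℝ :=
  dAt d f q e.1.1

end

/-! The first coordinate can be taken to be `x` itself, so that `dx / x^m` is never changed and no
Moser argument with a singular form is needed. In a chart the `b^m`-form is the restriction of a
smooth bilinear form `Ω` on the trivial bundle `E × ℝ` to the vectors `(v, c)` with `dX(v) = X^m c`.

Nondegeneracy gives a smooth field `W` with `ι_W ω = dx / x^m` (`exists_bm_field`). It is tangent to
the levels of `x` and nonzero at `p`, so it can be straightened to `∂ₜ` in coordinates `(w, x, t)`,
with `w` in a space `H` of dimension `2n - 2` and `x` kept as a coordinate. There `ω = dx/x^m ∧ (α -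
dt) + β`, with `α` and `β` forms on `H` that depend on parameters. Away from `x = 0` closedness says
that `α` and `β` do not depend on `t`, that `d_H β = 0` and that `d_H α = x^m ∂ₓβ`
(`bm_structure_equations`); by continuity this holds also on `x = 0`.

The decisive point is the last equation. The Poincaré homotopy operator along `H` turns it into `α =
d_H g + x^m γ`, with `γ` smooth and zero at the origin (`exists_primitive_mod_pow`), and division by
`x^m` gives `d_H γ = ∂ₓβ`. Hence `ω = dx/x^m ∧ d(g - t) + (dx ∧ γ + β)`, where the bracket is an
ordinary smooth closed two-form on `H × ℝ` whose kernel at the origin is the line of `∂ₓ`. The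
odd-dimensional Darboux theorem writes it as a sum of products `dxᵢ ∧ dyᵢ`, and `y₁ = g - t`
completes the chart (`isBmDarboux_of_flow_box`).

The ordinary Darboux theorem is proved by an induction that alternates parity. A closed form with a
line kernel descends to a transversal of the kernel field; from a symplectic form one subtracts `dt
∧ dl`, where `l` is a linear form and `t` is the time along its Hamiltonian field, and the
difference descends in the same way. Both steps need smooth flow boxes. The smooth flow comes from
the inverse function theorem on the Banach space of curves `C([0,1], E)`, where composition with a
smooth map is smooth. -/

set_option linter.unusedSectionVars false

/-! ### Composition operators on spaces of continuous maps -/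

section Nemytskii

variable {X : Type} [TopologicalSpace X] [CompactSpace X]
  {E F : Type} [NormedAddCommGroup E] [NormedSpace ℝ E] [NormedAddCommGroup F] [NormedSpace ℝ F]

/-- Pointwise application of a continuous family of operators to a continuous map. -/
noncomputable def applyFamily (X E F : Type) [TopologicalSpace X] [CompactSpace X]
    [NormedAddCommGroup E] [NormedSpace ℝ E] [NormedAddCommGroup F] [NormedSpace ℝ F] :
    C(X, E →L[ℝ] F) →L[ℝ] C(X, E) →L[ℝ] C(X, F) :=
  LinearMap.mkContinuous₂
    (LinearMap.mk₂ ℝ (fun (A : C(X, E →L[ℝ] F)) (h : C(X, E)) =>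
        (⟨fun x => A x (h x), by fun_prop⟩ : C(X, F)))
      (fun _ _ _ => by ext; simp) (fun _ _ _ => by ext; simp)
      (fun _ _ _ => by ext; simp) (fun _ _ _ => by ext; simp)) 1
    (fun A h => by
      rw [one_mul]
      refine (ContinuousMap.norm_le _ (by positivity)).2 fun x => ?_
      exact (A x).le_of_opNorm_le_of_le (A.norm_coe_le_norm x) (h.norm_coe_le_norm x))

@[simp] theorem applyFamily_apply (A : C(X, E →L[ℝ] F)) (h : C(X, E)) (x : X) :
    applyFamily X E F A h x = A x (h x) := rfl

/-- Composition with a continuous map, on spaces of continuous maps. -/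
def superpose (X : Type) [TopologicalSpace X] (f : C(E, F)) (γ : C(X, E)) : C(X, F) := f.comp γ

@[simp] theorem superpose_apply (f : C(E, F)) (γ : C(X, E)) (x : X) :
    superpose X f γ x = f (γ x) := rfl

/-- The range of `γ` is compact, so the derivative of `f` is uniformly continuous near it and a
single `δ` serves all points; the mean value inequality is then applied pointwise. -/
theorem hasFDerivAt_superpose (f : C(E, F)) (hf : ContDiff ℝ 1 f) (γ : C(X, E)) :
    HasFDerivAt (superpose X f)
      (applyFamily X E F (superpose X ⟨fderiv ℝ f, hf.continuous_fderiv one_ne_zero⟩ γ)) γ := by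
  rw [hasFDerivAt_iff_isLittleO_nhds_zero, Asymptotics.isLittleO_iff]
  intro ε hε
  have hK : IsCompact (range γ) := isCompact_range γ.continuous
  have hc := hf.continuous_fderiv one_ne_zero
  have hU := hK.uniformContinuousAt_of_continuousAt (fderiv ℝ f)
    (fun a _ => hc.continuousAt) (Metric.dist_mem_uniformity hε)
  obtain ⟨δ, hδ, hδ'⟩ := Metric.mem_uniformity_dist.1 hU
  filter_upwards [Metric.ball_mem_nhds (0 : C(X, E)) hδ] with h hh
  rw [mem_ball_zero_iff] at hh
  refine (ContinuousMap.norm_le _ (by positivity)).2 fun x => ?_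
  have hhx : ‖h x‖ < δ := (h.norm_coe_le_norm x).trans_lt hh
  have key := (convex_ball (γ x) δ).norm_image_sub_le_of_norm_hasFDerivWithin_le'
    (f := f) (f' := fderiv ℝ f) (φ := fderiv ℝ f (γ x)) (C := ε) (x := γ x) (y := γ x + h x)
    (fun y _ => (hf.differentiable one_ne_zero y).hasFDerivAt.hasFDerivWithinAt)
    (fun y hy => by
      have := hδ' (a := γ x) (b := y) (by simpa [dist_comm] using hy) (mem_range_self x)
      rw [← dist_eq_norm, dist_comm]
      exact le_of_lt this)
    (Metric.mem_ball_self hδ) (by simpa using hhx)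
  calc _ ≤ ε * ‖h x‖ := by simpa using key
    _ ≤ ε * ‖h‖ := by gcongr; exact h.norm_coe_le_norm x

/-- The derivative is again a superposition operator, built from `fderiv ℝ f`, followed by the fixed
continuous linear map `applyFamily`. The target space changes at each step of the induction and is
therefore quantified inside. -/
theorem contDiff_superpose_nat (n : ℕ) : ∀ {F : Type} [NormedAddCommGroup F] [NormedSpace ℝ F]
    (f : C(E, F)), ContDiff ℝ n f → ContDiff ℝ n (superpose X f) := by
  induction n with
  | zero =>
    intro F _ _ f _
    exact contDiff_zero.2 (ContinuousMap.continuous_postcomp f)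
  | succ n ih =>
    intro F _ _ f hf
    have h1 : ContDiff ℝ 1 f := hf.of_le (by norm_cast; omega)
    have hd := hasFDerivAt_superpose (X := X) f h1
    rw [Nat.cast_succ, contDiff_succ_iff_fderiv]
    refine ⟨fun γ => (hd γ).differentiableAt, by simp, ?_⟩
    have : fderiv ℝ (superpose X f) = fun γ =>
        applyFamily X E F (superpose X ⟨fderiv ℝ f, h1.continuous_fderiv one_ne_zero⟩ γ) :=
      funext fun γ => (hd γ).fderiv
    rw [this]
    refine (applyFamily X E F).contDiff.comp (ih _ ?_)
    exact hf.fderiv_right (by norm_cast)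

theorem contDiff_superpose (f : C(E, F)) (hf : ContDiff ℝ ∞ f) :
    ContDiff ℝ ∞ (superpose X f) :=
  contDiff_infty.2 fun n => contDiff_superpose_nat n f (hf.of_le (by exact_mod_cast le_top))

end Nemytskii

/-! ### Parametric integrals -/

section Integral

variable {E V : Type} [NormedAddCommGroup E] [NormedSpace ℝ E] [NormedAddCommGroup V]
  [NormedSpace ℝ V]

/-- The primitive vanishing at `0` of a continuous curve on the unit interval. -/
noncomputable def primitive (V : Type) [NormedAddCommGroup V] [NormedSpace ℝ V] :
    C(unitInterval, V) →L[ℝ] C(unitInterval, V) :=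
  LinearMap.mkContinuous
    { toFun := fun γ => ⟨fun s => ∫ r in (0 : ℝ)..s, IccExtend zero_le_one γ r, by
        have h : Continuous (IccExtend zero_le_one γ : ℝ → V) := γ.continuous.Icc_extend'
        exact (intervalIntegral.continuous_primitive
          (fun a b => h.intervalIntegrable a b) 0).comp continuous_subtype_val⟩
      map_add' := fun γ δ => by
        have h : ∀ γ : C(unitInterval, V), Continuous (IccExtend zero_le_one γ : ℝ → V) :=
          fun γ => γ.continuous.Icc_extend'
        ext s
        exact intervalIntegral.integral_add ((h γ).intervalIntegrable _ _)
          ((h δ).intervalIntegrable _ _)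
      map_smul' := fun c γ => by
        ext s
        exact intervalIntegral.integral_smul c _ } 1
    (fun γ => by
      rw [one_mul]
      refine (ContinuousMap.norm_le _ (by positivity)).2 fun s => ?_
      have := intervalIntegral.norm_integral_le_of_norm_le_const (a := 0) (b := (s : ℝ))
        (f := IccExtend zero_le_one γ) (C := ‖γ‖) (fun r _ => γ.norm_coe_le_norm _)
      refine this.trans ?_
      rw [sub_zero, abs_of_nonneg s.2.1]
      exact mul_le_of_le_one_right (norm_nonneg _) s.2.2)

theorem primitive_apply (γ : C(unitInterval, V)) (s : unitInterval) :
    primitive V γ s = ∫ r in (0 : ℝ)..s, IccExtend zero_le_one γ r := rfl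

theorem primitive_apply_eq {γ : C(unitInterval, V)} {f : ℝ → V}
    (h : ∀ r : unitInterval, γ r = f r) (s : unitInterval) :
    primitive V γ s = ∫ r in (0 : ℝ)..s, f r := by
  rw [primitive_apply]
  refine intervalIntegral.integral_congr fun r hr => ?_
  rw [uIcc_of_le s.2.1] at hr
  have hr' : r ∈ Icc (0 : ℝ) 1 := ⟨hr.1, hr.2.trans s.2.2⟩
  change IccExtend zero_le_one γ r = f r
  rw [IccExtend_of_mem _ _ hr', h]

/-- The path `s ↦ (p, s)`, as a function of `p`. -/
noncomputable def paramPath (E : Type) [NormedAddCommGroup E] [NormedSpace ℝ E] (p : E) :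
    C(unitInterval, E × ℝ) := ⟨fun s => (p, s), by fun_prop⟩

theorem hasFDerivAt_paramPath (p : E) : HasFDerivAt (paramPath E)
    (((ContinuousLinearMap.inl ℝ E ℝ).compLeftContinuous ℝ unitInterval).comp
      (ContinuousLinearMap.const ℝ unitInterval : E →L[ℝ] C(unitInterval, E))) p := by
  have : paramPath E = fun p =>
      (((ContinuousLinearMap.inl ℝ E ℝ).compLeftContinuous ℝ unitInterval).comp
      (ContinuousLinearMap.const ℝ unitInterval : E →L[ℝ] C(unitInterval, E))) p
        + paramPath E 0 := by
    ext p s <;> simp [paramPath]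
  rw [this]
  exact (ContinuousLinearMap.hasFDerivAt _).add_const _

/-- The integral is a continuous linear functional of the curve `s ↦ f (p, s)`, and that curve is a
superposition operator applied to a path affine in `p`. Differentiation under the integral sign
becomes the chain rule. -/
theorem contDiff_integral_and_hasFDerivAt [CompleteSpace V] {f : E × ℝ → V}
    (hf : ContDiff ℝ ∞ f) :
    ContDiff ℝ ∞ (fun p => ∫ s in (0 : ℝ)..1, f (p, s)) ∧
    ∀ p u, fderiv ℝ (fun p => ∫ s in (0 : ℝ)..1, f (p, s)) p u =
      ∫ s in (0 : ℝ)..1, fderiv ℝ f (p, s) (u, 0) := by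
  set ev := (ContinuousMap.evalCLM ℝ (1 : unitInterval) : C(unitInterval, V) →L[ℝ] V)
  set fC : C(E × ℝ, V) := ⟨f, hf.continuous⟩
  have key : (fun p => ∫ s in (0 : ℝ)..1, f (p, s)) =
      fun p => ev (primitive V (superpose unitInterval fC (paramPath E p))) := by
    funext p
    exact (primitive_apply_eq (f := fun s => f (p, s)) (fun r => rfl) 1).symm
  have hpath : ContDiff ℝ ∞ (paramPath E) := by
    rw [contDiff_infty_iff_fderiv]
    refine ⟨fun p => (hasFDerivAt_paramPath p).differentiableAt, ?_⟩
    rw [show fderiv ℝ (paramPath E) = fun _ => _ from funext fun p =>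
      (hasFDerivAt_paramPath p).fderiv]
    exact contDiff_const
  refine ⟨?_, fun p u => ?_⟩
  · rw [key]
    exact ev.contDiff.comp ((primitive V).contDiff.comp ((contDiff_superpose fC hf).comp hpath))
  · have h1 := (hasFDerivAt_superpose (X := unitInterval) fC (hf.of_le (by simp)) (paramPath E p)).comp p
      (hasFDerivAt_paramPath p)
    have h2 := (ev.comp (primitive V)).hasFDerivAt.comp p h1
    rw [key]
    change fderiv ℝ ((ev.comp (primitive V)) ∘ (superpose unitInterval fC ∘ paramPath E)) p u = _
    rw [h2.fderiv]
    exact (primitive_apply_eq (f := fun s => fderiv ℝ f (p, s) (u, 0)) (fun r => rfl) 1)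

end Integral

/-! ### Germs of smooth maps -/

section Germs

variable {E F G V V' : Type} [NormedAddCommGroup E] [NormedSpace ℝ E]
  [NormedAddCommGroup F] [NormedSpace ℝ F] [NormedAddCommGroup G] [NormedSpace ℝ G]
  [NormedAddCommGroup V] [NormedSpace ℝ V] [NormedAddCommGroup V'] [NormedSpace ℝ V']

theorem exists_cutoff [FiniteDimensional ℝ E] {f : E → F} {a : E}
    (hf : ∀ᶠ z in 𝓝 a, ContDiffAt ℝ ∞ f z) :
    ∃ ρ : E → ℝ, (∀ᶠ z in 𝓝 a, ρ z = 1) ∧ ContDiff ℝ ∞ fun z => ρ z • f z := by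
  obtain ⟨r, hr, hr'⟩ := Metric.eventually_nhds_iff_ball.1 hf
  let ρ : ContDiffBump a := ⟨r / 4, r / 2, by positivity, by linarith⟩
  refine ⟨ρ, ρ.eventuallyEq_one, contDiff_iff_contDiffAt.2 fun z => ?_⟩
  by_cases hz : z ∈ Metric.ball a r
  · exact ρ.contDiff.contDiffAt.smul (hr' z hz)
  · have hz' : z ∉ tsupport ρ := by
      rw [ρ.tsupport_eq]
      intro h
      apply hz
      have : dist z a ≤ r / 2 := h
      rw [Metric.mem_ball]
      linarith
    have h0 : (fun z => ρ z • f z) =ᶠ[𝓝 z] fun _ => 0 := by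
      filter_upwards [notMem_tsupport_iff_eventuallyEq.1 hz'] with y hy
      simp [hy]
    exact contDiffAt_const.congr_of_eventuallyEq h0

/-- All arguments concern germs. Passing to globally smooth representatives removes domains from the
later statements. -/
theorem exists_contDiff_eventuallyEq [FiniteDimensional ℝ E] {f : E → F} {a : E}
    (hf : ∀ᶠ z in 𝓝 a, ContDiffAt ℝ ∞ f z) :
    ∃ g : E → F, ContDiff ℝ ∞ g ∧ g =ᶠ[𝓝 a] f := by
  obtain ⟨ρ, hρ, h⟩ := exists_cutoff hf
  exact ⟨_, h, hρ.mono fun z hz => by simp [hz]⟩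

/-- Completeness replaces finite dimension because the lemma is applied to a space of curves. The
inverse is smooth on a whole neighbourhood since invertible operators form an open set. -/
theorem exists_local_inverse_of_complete [CompleteSpace E] [CompleteSpace F] {f : E → F}
    (hf : ContDiff ℝ ∞ f) {a : E} (e : E ≃L[ℝ] F) (he : HasFDerivAt f (e : E →L[ℝ] F) a) :
    ∃ g : F → E, g (f a) = a ∧ (∀ᶠ z in 𝓝 (f a), ContDiffAt ℝ ∞ g z) ∧
      (∀ᶠ z in 𝓝 a, g (f z) = z) ∧ ∀ᶠ z in 𝓝 (f a), f (g z) = z := by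
  have hfa := hf.contDiffAt (x := a)
  let φ := hfa.toOpenPartialHomeomorph f he (by simp)
  have hφ : (φ : E → F) = f := rfl
  have ha : a ∈ φ.source := hfa.mem_toOpenPartialHomeomorph_source he (by simp)
  have hfa' : f a ∈ φ.target := φ.map_source ha
  have hga : φ.symm (f a) = a := φ.left_inv ha
  refine ⟨φ.symm, hga, ?_, ?_, ?_⟩
  · have hopen : ∀ᶠ z in 𝓝 (f a), ∃ e' : E ≃L[ℝ] F,
        fderiv ℝ f (φ.symm z) = (e' : E →L[ℝ] F) := by
      have hc : ContinuousAt (fun z => fderiv ℝ f (φ.symm z)) (f a) :=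
        (hf.continuous_fderiv (by simp)).continuousAt.comp (φ.continuousAt_symm hfa')
      have hn := ContinuousLinearEquiv.nhds e
      have hval : fderiv ℝ f (φ.symm (f a)) = e := by rw [hga, he.fderiv]
      have hc' := hc.tendsto
      simp only [hval] at hc'
      filter_upwards [hc' hn] with z ⟨e', he'⟩
      exact ⟨e', he'.symm⟩
    filter_upwards [hopen, φ.open_target.mem_nhds hfa'] with z ⟨e', he'⟩ hz
    refine φ.contDiffAt_symm (f₀' := e') hz ?_ hf.contDiffAt
    rw [hφ, ← he']
    exact (hf.differentiable (by simp) _).hasFDerivAt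
  · filter_upwards [φ.open_source.mem_nhds ha] with z hz using φ.left_inv hz
  · filter_upwards [φ.open_target.mem_nhds hfa'] with z hz using φ.right_inv hz

/-- `Ψ` and `Θ` are smooth maps whose germs at `g` and `a` are inverse to each other. -/
structure GermInverse (Ψ : G → E) (Θ : E → G) (g : G) (a : E) : Prop where
  smooth : ContDiff ℝ ∞ Ψ
  smooth_inv : ContDiff ℝ ∞ Θ
  map_base : Ψ g = a
  inv_base : Θ a = g
  left_inv : ∀ᶠ z in 𝓝 g, Θ (Ψ z) = z
  right_inv : ∀ᶠ z in 𝓝 a, Ψ (Θ z) = z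

theorem exists_germInverse [FiniteDimensional ℝ E] [FiniteDimensional ℝ F] {f : E → F}
    (hf : ContDiff ℝ ∞ f) {a : E} (e : E ≃L[ℝ] F) (he : HasFDerivAt f (e : E →L[ℝ] F) a) :
    ∃ g : F → E, GermInverse f g a (f a) := by
  have := FiniteDimensional.complete ℝ E
  have := FiniteDimensional.complete ℝ F
  obtain ⟨g₀, h0, h1, h2, h3⟩ := exists_local_inverse_of_complete hf e he
  obtain ⟨g, hg, hgg⟩ := exists_contDiff_eventuallyEq h1
  refine ⟨g, hf, hg, rfl, hgg.eq_of_nhds.trans h0, ?_, ?_⟩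
  · filter_upwards [h2, hf.continuous.continuousAt.eventually hgg] with z hz hz'
    rw [hz', hz]
  · filter_upwards [h3, hgg] with z hz hz'
    rw [hz', hz]

theorem GermInverse.symm {Ψ : G → E} {Θ : E → G} {g : G} {a : E} (h : GermInverse Ψ Θ g a) :
    GermInverse Θ Ψ a g :=
  ⟨h.smooth_inv, h.smooth, h.inv_base, h.map_base, h.right_inv, h.left_inv⟩

theorem GermInverse.tendsto {Ψ : G → E} {Θ : E → G} {g : G} {a : E} (h : GermInverse Ψ Θ g a) :
    Tendsto Ψ (𝓝 g) (𝓝 a) := by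
  have := h.smooth.continuous.tendsto g
  rwa [h.map_base] at this

theorem GermInverse.fderiv_comp {Ψ : G → E} {Θ : E → G} {g : G} {a : E}
    (h : GermInverse Ψ Θ g a) :
    ∀ᶠ z in 𝓝 a, ∀ v, fderiv ℝ Ψ (Θ z) (fderiv ℝ Θ z v) = v := by
  filter_upwards [h.right_inv.eventually_nhds] with z hz v
  have h1 : HasFDerivAt (fun z => Ψ (Θ z)) ((fderiv ℝ Ψ (Θ z)).comp (fderiv ℝ Θ z)) z :=
    ((h.smooth.differentiable (by simp) _).hasFDerivAt).comp z
      ((h.smooth_inv.differentiable (by simp) _).hasFDerivAt)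
  have h2 : HasFDerivAt (fun z => Ψ (Θ z)) (ContinuousLinearMap.id ℝ E) z :=
    (hasFDerivAt_id z).congr_of_eventuallyEq hz
  exact DFunLike.congr_fun (h1.unique h2) v

/-- Smooth families of uniquely solvable linear equations have smooth solutions. -/
theorem exists_smooth_solution [FiniteDimensional ℝ E] [FiniteDimensional ℝ V]
    [FiniteDimensional ℝ V'] (hdim : Module.finrank ℝ V = Module.finrank ℝ V')
    {A : E → V →L[ℝ] V'} (hA : ContDiff ℝ ∞ A) {a : E} (ha : ∀ v, A a v = 0 → v = 0)
    {b : E → V'} (hb : ContDiff ℝ ∞ b) :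
    ∃ w : E → V, ContDiff ℝ ∞ w ∧ ∀ᶠ z in 𝓝 a, A z (w z) = b z := by
  have := FiniteDimensional.complete ℝ V
  let e : V ≃L[ℝ] V' := (LinearEquiv.ofInjectiveOfFinrankEq (A a : V →ₗ[ℝ] V')
    ((injective_iff_map_eq_zero _).2 ha) hdim).toContinuousLinearEquiv
  have he : A a = e := by ext v; rfl
  have hopen : ∀ᶠ z in 𝓝 a, ∃ e' : V ≃L[ℝ] V', A z = (e' : V →L[ℝ] V') := by
    filter_upwards [hA.continuous.continuousAt.eventually
      (by rw [he]; exact ContinuousLinearEquiv.nhds e)] with z ⟨e', he'⟩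
    exact ⟨e', he'.symm⟩
  have hsm : ∀ᶠ z in 𝓝 a, ContDiffAt ℝ ∞ (fun z => (A z).inverse (b z)) z := by
    filter_upwards [hopen] with z ⟨e', he'⟩
    have h1 : ContDiffAt ℝ ∞ (fun z => (A z).inverse) z :=
      ContDiffAt.comp z (g := ContinuousLinearMap.inverse)
        (by rw [he']; exact contDiffAt_map_inverse e') hA.contDiffAt
    exact h1.clm_apply hb.contDiffAt
  obtain ⟨w, hw, hww⟩ := exists_contDiff_eventuallyEq hsm
  refine ⟨w, hw, ?_⟩
  filter_upwards [hww, hopen] with z hz ⟨e', he'⟩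
  rw [hz, he', ContinuousLinearMap.inverse_equiv]
  simp

/-- A nonzero linear form is the second component of a linear isomorphism. -/
theorem exists_equiv_prod_snd [FiniteDimensional ℝ E] [FiniteDimensional ℝ F]
    (hdim : Module.finrank ℝ E = Module.finrank ℝ F + 1) {l : E →L[ℝ] ℝ} (hl : l ≠ 0) :
    ∃ e : E ≃L[ℝ] F × ℝ, ∀ v, (e v).2 = l v := by
  have hsurj : Function.Surjective (l : E →ₗ[ℝ] ℝ) :=
    LinearMap.surjective (by simpa using fun h => hl (by ext v; exact DFunLike.congr_fun h v))
  obtain ⟨w, hw⟩ := hsurj 1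
  have hw : l w = 1 := hw
  have hker : Module.finrank ℝ (LinearMap.ker (l : E →ₗ[ℝ] ℝ)) = Module.finrank ℝ F := by
    have h := LinearMap.finrank_range_add_finrank_ker (l : E →ₗ[ℝ] ℝ)
    rw [LinearMap.range_eq_top.2 hsurj, finrank_top, Module.finrank_self] at h
    omega
  let i := LinearEquiv.ofFinrankEq _ _ hker
  let p : E →ₗ[ℝ] LinearMap.ker (l : E →ₗ[ℝ] ℝ) :=
    (LinearMap.id - (l : E →ₗ[ℝ] ℝ).smulRight w).codRestrict _ (by
      intro v; simp [hw])
  let f : E →ₗ[ℝ] F × ℝ := (i.toLinearMap ∘ₗ p).prod (l : E →ₗ[ℝ] ℝ)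
  have hf : Function.Injective f := by
    rw [injective_iff_map_eq_zero]
    intro v hv
    have h2 : l v = 0 := congrArg Prod.snd hv
    have h1 : i (p v) = 0 := congrArg Prod.fst hv
    have h3 : p v = 0 := by simpa using h1
    have h4 : v - l v • w = 0 := congrArg Subtype.val h3
    simpa [h2] using h4
  exact ⟨(LinearEquiv.ofInjectiveOfFinrankEq f hf (by simp [hdim])).toContinuousLinearEquiv,
    fun v => rfl⟩

/-- A nonzero vector is the second basis direction for a linear isomorphism with a product. -/
theorem exists_equiv_prod_symm [FiniteDimensional ℝ E] [FiniteDimensional ℝ F]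
    (hdim : Module.finrank ℝ E = Module.finrank ℝ F + 1) {w : E} (hw : w ≠ 0) :
    ∃ e : E ≃L[ℝ] F × ℝ, e w = (0, 1) := by
  obtain ⟨l, hl⟩ := SeparatingDual.exists_eq_one (R := ℝ) hw
  obtain ⟨e, he⟩ := exists_equiv_prod_snd (F := F) hdim
    (l := l) (by rintro rfl; simp at hl)
  -- A shear along `l` removes the first component of `e w` and leaves second components unchanged.
  let f : E →ₗ[ℝ] F × ℝ :=
    (e.toLinearMap - (l : E →ₗ[ℝ] ℝ).smulRight ((e w).1, (0 : ℝ)))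
  have hfv : ∀ v, f v = ((e v).1 - l v • (e w).1, l v) := by
    intro v
    ext <;> simp [f, he]
  have hf : Function.Injective f := by
    rw [injective_iff_map_eq_zero]
    intro v hv
    rw [hfv] at hv
    have h2 : l v = 0 := congrArg Prod.snd hv
    have h1 : (e v).1 - l v • (e w).1 = 0 := congrArg Prod.fst hv
    rw [h2, zero_smul, sub_zero] at h1
    exact e.injective (by rw [map_zero]; exact Prod.ext h1 ((he v).trans h2))
  refine ⟨(LinearEquiv.ofInjectiveOfFinrankEq f hf (by simp [hdim])).toContinuousLinearEquiv, ?_⟩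
  change f w = _
  rw [hfv, hl, one_smul, sub_self]

/-- A function on a product whose derivative along the line factor vanishes near `0` is, near `0`,
a function of the first component. -/
theorem eventually_eq_of_fderiv_snd_eq_zero {f : E × ℝ → V} (hf : ContDiff ℝ ∞ f)
    (h : ∀ᶠ p in 𝓝 (0 : E × ℝ), fderiv ℝ f p (0, 1) = 0) :
    ∀ᶠ p in 𝓝 (0 : E × ℝ), f p = f (p.1, 0) := by
  obtain ⟨r, hr, hr'⟩ := Metric.eventually_nhds_iff_ball.1 h
  filter_upwards [Metric.ball_mem_nhds _ hr] with p hp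
  obtain ⟨k, t⟩ := p
  -- A nondegenerate segment is needed for derivatives within it to be unique.
  rcases eq_or_ne t 0 with rfl | ht
  · rfl
  have hmem : ∀ s ∈ uIcc 0 t, ((k, s) : E × ℝ) ∈ Metric.ball (0 : E × ℝ) r := by
    intro s hs
    rw [mem_ball_zero_iff, Prod.norm_mk, max_lt_iff] at hp ⊢
    refine ⟨hp.1, lt_of_le_of_lt ?_ hp.2⟩
    have := abs_sub_left_of_mem_uIcc hs
    simpa using this
  have hd : ∀ s, HasDerivAt (fun s => f (k, s)) (fderiv ℝ f (k, s) (0, 1)) s := fun s =>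
    ((hf.differentiable (by simp) (k, s)).hasFDerivAt).comp_hasDerivAt s
      ((hasDerivAt_const s k).prodMk (hasDerivAt_id s))
  have := (convex_uIcc (0 : ℝ) t).is_const_of_fderivWithin_eq_zero (𝕜 := ℝ)
    (f := fun s => f (k, s)) (fun s _ => (hd s).differentiableAt.differentiableWithinAt)
    (fun s hs => ?_) right_mem_uIcc left_mem_uIcc
  · exact this
  · rw [fderivWithin_eq_fderiv
      ((uniqueDiffOn_convex (convex_uIcc 0 t) (by
        rw [uIcc, interior_Icc]
        exact nonempty_Ioo.2 (by
          rcases lt_or_gt_of_ne ht with h | h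
          · simpa [h.le] using h
          · simpa [h.le] using h))) s hs) (hd s).differentiableAt]
    ext
    simp [(hd s).hasFDerivAt.fderiv, hr' _ (hmem s hs)]

end Germs

/-! ### Smooth local flows and straightening of vector fields -/

section Flow

variable {E K : Type} [NormedAddCommGroup E] [NormedSpace ℝ E] [FiniteDimensional ℝ E]
  [NormedAddCommGroup K] [NormedSpace ℝ K] [FiniteDimensional ℝ K]

/-- The zeros of this map are the curves `γ` with `γ' = t W(γ)` and `γ(0) = z`, together with the
parameters `(z, t)`. -/
noncomputable def flowEquation (W : C(E, E)) (q : (E × ℝ) × C(unitInterval, E)) :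
    (E × ℝ) × C(unitInterval, E) :=
  (q.1, q.2 - ContinuousMap.const _ q.1.1 - q.1.2 • primitive E (superpose unitInterval W q.2))

theorem contDiff_flowEquation (W : C(E, E)) (hW : ContDiff ℝ ∞ W) :
    ContDiff ℝ ∞ (flowEquation W) := by
  have h1 : ContDiff ℝ ∞ fun q : (E × ℝ) × C(unitInterval, E) =>
      ContinuousMap.const unitInterval q.1.1 :=
    (ContinuousLinearMap.const ℝ unitInterval : E →L[ℝ] C(unitInterval, E)).contDiff.comp
      (contDiff_fst.comp contDiff_fst)
  have h2 : ContDiff ℝ ∞ fun q : (E × ℝ) × C(unitInterval, E) =>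
      primitive E (superpose unitInterval W q.2) :=
    (primitive E).contDiff.comp ((contDiff_superpose W hW).comp contDiff_snd)
  exact contDiff_fst.prodMk ((contDiff_snd.sub h1).sub ((contDiff_snd.comp contDiff_fst).smul h2))

/-- The shear `(p, γ) ↦ (p, γ + A p)`. -/
noncomputable def shear {P C : Type} [NormedAddCommGroup P] [NormedSpace ℝ P]
    [NormedAddCommGroup C] [NormedSpace ℝ C] (A : P →L[ℝ] C) : (P × C) ≃L[ℝ] (P × C) :=
  ContinuousLinearEquiv.equivOfInverse
    ((ContinuousLinearMap.fst ℝ P C).prod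
      (ContinuousLinearMap.snd ℝ P C + A.comp (ContinuousLinearMap.fst ℝ P C)))
    ((ContinuousLinearMap.fst ℝ P C).prod
      (ContinuousLinearMap.snd ℝ P C - A.comp (ContinuousLinearMap.fst ℝ P C)))
    (fun q => by simp) (fun q => by simp)

/-- The integral term carries the factor `t`, which is zero at the base point, so its variation in
the curve drops out. What remains is a shear, invertible without any smallness condition on `W`. -/
theorem exists_hasFDerivAt_flowEquation (W : C(E, E)) (hW : ContDiff ℝ ∞ W) (a : E) :
    ∃ e : ((E × ℝ) × C(unitInterval, E)) ≃L[ℝ] ((E × ℝ) × C(unitInterval, E)),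
      HasFDerivAt (flowEquation W)
        (e : ((E × ℝ) × C(unitInterval, E)) →L[ℝ] ((E × ℝ) × C(unitInterval, E)))
        ((a, 0), ContinuousMap.const _ a) := by
  let c : E →L[ℝ] C(unitInterval, E) := ContinuousLinearMap.const ℝ unitInterval
  let j := primitive E (superpose unitInterval W (ContinuousMap.const _ a))
  refine ⟨shear (-(c.comp (ContinuousLinearMap.fst ℝ E ℝ)) -
    (ContinuousLinearMap.snd ℝ E ℝ).smulRight j), ?_⟩
  set q₀ : (E × ℝ) × C(unitInterval, E) := ((a, 0), ContinuousMap.const _ a)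
  have h1 : HasFDerivAt (fun q : (E × ℝ) × C(unitInterval, E) => c q.1.1)
      (c.comp ((ContinuousLinearMap.fst ℝ E ℝ).comp (ContinuousLinearMap.fst ℝ _ _))) q₀ :=
    (c.hasFDerivAt (x := a)).comp q₀
      ((hasFDerivAt_fst (p := q₀.1)).comp q₀ hasFDerivAt_fst)
  have h2 : HasFDerivAt (fun q : (E × ℝ) × C(unitInterval, E) => q.1.2)
      ((ContinuousLinearMap.snd ℝ E ℝ).comp (ContinuousLinearMap.fst ℝ _ _)) q₀ :=
    (hasFDerivAt_snd (p := q₀.1)).comp q₀ hasFDerivAt_fst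
  have h3 : HasFDerivAt (fun q : (E × ℝ) × C(unitInterval, E) =>
      primitive E (superpose unitInterval W q.2)) _ q₀ :=
    (primitive E).hasFDerivAt.comp q₀ ((hasFDerivAt_superpose W (hW.of_le (by simp)) _).comp q₀
      hasFDerivAt_snd)
  refine (hasFDerivAt_fst.prodMk ((hasFDerivAt_snd.sub h1).sub (h2.smul h3))).congr_fderiv ?_
  refine ContinuousLinearMap.ext fun q => Prod.ext rfl ?_
  ext s
  simp [shear, q₀, j, c]
  abel

theorem flowEquation_eq_zero_iff {W : C(E, E)} {p : E × ℝ} {γ : C(unitInterval, E)} :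
    (flowEquation W (p, γ)).2 = 0 ↔
      ∀ s : unitInterval, γ s = p.1 + p.2 • ∫ r in (0 : ℝ)..s, W (IccExtend zero_le_one γ r) := by
  have key : ∀ s : unitInterval, primitive E (superpose unitInterval W γ) s =
      ∫ r in (0 : ℝ)..s, W (IccExtend zero_le_one γ r) := fun s =>
    primitive_apply_eq (f := fun r => W (IccExtend zero_le_one γ r))
      (fun r => by simp [IccExtend_val]) s
  rw [ContinuousMap.ext_iff]
  refine forall_congr' fun s => ?_
  simp only [flowEquation, ContinuousMap.sub_apply, ContinuousMap.const_apply,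
    ContinuousMap.smul_apply, key, ContinuousMap.zero_apply]
  rw [sub_sub, sub_eq_zero]

/-- An orbit stopped at the fraction `s` of its time and rescaled is an orbit for time `s * t`.
Together with local uniqueness this identifies the points of one solution curve with endpoints of
others. -/
theorem flowEquation_reparam {W : C(E, E)} {z : E} {t : ℝ} {γ : C(unitInterval, E)}
    (h : (flowEquation W ((z, t), γ)).2 = 0) (s : unitInterval) :
    (flowEquation W ((z, s * t), ⟨fun r => γ (s * r), by fun_prop⟩)).2 = 0 := by
  rw [flowEquation_eq_zero_iff] at h ⊢
  intro u
  have h1 := h (s * u)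
  have h2 : ∫ r in (0 : ℝ)..u, W (IccExtend zero_le_one
      (fun r : unitInterval => γ (s * r)) r) =
      ∫ r in (0 : ℝ)..u, W (IccExtend zero_le_one γ (s * r)) := by
    refine intervalIntegral.integral_congr fun r hr => ?_
    rw [uIcc_of_le u.2.1] at hr
    have hr' : r ∈ Icc (0 : ℝ) 1 := ⟨hr.1, hr.2.trans u.2.2⟩
    have hsr : (s : ℝ) * r ∈ Icc (0 : ℝ) 1 :=
      ⟨mul_nonneg s.2.1 hr'.1, mul_le_one₀ s.2.2 hr'.1 hr'.2⟩
    simp only [IccExtend_of_mem _ _ hr', IccExtend_of_mem _ _ hsr]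
    rfl
  change γ (s * u) = z + ((s : ℝ) * t) • ∫ r in (0 : ℝ)..u, W (IccExtend zero_le_one
      (fun r : unitInterval => γ (s * r)) r)
  rw [h1, h2, mul_comm (s : ℝ) t, mul_smul,
    intervalIntegral.smul_integral_comp_mul_left (fun r => W (IccExtend zero_le_one γ r))]
  simp

/-- A smooth vector field has a smooth local flow. -/
theorem exists_smooth_flow {W : E → E} (hW : ContDiff ℝ ∞ W) (a : E) :
    ∃ F : E × ℝ → E, ContDiff ℝ ∞ F ∧ (∀ᶠ z in 𝓝 a, F (z, 0) = z) ∧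
      ∀ᶠ p in 𝓝 (a, (0 : ℝ)), fderiv ℝ F p (0, 1) = W (F p) := by
  have : CompleteSpace E := FiniteDimensional.complete ℝ E
  let WC : C(E, E) := ⟨W, hW.continuous⟩
  obtain ⟨e, he⟩ := exists_hasFDerivAt_flowEquation WC hW a
  obtain ⟨g, hg0, hg1, hg2, hg3⟩ :=
    exists_local_inverse_of_complete (contDiff_flowEquation WC hW) e he
  have hbase : flowEquation WC ((a, 0), ContinuousMap.const _ a) = ((a, 0), 0) := by
    ext <;> simp [flowEquation]
  rw [hbase] at hg0 hg1 hg3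
  -- `Γ (z, t)` is the curve that solves the flow equation with data `(z, t)`; the flow is its
  -- endpoint at parameter `1`.
  let Γ : E × ℝ → C(unitInterval, E) := fun p => (g (p, 0)).2
  have hin : Tendsto (fun p : E × ℝ => (p, (0 : C(unitInterval, E)))) (𝓝 (a, 0))
      (𝓝 ((a, 0), 0)) := by
    exact (Continuous.prodMk continuous_id continuous_const).tendsto (a, (0 : ℝ))
  have hΓs : ∀ᶠ p in 𝓝 (a, (0 : ℝ)), ContDiffAt ℝ ∞ Γ p := by
    filter_upwards [hin.eventually hg1] with p hp
    exact contDiffAt_snd.comp p (hp.comp p (contDiffAt_id.prodMk contDiffAt_const))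
  have hΓ0 : Γ (a, 0) = ContinuousMap.const _ a := congrArg Prod.snd hg0
  have hΓeq : ∀ᶠ p in 𝓝 (a, (0 : ℝ)), (flowEquation WC (p, Γ p)).2 = 0 := by
    filter_upwards [hin.eventually hg3] with p hp
    have h1 : (g (p, 0)).1 = p := congrArg Prod.fst hp
    have h2 : g (p, 0) = (p, Γ p) := Prod.ext h1 rfl
    rw [← h2, hp]
  let ev : C(unitInterval, E) →L[ℝ] E := ContinuousMap.evalCLM ℝ (1 : unitInterval)
  obtain ⟨F, hF, hFΓ⟩ := exists_contDiff_eventuallyEq (f := fun p => ev (Γ p))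
    (hΓs.mono fun p hp => ev.contDiff.contDiffAt.comp p hp)
  obtain ⟨r₁, hr₁, hr₁'⟩ := Metric.eventually_nhds_iff_ball.1 hg2
  have hΓc : ∀ᶠ p in 𝓝 (a, (0 : ℝ)), Γ p ∈ Metric.ball (ContinuousMap.const _ a) r₁ := by
    have := hΓs.self_of_nhds.continuousAt.tendsto
    rw [hΓ0] at this
    exact this (Metric.ball_mem_nhds _ hr₁)
  obtain ⟨r₂, hr₂, hr₂'⟩ := Metric.eventually_nhds_iff_ball.1 (hΓeq.and (hΓc.and hFΓ))
  set r := min r₁ r₂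
  have hr : 0 < r := lt_min hr₁ hr₂
  have hscale : ∀ z t, ((z, t) : E × ℝ) ∈ Metric.ball (a, (0 : ℝ)) r → ∀ s : unitInterval,
      ((z, (s : ℝ) * t) : E × ℝ) ∈ Metric.ball (a, (0 : ℝ)) r := by
    intro z t h s
    rw [Metric.mem_ball, Prod.dist_eq, max_lt_iff] at h ⊢
    refine ⟨h.1, lt_of_le_of_lt ?_ h.2⟩
    simp only [dist_zero_right, norm_mul, Real.norm_eq_abs, abs_of_nonneg s.2.1]
    exact mul_le_of_le_one_left (abs_nonneg _) s.2.2
  have hsub : ∀ p ∈ Metric.ball (a, (0 : ℝ)) r, p ∈ Metric.ball (a, (0 : ℝ)) r₂ := fun p hp =>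
    Metric.ball_subset_ball (min_le_right _ _) hp
  -- Both the rescaled curve and `Γ (z, s * t)` solve the equation near the base point, where the
  -- flow equation has a left inverse, so they coincide.
  have huniq : ∀ z t, ((z, t) : E × ℝ) ∈ Metric.ball (a, (0 : ℝ)) r → ∀ s : unitInterval,
      F (z, s * t) = Γ (z, t) s := by
    intro z t h s
    have hp := hr₂' _ (hsub _ h)
    set γ := Γ (z, t)
    let γs : C(unitInterval, E) := ⟨fun r => γ (s * r), by fun_prop⟩
    have hγs : (flowEquation WC ((z, s * t), γs)).2 = 0 := flowEquation_reparam hp.1 s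
    have hmem : ((z, (s : ℝ) * t), γs) ∈ Metric.ball ((a, (0 : ℝ)), ContinuousMap.const _ a) r₁ := by
      rw [Metric.mem_ball, Prod.dist_eq, max_lt_iff]
      refine ⟨Metric.ball_subset_ball (min_le_left _ _) (hscale z t h s), ?_⟩
      exact (ContinuousMap.dist_lt_iff hr₁).2 fun r =>
        (ContinuousMap.dist_apply_le_dist (f := γ) (g := ContinuousMap.const _ a) _).trans_lt hp.2.1
    have h1 := hr₁' _ hmem
    have h2 : flowEquation WC ((z, s * t), γs) = ((z, (s : ℝ) * t), 0) := Prod.ext rfl hγs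
    rw [h2] at h1
    have h3 : Γ (z, s * t) = γs := congrArg Prod.snd h1
    rw [(hr₂' _ (hsub _ (hscale z t h s))).2.2]
    change Γ (z, s * t) 1 = γ s
    rw [h3]
    change γ (s * 1) = γ s
    rw [mul_one]
  -- The equation for the curve becomes the integral equation for `F` after the substitution `τ = r
  -- * t`; its derivative in `t` is then the fundamental theorem of calculus.
  have hint : ∀ z t, ((z, t) : E × ℝ) ∈ Metric.ball (a, (0 : ℝ)) r →
      F (z, t) = z + ∫ τ in (0 : ℝ)..t, W (F (z, τ)) := by
    intro z t h
    have hp := (hr₂' _ (hsub _ h)).1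
    rw [flowEquation_eq_zero_iff] at hp
    have h1 := hp 1
    rw [← huniq z t h 1] at h1
    simp only [Icc.coe_one, one_mul] at h1
    rw [h1]
    congr 1
    have h2 : ∫ r in (0 : ℝ)..1, WC (IccExtend zero_le_one (Γ (z, t)) r) =
        ∫ r in (0 : ℝ)..1, W (F (z, r * t)) := by
      refine intervalIntegral.integral_congr fun r hr => ?_
      rw [uIcc_of_le zero_le_one] at hr
      simp only [IccExtend_of_mem _ _ hr]
      rw [← huniq z t h ⟨r, hr⟩]
      rfl
    rw [h2, intervalIntegral.smul_integral_comp_mul_right (fun τ => W (F (z, τ)))]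
    simp
  refine ⟨F, hF, ?_, ?_⟩
  · have : Tendsto (fun z : E => (z, (0 : ℝ))) (𝓝 a) (𝓝 (a, 0)) :=
      (Continuous.prodMk continuous_id continuous_const).tendsto a
    filter_upwards [this.eventually (Metric.ball_mem_nhds _ hr)] with z hz
    rw [hint z 0 hz]
    simp
  · filter_upwards [Metric.isOpen_ball.mem_nhds (Metric.mem_ball_self hr)] with p hp
    obtain ⟨z, t⟩ := p
    have h1 : HasDerivAt (fun t => F (z, t)) (fderiv ℝ F (z, t) (0, 1)) t :=
      ((hF.differentiable (by simp) (z, t)).hasFDerivAt).comp_hasDerivAt t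
        ((hasDerivAt_const t z).prodMk (hasDerivAt_id t))
    have hc : Continuous fun τ => W (F (z, τ)) :=
      hW.continuous.comp (hF.continuous.comp (by fun_prop))
    have h2 : HasDerivAt (fun t => z + ∫ τ in (0 : ℝ)..t, W (F (z, τ))) (W (F (z, t))) t :=
      (intervalIntegral.integral_hasDerivAt_right (hc.intervalIntegrable _ _)
        hc.stronglyMeasurable.stronglyMeasurableAtFilter hc.continuousAt).const_add z
    have hev : (fun t => F (z, t)) =ᶠ[𝓝 t] fun t => z + ∫ τ in (0 : ℝ)..t, W (F (z, τ)) := by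
      have : Tendsto (fun t : ℝ => (z, t)) (𝓝 t) (𝓝 (z, t)) :=
        (Continuous.prodMk continuous_const continuous_id).tendsto t
      filter_upwards [this.eventually (Metric.isOpen_ball.mem_nhds hp)] with τ hτ
      exact hint z τ hτ
    exact h1.unique (h2.congr_of_eventuallyEq hev)

/-- Straightening of a vector field along a transverse section. -/
theorem exists_flow_box {W : E → E} (hW : ContDiff ℝ ∞ W) {σ : K → E} (hσ : ContDiff ℝ ∞ σ)
    (e : E ≃L[ℝ] K × ℝ) (hσe : ∀ k, fderiv ℝ σ 0 k = e.symm (k, 0))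
    (hWe : e (W (σ 0)) = (0, 1)) :
    ∃ (Ψ : K × ℝ → E) (Θ : E → K × ℝ), GermInverse Ψ Θ 0 (σ 0) ∧
      (∀ᶠ k in 𝓝 (0 : K), Ψ (k, 0) = σ k) ∧
      ∀ᶠ p in 𝓝 (0 : K × ℝ), fderiv ℝ Ψ p (0, 1) = W (Ψ p) := by
  obtain ⟨F, hF, hF0, hFW⟩ := exists_smooth_flow hW (σ 0)
  let i : K × ℝ → E × ℝ := fun p => (σ p.1, p.2)
  have hi : ContDiff ℝ ∞ i := (hσ.comp contDiff_fst).prodMk contDiff_snd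
  let Ψ : K × ℝ → E := fun p => F (i p)
  have hΨ : ContDiff ℝ ∞ Ψ := hF.comp hi
  have hi0 : Tendsto i (𝓝 0) (𝓝 (σ 0, 0)) := hi.continuous.tendsto 0
  have hΨ0 : ∀ᶠ k in 𝓝 (0 : K), Ψ (k, 0) = σ k := by
    filter_upwards [hσ.continuous.continuousAt.eventually hF0] with k hk using hk
  have hΨt : ∀ᶠ p in 𝓝 (0 : K × ℝ), fderiv ℝ Ψ p (0, 1) = W (Ψ p) := by
    filter_upwards [hi0.eventually hFW] with p hp
    have h1 : HasFDerivAt i (((fderiv ℝ σ p.1).comp (ContinuousLinearMap.fst ℝ K ℝ)).prod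
        (ContinuousLinearMap.snd ℝ K ℝ)) p :=
      (((hσ.differentiable (by simp) _).hasFDerivAt).comp p hasFDerivAt_fst).prodMk hasFDerivAt_snd
    have h2 : HasFDerivAt Ψ _ p := ((hF.differentiable (by simp) _).hasFDerivAt).comp p h1
    rw [h2.fderiv, ← hp]
    simp
  have hΨσ : Ψ 0 = σ 0 := hΨ0.self_of_nhds
  -- On `K` the derivative is that of the section, on the line it is `W (σ 0)`; the hypotheses on
  -- `e` say that together they form `e.symm`.
  have hd : HasFDerivAt Ψ (e.symm : K × ℝ →L[ℝ] E) 0 := by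
    have h1 := (hΨ.differentiable (by simp) 0).hasFDerivAt
    refine h1.congr_fderiv (ContinuousLinearMap.ext fun q => ?_)
    obtain ⟨k, t⟩ := q
    have h2 : fderiv ℝ Ψ 0 (k, 0) = e.symm (k, 0) := by
      rw [← hσe]
      have h3 : HasFDerivAt (fun k : K => Ψ (k, 0)) ((fderiv ℝ Ψ 0).comp
          (ContinuousLinearMap.inl ℝ K ℝ)) 0 :=
        HasFDerivAt.comp (0 : K) (f := fun k => (k, (0 : ℝ))) h1
          (ContinuousLinearMap.inl ℝ K ℝ).hasFDerivAt
      have h4 : HasFDerivAt σ ((fderiv ℝ Ψ 0).comp (ContinuousLinearMap.inl ℝ K ℝ)) 0 :=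
        h3.congr_of_eventuallyEq (hΨ0.mono fun k hk => hk.symm)
      rw [h4.fderiv]
      simp
    have h5 : fderiv ℝ Ψ 0 (0, 1) = e.symm (0, 1) := by
      rw [hΨt.self_of_nhds, hΨσ, ← hWe, e.symm_apply_apply]
    have h6 : ((k, t) : K × ℝ) = (k, 0) + t • (0, 1) := by simp
    rw [h6, map_add, map_smul, h2, h5, ContinuousLinearEquiv.coe_coe, map_add, map_smul]
  obtain ⟨Θ, hΘ⟩ := exists_germInverse hΨ e.symm hd
  rw [hΨσ] at hΘ
  exact ⟨Ψ, Θ, hΘ, hΨ0, hΨt⟩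

end Flow

/-! ### Closed two-forms on normed spaces -/

section Forms

variable {E F K : Type} [NormedAddCommGroup E] [NormedSpace ℝ E]
  [NormedAddCommGroup F] [NormedSpace ℝ F] [NormedAddCommGroup K] [NormedSpace ℝ K]

theorem fderiv_eq_zero_of_eventually {f : E → F} {z : E} (h : ∀ᶠ y in 𝓝 z, f y = 0) :
    fderiv ℝ f z = 0 := by
  have h' : f =ᶠ[𝓝 z] fun _ => 0 := h
  rw [h'.fderiv_eq]
  simp

/-- The exterior derivative of the two-form `η`, given as a family of bilinear forms, vanishes at
`z`. -/
def IsClosedFormAt (η : E → E →L[ℝ] E →L[ℝ] ℝ) (z : E) : Prop :=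
  ∀ u v w, fderiv ℝ η z u v w + fderiv ℝ η z v w u + fderiv ℝ η z w u v = 0

/-- The pullback of a family of bilinear forms. -/
noncomputable def pullbackForm (Φ : E → F) (η : F → F →L[ℝ] F →L[ℝ] ℝ) (z : E) :
    E →L[ℝ] E →L[ℝ] ℝ :=
  (((ContinuousLinearMap.compL ℝ E F ℝ).flip (fderiv ℝ Φ z)).comp (η (Φ z))).comp (fderiv ℝ Φ z)

@[simp] theorem pullbackForm_apply (Φ : E → F) (η : F → F →L[ℝ] F →L[ℝ] ℝ) (z u v : E) :
    pullbackForm Φ η z u v = η (Φ z) (fderiv ℝ Φ z u) (fderiv ℝ Φ z v) := rfl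

theorem contDiff_pullbackForm {Φ : E → F} {η : F → F →L[ℝ] F →L[ℝ] ℝ}
    (hΦ : ContDiff ℝ ∞ Φ) (hη : ContDiff ℝ ∞ η) : ContDiff ℝ ∞ (pullbackForm Φ η) := by
  have h := hΦ.fderiv_right (m := ∞) (by simp)
  exact (((ContinuousLinearMap.contDiff _).comp h).clm_comp (hη.comp hΦ)).clm_comp h

theorem differentiableAt_pullbackForm {Φ : E → F} {η : F → F →L[ℝ] F →L[ℝ] ℝ} {z : E}
    (hΦ : ContDiff ℝ ∞ Φ) (hη : DifferentiableAt ℝ η (Φ z)) :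
    DifferentiableAt ℝ (pullbackForm Φ η) z := by
  have h : DifferentiableAt ℝ (fderiv ℝ Φ) z :=
    (hΦ.fderiv_right (m := ∞) (by simp)).differentiable (by simp) z
  exact (((ContinuousLinearMap.differentiableAt _).comp z h).clm_comp
    (hη.comp z (hΦ.differentiable (by simp) z))).clm_comp h

theorem fderiv_bilin_apply {η : E → F →L[ℝ] K →L[ℝ] ℝ} {z : E} (h : DifferentiableAt ℝ η z)
    (u : E) (v : F) (w : K) :
    fderiv ℝ (fun z => η z v w) z u = fderiv ℝ η z u v w := by
  have h1 := ((h.hasFDerivAt.clm_apply (hasFDerivAt_const v z)).clm_apply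
    (hasFDerivAt_const w z))
  rw [h1.fderiv]
  simp

theorem IsClosedFormAt.sub {η ζ : E → E →L[ℝ] E →L[ℝ] ℝ} {z : E} (h : IsClosedFormAt η z)
    (hη : DifferentiableAt ℝ η z) (hζ : DifferentiableAt ℝ ζ z) (h' : IsClosedFormAt ζ z) :
    IsClosedFormAt (fun z => η z - ζ z) z := by
  have hd : ∀ {η : E → E →L[ℝ] E →L[ℝ] ℝ}, DifferentiableAt ℝ η z → ∀ v w,
      DifferentiableAt ℝ (fun z => η z v w) z := fun h v w =>
    (h.clm_apply (differentiableAt_const v)).clm_apply (differentiableAt_const w)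
  have hsub := DifferentiableAt.fun_sub (𝕜 := ℝ) (E := E) (F := E →L[ℝ] E →L[ℝ] ℝ)
    (f := η) (g := ζ) (x := z) hη hζ
  have key : ∀ u v w, fderiv ℝ (fun z => η z - ζ z) z u v w =
      fderiv ℝ η z u v w - fderiv ℝ ζ z u v w := fun u v w => by
    rw [← fderiv_bilin_apply (η := fun z => η z - ζ z) hsub, ← fderiv_bilin_apply hη, ← fderiv_bilin_apply hζ]
    simp only [sub_apply]
    rw [fderiv_fun_sub (hd hη v w) (hd hζ v w)]
    rfl
  intro u v w
  rw [key, key, key]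
  linarith [h u v w, h' u v w]

/-- Besides the pulled back exterior derivative, the cyclic sum contains terms with the second
derivative of `Φ`. They cancel in pairs, by its symmetry and the antisymmetry of `η`. -/
theorem IsClosedFormAt.pullback {Φ : E → F} {η : F → F →L[ℝ] F →L[ℝ] ℝ} {z : E}
    (hΦ : ContDiff ℝ ∞ Φ) (hη : DifferentiableAt ℝ η (Φ z))
    (halt : ∀ u v, η (Φ z) u v = -η (Φ z) v u) (h : IsClosedFormAt η (Φ z)) :
    IsClosedFormAt (pullbackForm Φ η) z := by
  have hD : HasFDerivAt (fderiv ℝ Φ) (fderiv ℝ (fderiv ℝ Φ) z) z :=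
    ((hΦ.fderiv_right (m := ∞) (by simp)).differentiable (by simp) z).hasFDerivAt
  have hsymm : ∀ u v, fderiv ℝ (fderiv ℝ Φ) z u v = fderiv ℝ (fderiv ℝ Φ) z v u :=
    (hΦ.contDiffAt (x := z)).isSymmSndFDerivAt (by simp; exact WithTop.coe_le_coe.2 (le_top : (2 : ℕ∞) ≤ ⊤))
  have key : ∀ u v w, fderiv ℝ (pullbackForm Φ η) z u v w =
      fderiv ℝ η (Φ z) (fderiv ℝ Φ z u) (fderiv ℝ Φ z v) (fderiv ℝ Φ z w) +
      η (Φ z) (fderiv ℝ (fderiv ℝ Φ) z u v) (fderiv ℝ Φ z w) +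
      η (Φ z) (fderiv ℝ Φ z v) (fderiv ℝ (fderiv ℝ Φ) z u w) := by
    intro u v w
    rw [← fderiv_bilin_apply (differentiableAt_pullbackForm hΦ hη)]
    have h1 := HasFDerivAt.comp (g := η) z hη.hasFDerivAt (hΦ.differentiable (by simp) z).hasFDerivAt
    have h2 := (h1.clm_apply (hD.clm_apply (hasFDerivAt_const v z))).clm_apply
      (hD.clm_apply (hasFDerivAt_const w z))
    change fderiv ℝ (fun z => η (Φ z) (fderiv ℝ Φ z v) (fderiv ℝ Φ z w)) z u = _
    refine (DFunLike.congr_fun h2.fderiv u).trans ?_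
    simp
    ring
  intro u v w
  have h0 := h (fderiv ℝ Φ z u) (fderiv ℝ Φ z v) (fderiv ℝ Φ z w)
  rw [key, key, key, hsymm v u, hsymm w v, hsymm u w,
    halt (fderiv ℝ Φ z w), halt (fderiv ℝ Φ z u), halt (fderiv ℝ Φ z v)]
  linarith

/-- The two-form `df ∧ dg`. -/
noncomputable def wedgeForm (f g : E → ℝ) (z : E) : E →L[ℝ] E →L[ℝ] ℝ :=
  (fderiv ℝ f z).smulRight (fderiv ℝ g z) - (fderiv ℝ g z).smulRight (fderiv ℝ f z)

theorem wedgeForm_apply (f g : E → ℝ) (z u v : E) : wedgeForm f g z u v =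
    wedgeEval (fderiv ℝ f z) (fderiv ℝ g z) u v := by
  simp [wedgeForm, wedgeEval, mul_comm]

theorem contDiff_wedgeForm {f g : E → ℝ} (hf : ContDiff ℝ ∞ f) (hg : ContDiff ℝ ∞ g) :
    ContDiff ℝ ∞ (wedgeForm f g) := by
  have h1 := hf.fderiv_right (m := ∞) (by simp)
  have h2 := hg.fderiv_right (m := ∞) (by simp)
  exact (h1.smulRight h2).sub (h2.smulRight h1)

theorem isClosedFormAt_wedgeForm {f g : E → ℝ} (hf : ContDiff ℝ ∞ f) (hg : ContDiff ℝ ∞ g)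
    (z : E) : IsClosedFormAt (wedgeForm f g) z := by
  have hD : ∀ {f : E → ℝ}, ContDiff ℝ ∞ f →
      HasFDerivAt (fderiv ℝ f) (fderiv ℝ (fderiv ℝ f) z) z := fun hf =>
    ((hf.fderiv_right (m := ∞) (by simp)).differentiable (by simp) z).hasFDerivAt
  have hs : ∀ {f : E → ℝ}, ContDiff ℝ ∞ f → ∀ u v,
      fderiv ℝ (fderiv ℝ f) z u v = fderiv ℝ (fderiv ℝ f) z v u := fun hf =>
    (hf.contDiffAt (x := z)).isSymmSndFDerivAt (by simp; exact WithTop.coe_le_coe.2 (le_top : (2 : ℕ∞) ≤ ⊤))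
  have key : ∀ u v w, fderiv ℝ (wedgeForm f g) z u v w =
      fderiv ℝ (fderiv ℝ f) z u v * fderiv ℝ g z w + fderiv ℝ f z v * fderiv ℝ (fderiv ℝ g) z u w
      - fderiv ℝ (fderiv ℝ g) z u v * fderiv ℝ f z w
      - fderiv ℝ g z v * fderiv ℝ (fderiv ℝ f) z u w := by
    intro u v w
    rw [← fderiv_bilin_apply ((contDiff_wedgeForm hf hg).differentiable (by simp) z)]
    have h : ∀ {f : E → ℝ}, ContDiff ℝ ∞ f → ∀ v, HasFDerivAt (fun z => fderiv ℝ f z v)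
        ((fderiv ℝ (fderiv ℝ f) z).flip v) z := fun hf v =>
      ((hD hf).clm_apply (hasFDerivAt_const v z)).congr_fderiv (by ext; simp)
    have h1 := ((h hf v).mul (h hg w)).sub ((h hf w).mul (h hg v))
    have h2 : (fun z => wedgeForm f g z v w) =
        fun z => fderiv ℝ f z v * fderiv ℝ g z w - fderiv ℝ f z w * fderiv ℝ g z v := by
      funext z
      rw [wedgeForm_apply]
      rfl
    rw [h2]
    refine (DFunLike.congr_fun h1.fderiv u).trans ?_
    simp
    ring
  intro u v w
  rw [key, key, key, hs hf v u, hs hf w v, hs hf u w, hs hg v u, hs hg w v, hs hg u w]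
  ring

/-- Near `a`, the two-form `η` is a sum of `k` products `dxᵢ ∧ dyᵢ`. -/
def IsDarbouxSum (k : ℕ) (η : E → E →L[ℝ] E →L[ℝ] ℝ) (a : E) : Prop :=
  ∃ x y : Fin k → E → ℝ, (∀ i, ContDiff ℝ ∞ (x i)) ∧ (∀ i, ContDiff ℝ ∞ (y i)) ∧
    ∀ᶠ z in 𝓝 a, ∀ u v, η z u v = ∑ i, wedgeEval (fderiv ℝ (x i) z) (fderiv ℝ (y i) z) u v

theorem IsDarbouxSum.congr {k : ℕ} {η ζ : E → E →L[ℝ] E →L[ℝ] ℝ} {a : E}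
    (h : IsDarbouxSum k η a) (he : ∀ᶠ z in 𝓝 a, ∀ u v, ζ z u v = η z u v) :
    IsDarbouxSum k ζ a := by
  obtain ⟨x, y, hx, hy, hxy⟩ := h
  exact ⟨x, y, hx, hy, by filter_upwards [hxy, he] with z h1 h2 u v using (h2 u v).trans (h1 u v)⟩

theorem IsDarbouxSum.pullback {k : ℕ} {η : F → F →L[ℝ] F →L[ℝ] ℝ} {Φ : E → F} {a : E}
    (hΦ : ContDiff ℝ ∞ Φ) (h : IsDarbouxSum k η (Φ a)) :
    IsDarbouxSum k (pullbackForm Φ η) a := by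
  obtain ⟨x, y, hx, hy, hxy⟩ := h
  refine ⟨fun i => x i ∘ Φ, fun i => y i ∘ Φ, fun i => (hx i).comp hΦ, fun i => (hy i).comp hΦ, ?_⟩
  filter_upwards [hΦ.continuous.continuousAt.eventually hxy] with z hz u v
  have hc : ∀ f : F → ℝ, ContDiff ℝ ∞ f → fderiv ℝ (f ∘ Φ) z =
      (fderiv ℝ f (Φ z)).comp (fderiv ℝ Φ z) := fun f hf =>
    fderiv_comp z (hf.differentiable (by simp) _) (hΦ.differentiable (by simp) _)
  rw [pullbackForm_apply, hz]
  refine Finset.sum_congr rfl fun i _ => ?_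
  rw [hc _ (hx i), hc _ (hy i)]
  rfl

/-- A closed two-form annihilated by `∂ₜ` in a flow box is the pullback of its restriction to the
transversal. -/
theorem eventually_eq_pullback_of_flow_box {Ψ : K × ℝ → E} {Θ : E → K × ℝ} {a : E}
    (hΨ : GermInverse Ψ Θ 0 a) {η : E → E →L[ℝ] E →L[ℝ] ℝ} (hη : ContDiff ℝ ∞ η)
    (halt : ∀ z u v, η z u v = -η z v u) (hcl : ∀ᶠ z in 𝓝 a, IsClosedFormAt η z)
    (hker : ∀ᶠ p in 𝓝 (0 : K × ℝ), ∀ v, η (Ψ p) (fderiv ℝ Ψ p (0, 1)) v = 0) :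
    ∀ᶠ z in 𝓝 a, ∀ u v, η z u v =
      pullbackForm (fun z => (Θ z).1) (pullbackForm (fun k => Ψ (k, 0)) η) z u v := by
  let ζ := pullbackForm Ψ η
  have hζ : ContDiff ℝ ∞ ζ := contDiff_pullbackForm hΨ.smooth hη
  have hζalt : ∀ p u v, ζ p u v = -ζ p v u := fun p u v => halt _ _ _
  have hζcl : ∀ᶠ p in 𝓝 0, IsClosedFormAt ζ p := by
    filter_upwards [hΨ.tendsto.eventually hcl] with p hp
    exact hp.pullback hΨ.smooth (hη.differentiable (by simp) _) (halt _)
  have hζk : ∀ᶠ p in 𝓝 (0 : K × ℝ), ∀ v, ζ p (0, 1) v = 0 := by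
    filter_upwards [hker] with p hp v using hp _
  -- Closedness is applied to `∂ₜ, u, v`. Two of its terms differentiate contractions of `ζ` with
  -- `∂ₜ`, which vanish, so the third, `∂ₜζ (u, v)`, vanishes as well.
  have hζd : ∀ᶠ p in 𝓝 (0 : K × ℝ), fderiv ℝ ζ p (0, 1) = 0 := by
    filter_upwards [hζcl, hζk.eventually_nhds] with p hp hk
    have hd := hζ.differentiable (by simp) p
    have h0 : ∀ u v, fderiv ℝ ζ p u (0, 1) v = 0 := fun u v => by
      rw [← fderiv_bilin_apply hd, fderiv_eq_zero_of_eventually (hk.mono fun q hq => hq v)]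
      rfl
    have h1 : ∀ u v, fderiv ℝ ζ p u v (0, 1) = 0 := fun u v => by
      rw [← fderiv_bilin_apply hd, fderiv_eq_zero_of_eventually
        (hk.mono fun q hq => by rw [hζalt, hq v, neg_zero])]
      rfl
    refine ContinuousLinearMap.ext fun u => ContinuousLinearMap.ext fun v => ?_
    have := hp (0, 1) u v
    rw [h1, h0] at this
    simpa using this
  have hζt := eventually_eq_of_fderiv_snd_eq_zero hζ hζd
  have hproj : Tendsto (fun z => ((Θ z).1, (0 : ℝ))) (𝓝 a) (𝓝 (0 : K × ℝ)) := by
    have : Continuous fun z => ((Θ z).1, (0 : ℝ)) := by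
      have := hΨ.smooth_inv.continuous
      fun_prop
    have h := this.tendsto a
    rwa [hΨ.inv_base] at h
  filter_upwards [hΨ.fderiv_comp, hΨ.right_inv, hΨ.symm.tendsto.eventually hζt,
    hproj.eventually hζk] with z h1 h2 h3 h4 u v
  have h5 : η z u v = ζ (Θ z) (fderiv ℝ Θ z u) (fderiv ℝ Θ z v) := by
    change _ = η _ (fderiv ℝ Ψ (Θ z) _) (fderiv ℝ Ψ (Θ z) _)
    rw [h1, h1, h2]
  have h6 : ∀ q q' : K × ℝ, ζ ((Θ z).1, 0) q q' = ζ ((Θ z).1, 0) (q.1, 0) (q'.1, 0) := by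
    intro q q'
    have e1 : ∀ q : K × ℝ, q = (q.1, 0) + q.2 • (0, 1) := fun q => by ext <;> simp
    have h7 : ∀ v, ζ ((Θ z).1, 0) v (0, 1) = 0 := fun v => by rw [hζalt, h4, neg_zero]
    conv_lhs => rw [e1 q, e1 q']
    simp only [map_add, map_smul, add_apply, smul_apply,
      h4, h7]
    simp
  rw [h5, h3, h6]
  have hΘ1 : ∀ u, fderiv ℝ (fun z => (Θ z).1) z u = (fderiv ℝ Θ z u).1 := fun u => by
    rw [((hΨ.smooth_inv.differentiable (by simp) z).hasFDerivAt.fst).fderiv]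
    rfl
  have hΨ1 : ∀ k h, fderiv ℝ (fun k => Ψ (k, 0)) k h = fderiv ℝ Ψ (k, 0) (h, 0) := fun k h => by
    have h8 : HasFDerivAt (fun k : K => Ψ (k, 0)) ((fderiv ℝ Ψ (k, 0)).comp
        (ContinuousLinearMap.inl ℝ K ℝ)) k :=
      HasFDerivAt.comp k (f := fun k => (k, (0 : ℝ)))
        (hΨ.smooth.differentiable (by simp) _).hasFDerivAt
        (hasFDerivAt_prodMk_left k (0 : ℝ))
    rw [h8.fderiv]
    rfl
  simp only [pullbackForm_apply, hΘ1, hΨ1]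
  rfl

end Forms

/-! ### Darboux's theorem for closed two-forms of corank at most one -/

section Darboux

/-- Darboux's theorem for symplectic forms in dimension `2k`. -/
def DarbouxEven (k : ℕ) : Prop :=
  ∀ (E : Type) [NormedAddCommGroup E] [NormedSpace ℝ E] [FiniteDimensional ℝ E],
    Module.finrank ℝ E = 2 * k → ∀ {η : E → E →L[ℝ] E →L[ℝ] ℝ}, ContDiff ℝ ∞ η →
    (∀ z u v, η z u v = -η z v u) → ∀ {a : E}, (∀ᶠ z in 𝓝 a, IsClosedFormAt η z) →
    (∀ u, (∀ v, η a u v = 0) → u = 0) → IsDarbouxSum k η a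

/-- Darboux's theorem for closed two-forms with one-dimensional kernel in dimension `2k + 1`. -/
def DarbouxOdd (k : ℕ) : Prop :=
  ∀ (E : Type) [NormedAddCommGroup E] [NormedSpace ℝ E] [FiniteDimensional ℝ E],
    Module.finrank ℝ E = 2 * k + 1 → ∀ {η : E → E →L[ℝ] E →L[ℝ] ℝ}, ContDiff ℝ ∞ η →
    (∀ z u v, η z u v = -η z v u) → ∀ {a : E}, (∀ᶠ z in 𝓝 a, IsClosedFormAt η z) →
    ∀ {w : E}, w ≠ 0 → (∀ v, η a w v = 0) → (∀ u, (∀ v, η a u v = 0) → ∃ c : ℝ, u = c • w) →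
    IsDarbouxSum k η a

variable {E K : Type} [NormedAddCommGroup E] [NormedSpace ℝ E] [FiniteDimensional ℝ E]
  [NormedAddCommGroup K] [NormedSpace ℝ K] [FiniteDimensional ℝ K]

theorem finrank_continuousDual : Module.finrank ℝ (E →L[ℝ] ℝ) = Module.finrank ℝ E := by
  rw [← (LinearMap.toContinuousLinearMap (𝕜 := ℝ) (E := E) (F' := ℝ)).finrank_eq]
  exact Subspace.dual_finrank_eq

/-- Straightening of a vector field near a point where it does not vanish. -/
theorem exists_flow_box_of_ne_zero (hdim : Module.finrank ℝ E = Module.finrank ℝ K + 1)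
    {W : E → E} (hW : ContDiff ℝ ∞ W) {a : E} (ha : W a ≠ 0) :
    ∃ (Ψ : K × ℝ → E) (Θ : E → K × ℝ), GermInverse Ψ Θ 0 a ∧
      ∀ᶠ p in 𝓝 (0 : K × ℝ), fderiv ℝ Ψ p (0, 1) = W (Ψ p) := by
  obtain ⟨e, he⟩ := exists_equiv_prod_symm (F := K) hdim ha
  let L : K →L[ℝ] E := (e.symm : K × ℝ →L[ℝ] E).comp (ContinuousLinearMap.inl ℝ K ℝ)
  let σ : K → E := fun k => a + L k
  have hσ0 : σ 0 = a := by simp [σ]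
  have hσ : ContDiff ℝ ∞ σ := contDiff_const.add L.contDiff
  have hd : ∀ k, fderiv ℝ σ 0 k = e.symm (k, 0) := fun k => by
    have : HasFDerivAt σ L 0 := L.hasFDerivAt.const_add a
    rw [this.fderiv]
    rfl
  obtain ⟨Ψ, Θ, h1, -, h2⟩ := exists_flow_box hW hσ e hd (by rw [hσ0, he])
  rw [hσ0] at h1
  exact ⟨Ψ, Θ, h1, h2⟩

/-- A two-form with one-dimensional kernel at a point, in odd dimension, has near that point a
nonvanishing smooth vector field in its kernel. -/
theorem exists_kernel_field {η : E → E →L[ℝ] E →L[ℝ] ℝ} (hη : ContDiff ℝ ∞ η)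
    (halt : ∀ z u v, η z u v = -η z v u) {a w : E} (hw : w ≠ 0) (hker : ∀ v, η a w v = 0)
    (hker' : ∀ u, (∀ v, η a u v = 0) → ∃ c : ℝ, u = c • w) :
    ∃ W : E → E, ContDiff ℝ ∞ W ∧ W a ≠ 0 ∧ ∀ᶠ z in 𝓝 a, ∀ v, η z (W z) v = 0 := by
  obtain ⟨τ, hτ⟩ := SeparatingDual.exists_eq_one (R := ℝ) hw
  let A : E → (E × ℝ) →L[ℝ] (E →L[ℝ] ℝ) × ℝ := fun z =>
    ((η z).comp (ContinuousLinearMap.fst ℝ E ℝ) +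
      (ContinuousLinearMap.snd ℝ E ℝ).smulRight τ).prod
    (τ.comp (ContinuousLinearMap.fst ℝ E ℝ))
  have hA : ContDiff ℝ ∞ A := contDiff_clm_apply_iff.2 fun q => by
    change ContDiff ℝ ∞ fun z => (η z q.1 + q.2 • τ, τ q.1)
    exact ((hη.clm_apply contDiff_const).add contDiff_const).prodMk contDiff_const
  have halt0 : ∀ z u, η z u u = 0 := fun z u => by linarith [halt z u u]
  have hinj : ∀ q, A a q = 0 → q = 0 := by
    rintro ⟨u, μ⟩ h
    have h1 : η a u + μ • τ = 0 := congrArg Prod.fst h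
    have h2 : τ u = 0 := congrArg Prod.snd h
    have h1' : ∀ v, η a u v + μ * τ v = 0 := fun v => DFunLike.congr_fun h1 v
    have hμ : μ = 0 := by
      have := h1' w
      rwa [halt, hker, hτ, neg_zero, zero_add, mul_one] at this
    subst hμ
    obtain ⟨c, rfl⟩ := hker' u fun v => by simpa using h1' v
    rw [map_smul, hτ] at h2
    have : c = 0 := by simpa using h2
    simp [this]
  obtain ⟨s, hs, hsA⟩ := exists_smooth_solution (by simp [finrank_continuousDual]) hA hinj
    (contDiff_const (c := ((0 : E →L[ℝ] ℝ), (1 : ℝ))))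
  have hsA' : ∀ z, A z (s z) = (0, 1) → τ (s z).1 = 1 ∧ ∀ v, η z (s z).1 v = 0 := by
    intro z h
    have h1 : η z (s z).1 + (s z).2 • τ = 0 := congrArg Prod.fst h
    have h2 : τ (s z).1 = 1 := congrArg Prod.snd h
    have h1' : ∀ v, η z (s z).1 v + (s z).2 * τ v = 0 := fun v => DFunLike.congr_fun h1 v
    have hμ : (s z).2 = 0 := by
      have := h1' (s z).1
      rwa [halt0, h2, zero_add, mul_one] at this
    exact ⟨h2, fun v => by simpa [hμ] using h1' v⟩
  refine ⟨fun z => (s z).1, contDiff_fst.comp hs, fun h0 => ?_, ?_⟩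
  · have := (hsA' a hsA.self_of_nhds).1
    rw [show (s a).1 = 0 from h0, map_zero] at this
    exact zero_ne_one this
  · filter_upwards [hsA] with z hz using (hsA' z hz).2

theorem fderiv_slice {Ψ : K × ℝ → E} (hΨ : ContDiff ℝ ∞ Ψ) (k h : K) :
    fderiv ℝ (fun k => Ψ (k, 0)) k h = fderiv ℝ Ψ (k, 0) (h, 0) := by
  have h8 : HasFDerivAt (fun k : K => Ψ (k, 0)) ((fderiv ℝ Ψ (k, 0)).comp
      (ContinuousLinearMap.inl ℝ K ℝ)) k :=
    HasFDerivAt.comp k (f := fun k => (k, (0 : ℝ)))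
      (hΨ.differentiable (by simp) _).hasFDerivAt
      (hasFDerivAt_prodMk_left k (0 : ℝ))
  rw [h8.fderiv]
  rfl

theorem GermInverse.fderiv_comp_base {G : Type} [NormedAddCommGroup G] [NormedSpace ℝ G]
    {Ψ : G → E} {Θ : E → G} {g : G} {a : E}
    (h : GermInverse Ψ Θ g a) : ∀ v, fderiv ℝ Ψ g (fderiv ℝ Θ a v) = v := by
  have := h.fderiv_comp.self_of_nhds
  rwa [h.inv_base] at this

/-- The kernel field is straightened; the form is then pulled back from a transversal, where it is
symplectic. -/
theorem DarbouxEven.odd {k : ℕ} (hk : DarbouxEven k) : DarbouxOdd k := by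
  intro E _ _ _ hdim η hη halt a hcl w hw hker hker'
  obtain ⟨W, hW, hWa, hWη⟩ := exists_kernel_field hη halt hw hker hker'
  let K := EuclideanSpace ℝ (Fin (2 * k))
  obtain ⟨Ψ, Θ, hΨ, hΨt⟩ := exists_flow_box_of_ne_zero (K := K) (by simp [K, hdim]) hW hWa
  have hdesc := eventually_eq_pullback_of_flow_box hΨ hη halt hcl (by
    filter_upwards [hΨt, hΨ.tendsto.eventually hWη] with p h1 h2 v
    rw [h1, h2])
  have hι : ContDiff ℝ ∞ fun k : K => Ψ (k, 0) :=
    hΨ.smooth.comp (contDiff_id.prodMk contDiff_const)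
  have hι0 : Ψ ((0 : K), 0) = a := hΨ.map_base
  have hWk : ∀ v, η a (fderiv ℝ Ψ (0, 0) (0, 1)) v = 0 := fun v => by
    have h1 := hΨt.self_of_nhds
    rw [hΨ.map_base] at h1
    exact h1 ▸ hWη.self_of_nhds v
  obtain ⟨b, hb⟩ := hker' _ hWk
  have hζ := hk K (η := pullbackForm (fun k : K => Ψ (k, 0)) η) (a := 0) (by simp [K])
    (contDiff_pullbackForm hι hη) (fun z u v => halt _ _ _)
    (by
      have : Tendsto (fun k : K => Ψ (k, 0)) (𝓝 0) (𝓝 a) := by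
        have := hι.continuous.tendsto 0
        rwa [hι0] at this
      filter_upwards [this.eventually hcl] with z hz
      exact hz.pullback hι (hη.differentiable (by simp) _) (halt _))
    (by
      intro h hh
      simp only [pullbackForm_apply, fderiv_slice hΨ.smooth, hι0] at hh
      -- A vector in the kernel of the restriction also pairs to zero with the flow direction, hence
      -- is a multiple of `w`. The flow direction is a nonzero multiple of `w` too, and
      -- transversality forces `h = 0`.
      obtain ⟨c, hc⟩ := hker' (fderiv ℝ Ψ (0, 0) (h, 0)) fun v => by
        rw [← hΨ.fderiv_comp_base v]
        set q := fderiv ℝ Θ a v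
        have e1 : q = (q.1, 0) + q.2 • (0, 1) := by ext <;> simp
        rw [e1, map_add, map_smul, map_add, map_smul]
        rw [show fderiv ℝ Ψ 0 (q.1, 0) = fderiv ℝ Ψ (0, 0) (q.1, 0) from rfl, hh,
          show fderiv ℝ Ψ 0 (0, 1) = fderiv ℝ Ψ (0, 0) (0, 1) from rfl, halt, hWk]
        simp
      have hb0 : b ≠ 0 := by
        rintro rfl
        rw [zero_smul] at hb
        have h1 := hΨ.symm.fderiv_comp_base ((0 : K), (1 : ℝ))
        rw [show fderiv ℝ Ψ 0 (0, 1) = fderiv ℝ Ψ (0, 0) (0, 1) from rfl, hb, map_zero] at h1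
        simpa using congrArg Prod.snd h1
      have h2 : fderiv ℝ Ψ (0, 0) (h, 0) = fderiv ℝ Ψ (0, 0) ((0, c / b) : K × ℝ) := by
        have e2 : ((0, c / b) : K × ℝ) = (c / b) • (0, 1) := by simp
        rw [e2, map_smul, hb, hc, smul_smul, div_mul_cancel₀ _ hb0]
      have h3 := congrArg (fderiv ℝ Θ a) h2
      have h4 := hΨ.symm.fderiv_comp_base
      rw [show ((0, 0) : K × ℝ) = 0 from rfl, h4, h4] at h3
      exact congrArg Prod.fst h3)
  refine IsDarbouxSum.congr (IsDarbouxSum.pullback (Φ := fun z => (Θ z).1)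
    (contDiff_fst.comp hΨ.smooth_inv) ?_) hdesc
  rw [hΨ.inv_base]
  exact hζ

theorem IsDarbouxSum.add_wedge {k : ℕ} {η ζ : E → E →L[ℝ] E →L[ℝ] ℝ} {a : E} {f g : E → ℝ}
    (hf : ContDiff ℝ ∞ f) (hg : ContDiff ℝ ∞ g) (h : IsDarbouxSum k ζ a)
    (he : ∀ᶠ z in 𝓝 a, ∀ u v, η z u v = wedgeForm f g z u v + ζ z u v) :
    IsDarbouxSum (k + 1) η a := by
  obtain ⟨x, y, hx, hy, hxy⟩ := h
  refine ⟨Fin.cons f x, Fin.cons g y, fun i => ?_, fun i => ?_, ?_⟩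
  · refine Fin.cases hf (fun i => hx i) i
  · refine Fin.cases hg (fun i => hy i) i
  · filter_upwards [he, hxy] with z h1 h2 u v
    rw [h1, h2, Fin.sum_univ_succ, wedgeForm_apply]
    rfl

/-- Let `X` be the Hamiltonian field of a nonzero linear form `l`, and `t` the time along it. Since
`dt(X) = 1` and `l(X) = 0`, contraction with `X` gives `l` both for `η` and for `dt ∧ dl`. The
difference is closed and annihilated by `X`, so it descends to a transversal of dimension `2k + 1`.
-/
theorem DarbouxOdd.even {k : ℕ} (hk : DarbouxOdd k) : DarbouxEven (k + 1) := by
  intro E _ _ _ hdim η hη halt a hcl hnd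
  have halt0 : ∀ z u, η z u u = 0 := fun z u => by linarith [halt z u u]
  obtain ⟨v₀, hv₀⟩ := Module.finrank_pos_iff_exists_ne_zero (R := ℝ) (M := E).1 (by omega)
  obtain ⟨l, hl⟩ := SeparatingDual.exists_eq_one (R := ℝ) hv₀
  have hl' : ∀ z, fderiv ℝ l z = l := fun z => l.fderiv
  obtain ⟨X, hX, hXη⟩ := exists_smooth_solution finrank_continuousDual.symm hη
    (fun u hu => hnd u fun v => by rw [hu]; rfl) (contDiff_const (c := l))
  have hXa : X a ≠ 0 := by
    intro h
    have := hXη.self_of_nhds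
    rw [h, map_zero] at this
    rw [← this] at hl
    simp at hl
  let K := EuclideanSpace ℝ (Fin (2 * k + 1))
  obtain ⟨Ψ, Θ, hΨ, hΨt⟩ := exists_flow_box_of_ne_zero (K := K) (by simp [K, hdim]; ring) hX hXa
  let t : E → ℝ := fun z => (Θ z).2
  have ht : ContDiff ℝ ∞ t := contDiff_snd.comp hΨ.smooth_inv
  have htd : ∀ z u, fderiv ℝ t z u = (fderiv ℝ Θ z u).2 := fun z u => by
    rw [((hΨ.smooth_inv.differentiable (by simp) z).hasFDerivAt.snd).fderiv]
    rfl
  let ζ : E → E →L[ℝ] E →L[ℝ] ℝ := fun z => η z - wedgeForm t l z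
  have hζ : ContDiff ℝ ∞ ζ := hη.sub (contDiff_wedgeForm ht l.contDiff)
  have hζalt : ∀ z u v, ζ z u v = -ζ z v u := fun z u v => by
    simp only [ζ, sub_apply, wedgeForm_apply, wedgeEval]
    rw [halt]
    ring
  have hζcl : ∀ᶠ z in 𝓝 a, IsClosedFormAt ζ z := by
    filter_upwards [hcl] with z hz
    exact hz.sub (hη.differentiable (by simp) z)
      ((contDiff_wedgeForm ht l.contDiff).differentiable (by simp) z)
      (isClosedFormAt_wedgeForm ht l.contDiff z)
  have hζk : ∀ᶠ p in 𝓝 (0 : K × ℝ), ∀ v, ζ (Ψ p) (fderiv ℝ Ψ p (0, 1)) v = 0 := by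
    filter_upwards [hΨt, hΨ.tendsto.eventually hXη, hΨ.symm.fderiv_comp] with p h1 h2 h3 v
    simp only [ζ, sub_apply, wedgeForm_apply, wedgeEval, hl', htd, h3]
    have h4 : l (X (Ψ p)) = 0 := by rw [← h2, halt0]
    rw [h1, h2, h4]
    ring
  have hdesc := eventually_eq_pullback_of_flow_box hΨ hζ hζalt hζcl hζk
  have hι : ContDiff ℝ ∞ fun k : K => Ψ (k, 0) :=
    hΨ.smooth.comp (contDiff_id.prodMk contDiff_const)
  have hι0 : Ψ ((0 : K), 0) = a := hΨ.map_base
  have hΘΨ : ∀ q, fderiv ℝ Θ a (fderiv ℝ Ψ (0, 0) q) = q := hΨ.symm.fderiv_comp_base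
  have hΨΘ : ∀ v, fderiv ℝ Ψ (0, 0) (fderiv ℝ Θ a v) = v := hΨ.fderiv_comp_base
  have hta : ∀ q, fderiv ℝ t a (fderiv ℝ Ψ (0, 0) q) = q.2 := fun q => by rw [htd, hΘΨ]
  -- Since `dt` vanishes on the transversal, the subtracted term does not contribute there.
  have hζ0 : ∀ h h' : K, pullbackForm (fun k : K => Ψ (k, 0)) ζ 0 h h' =
      η a (fderiv ℝ Ψ (0, 0) (h, 0)) (fderiv ℝ Ψ (0, 0) (h', 0)) := fun h h' => by
    simp only [pullbackForm_apply, fderiv_slice hΨ.smooth, hι0, ζ, sub_apply,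
      wedgeForm_apply, wedgeEval, hta]
    ring
  have hX0 : fderiv ℝ Ψ (0, 0) ((0 : K), (1 : ℝ)) = X a := by
    have h1 := hΨt.self_of_nhds
    rwa [hΨ.map_base] at h1
  -- the Hamiltonian vector of `-t` at `a`
  obtain ⟨s, hs, hsη⟩ := exists_smooth_solution finrank_continuousDual.symm hη
    (fun u hu => hnd u fun v => by rw [hu]; rfl) (contDiff_const (c := -fderiv ℝ t a))
  have hu := hsη.self_of_nhds
  set u := s a
  -- The vector `u` is tangent to the transversal because `dt(u) = -η(u, u) = 0`.
  obtain ⟨w, hw⟩ : ∃ w : K, fderiv ℝ Ψ (0, 0) (w, 0) = u := by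
    refine ⟨(fderiv ℝ Θ a u).1, ?_⟩
    have h1 : fderiv ℝ t a u = 0 := by
      have := halt0 a u
      rw [hu] at this
      simpa using this
    rw [htd] at h1
    have h2 : ((fderiv ℝ Θ a u).1, (0 : ℝ)) = fderiv ℝ Θ a u := Prod.ext rfl h1.symm
    rw [h2]
    exact hΨΘ u
  have hw0 : w ≠ 0 := by
    rintro rfl
    have h1 : u = 0 := by
      rw [← hw]
      exact map_zero _
    have h2 := hta (0, 1)
    rw [h1, map_zero] at hu
    rw [neg_eq_zero.1 hu.symm] at h2
    simp at h2
  have hζD := hk K (η := pullbackForm (fun k : K => Ψ (k, 0)) ζ) (a := 0) (by simp [K])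
    (contDiff_pullbackForm hι hζ) (fun z u v => hζalt _ _ _)
    (by
      have : Tendsto (fun k : K => Ψ (k, 0)) (𝓝 0) (𝓝 a) := by
        have := hι.continuous.tendsto 0
        rwa [hι0] at this
      filter_upwards [this.eventually hζcl] with z hz
      exact hz.pullback hι (hζ.differentiable (by simp) _) (hζalt _))
    hw0
    (by
      intro v
      rw [hζ0, hw, hu]
      simp [hta])
    (by
      intro h hh
      refine ⟨l (fderiv ℝ Ψ (0, 0) (h, 0)), ?_⟩
      -- For `h` in the kernel on the transversal, `η(h, ·)` is a multiple of `dt`. Evaluation on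
      -- `X` gives the factor `-l(h)`, and `η(u, ·) = -dt`; nondegeneracy then yields `h = l(h) u`.
      have h1 : fderiv ℝ Ψ (0, 0) (h, 0) = l (fderiv ℝ Ψ (0, 0) (h, 0)) • u := by
        rw [← sub_eq_zero]
        refine hnd _ fun v => ?_
        rw [← hΨΘ v]
        set q := fderiv ℝ Θ a v
        have e1 : q = (q.1, 0) + q.2 • (0, 1) := by ext <;> simp
        have h2 : η a (fderiv ℝ Ψ (0, 0) (h, 0)) (fderiv ℝ Ψ (0, 0) q) =
            -(q.2 * l (fderiv ℝ Ψ (0, 0) (h, 0))) := by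
          conv_lhs => rw [e1]
          rw [map_add, map_smul, map_add, map_smul, ← hζ0, hh, hX0, halt a _ (X a),
            hXη.self_of_nhds]
          simp
        rw [map_sub, map_smul, hu]
        simp only [sub_apply, smul_apply, neg_apply, hta, h2, smul_eq_mul]
        ring
      have h3 := congrArg (fun v => (fderiv ℝ Θ a v).1) h1
      simp only [map_smul, hΘΨ, ← hw] at h3
      simpa [hw, hΘΨ] using h3)
  refine IsDarbouxSum.add_wedge (f := t) (g := l) (ζ := ζ) ht l.contDiff
    (IsDarbouxSum.congr (IsDarbouxSum.pullback (Φ := fun z => (Θ z).1)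
    (contDiff_fst.comp hΨ.smooth_inv) ?_) hdesc) (Eventually.of_forall fun z u v => ?_)
  · rw [hΨ.inv_base]
    exact hζD
  · simp [ζ]

theorem darbouxEven : ∀ k, DarbouxEven k
  | 0 => by
    intro E _ _ _ hdim η _ _ a _ _
    have : Subsingleton E := Module.finrank_zero_iff.1 hdim
    refine ⟨Fin.elim0, Fin.elim0, fun i => i.elim0, fun i => i.elim0,
      Eventually.of_forall fun z u v => ?_⟩
    rw [Subsingleton.elim u 0]
    simp
  | k + 1 => (darbouxEven k).odd.even

theorem darbouxOdd (k : ℕ) : DarbouxOdd k := (darbouxEven k).odd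

end Darboux

/-! ### Normal form of a `b^m`-symplectic form in a flow box -/

section Homotopy

variable {E H : Type} [NormedAddCommGroup E] [NormedSpace ℝ E] [NormedAddCommGroup H] [NormedSpace ℝ H] [FiniteDimensional ℝ H]

/-- Continuous identities extend across a hyperplane. -/
theorem eventually_eq_of_eventually_off_hyperplane {Y : Type} [TopologicalSpace Y] [T2Space Y]
    {f g : E → Y} (hf : Continuous f)
    (hg : Continuous g) {l : E →L[ℝ] ℝ} {w : E} (hw : l w ≠ 0) {a : E}
    (h : ∀ᶠ z in 𝓝 a, l z ≠ 0 → f z = g z) : ∀ᶠ z in 𝓝 a, f z = g z := by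
  filter_upwards [h.eventually_nhds] with z hz
  by_cases h0 : l z = 0
  · have hc : Continuous fun s : ℝ => z + s • w := by fun_prop
    have ht : Tendsto (fun s : ℝ => z + s • w) (𝓝[≠] 0) (𝓝 z) := by
      have := (hc.tendsto 0).mono_left (nhdsWithin_le_nhds (s := {0}ᶜ))
      simpa using this
    have he : (fun s : ℝ => f (z + s • w)) =ᶠ[𝓝[≠] 0] fun s => g (z + s • w) := by
      filter_upwards [ht.eventually hz, self_mem_nhdsWithin] with s hs hs0
      refine hs ?_
      rw [map_add, map_smul, h0, zero_add, smul_eq_mul]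
      exact mul_ne_zero hs0 hw
    exact tendsto_nhds_unique_of_eventuallyEq ((hf.tendsto z).comp ht) ((hg.tendsto z).comp ht) he
  · exact hz.self_of_nhds h0

/-- This provides the radial segments in `H`, at fixed `x`, along which the homotopy operator
integrates. -/
theorem eventually_prod_segment {P : H × ℝ → Prop} (h : ∀ᶠ k in 𝓝 (0 : H × ℝ), P k) :
    ∀ᶠ k in 𝓝 (0 : H × ℝ), ∀ s ∈ Icc (0 : ℝ) 1, P (s • k.1, k.2) := by
  obtain ⟨r, hr, hr'⟩ := Metric.eventually_nhds_iff_ball.1 h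
  filter_upwards [Metric.ball_mem_nhds _ hr] with k hk s hs
  refine hr' _ ?_
  rw [mem_ball_zero_iff, Prod.norm_def, max_lt_iff] at hk ⊢
  refine ⟨lt_of_le_of_lt ?_ hk.1, hk.2⟩
  rw [norm_smul, Real.norm_eq_abs, abs_of_nonneg hs.1]
  exact mul_le_of_le_one_left (norm_nonneg _) hs.2

/-- A family of one-forms on `H`, depending on a parameter `x`, whose differential is divisible by
`x ^ m`, is exact modulo `x ^ m`. -/
theorem exists_primitive_mod_pow (m : ℕ) {α : H × ℝ → H →L[ℝ] ℝ} (hα : ContDiff ℝ ∞ α)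
    {β : H × ℝ → H →L[ℝ] H →L[ℝ] ℝ} (hβ : ContDiff ℝ ∞ β)
    (h : ∀ᶠ k in 𝓝 (0 : H × ℝ), ∀ u w, fderiv ℝ α k (u, 0) w - fderiv ℝ α k (w, 0) u =
      k.2 ^ m * fderiv ℝ β k (0, 1) u w) :
    ∃ (g : H × ℝ → ℝ) (γ : H × ℝ → H →L[ℝ] ℝ), ContDiff ℝ ∞ g ∧ ContDiff ℝ ∞ γ ∧ γ 0 = 0 ∧
      ∀ᶠ k in 𝓝 (0 : H × ℝ), ∀ w, α k w = fderiv ℝ g k (w, 0) + k.2 ^ m * γ k w := by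
  have : CompleteSpace (H →L[ℝ] ℝ) := inferInstance
  let c : (H × ℝ) × ℝ → H × ℝ := fun p => (p.2 • p.1.1, p.1.2)
  have hc : ContDiff ℝ ∞ c := by fun_prop
  have hβ' : ContDiff ℝ ∞ fun k => fderiv ℝ β k (0, 1) :=
    (hβ.fderiv_right (m := ∞) (by simp)).clm_apply contDiff_const
  -- These are the integrands of the radial homotopy operator along `H`, applied to `α` and to
  -- `∂ₓβ`. The formula `α = d K α + K d α` with `d α = x^m ∂ₓβ` gives the result, since `K`
  -- commutes with the factor `x^m`. The integrand `f'` contains the radial vector, hence `γ 0 = 0`.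
  let f : (H × ℝ) × ℝ → ℝ := fun p => α (c p) p.1.1
  let f' : (H × ℝ) × ℝ → H →L[ℝ] ℝ := fun p => p.2 • fderiv ℝ β (c p) (0, 1) p.1.1
  have hf : ContDiff ℝ ∞ f := (hα.comp hc).clm_apply (by fun_prop)
  have hf' : ContDiff ℝ ∞ f' := contDiff_snd.smul ((hβ'.comp hc).clm_apply (by fun_prop))
  obtain ⟨hg, hgd⟩ := contDiff_integral_and_hasFDerivAt hf
  obtain ⟨hγ, -⟩ := contDiff_integral_and_hasFDerivAt hf'
  refine ⟨_, _, hg, hγ, by simp [f'], ?_⟩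
  filter_upwards [eventually_prod_segment h] with k hk w
  rw [hgd]
  have hcont : ∀ {Y : Type} [NormedAddCommGroup Y] [NormedSpace ℝ Y] {φ : (H × ℝ) × ℝ → Y},
      Continuous φ → IntervalIntegrable (fun s => φ (k, s)) MeasureTheory.volume 0 1 := fun hφ =>
    (hφ.comp (by fun_prop : Continuous fun s : ℝ => (k, s))).intervalIntegrable _ _
  rw [ContinuousLinearMap.intervalIntegral_apply (hcont hf'.continuous) w,
    ← intervalIntegral.integral_const_mul]
  have hfd : ∀ s, fderiv ℝ f (k, s) ((w, 0), 0) =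
      s * fderiv ℝ α (s • k.1, k.2) (w, 0) k.1 + α (s • k.1, k.2) w := by
    intro s
    have h1 : HasFDerivAt c (((ContinuousLinearMap.snd ℝ (H × ℝ) ℝ).smulRight k.1 +
        s • ((ContinuousLinearMap.fst ℝ H ℝ).comp (ContinuousLinearMap.fst ℝ _ ℝ))).prod
        ((ContinuousLinearMap.snd ℝ H ℝ).comp (ContinuousLinearMap.fst ℝ _ ℝ))) (k, s) := by
      refine HasFDerivAt.prodMk ?_ (hasFDerivAt_fst.snd)
      refine (hasFDerivAt_snd.smul hasFDerivAt_fst.fst).congr_fderiv ?_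
      ext <;> simp
    have h2 := HasFDerivAt.clm_apply
      (HasFDerivAt.comp (g := α) (k, s) (hα.differentiable (by simp) (c (k, s))).hasFDerivAt h1)
      (hasFDerivAt_fst (p := (k, s))).fst
    refine (DFunLike.congr_fun h2.fderiv _).trans ?_
    have e1 : fderiv ℝ α (s • k.1, k.2) (s • w, 0) k.1 =
        s * fderiv ℝ α (s • k.1, k.2) (w, 0) k.1 := by
      rw [show ((s • w, 0) : H × ℝ) = s • (w, 0) by simp, map_smul]
      rfl
    simp [c, e1, add_comm]
  have hγs : Continuous fun p : (H × ℝ) × ℝ => p.1.2 ^ m * f' p w := by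
    have := hf'.continuous
    fun_prop
  have hfs : Continuous fun p : (H × ℝ) × ℝ => fderiv ℝ f p ((w, 0), 0) := by
    have := hf.continuous_fderiv (by simp)
    fun_prop
  rw [← intervalIntegral.integral_add (hcont hfs) (hcont hγs)]
  have hd : ∀ s, HasDerivAt (fun s : ℝ => s * α (s • k.1, k.2) w)
      (1 * α (s • k.1, k.2) w + s * fderiv ℝ α (s • k.1, k.2) (k.1, 0) w) s := by
    intro s
    refine (hasDerivAt_id s).mul ?_
    have h1 : HasDerivAt (fun s : ℝ => (s • k.1, k.2)) ((1 : ℝ) • k.1, (0 : ℝ)) s :=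
      ((hasDerivAt_id s).smul_const k.1).prodMk (hasDerivAt_const s _)
    have h2 := ((hα.differentiable (by simp) _).hasFDerivAt).comp_hasDerivAt s h1
    have h3 := h2.clm_apply (hasDerivAt_const s w)
    simpa using h3
  have hint : IntervalIntegrable (fun s => 1 * α (s • k.1, k.2) w +
      s * fderiv ℝ α (s • k.1, k.2) (k.1, 0) w) MeasureTheory.volume 0 1 := by
    have h1 := hα.continuous
    have h2 := hα.continuous_fderiv (by simp)
    exact Continuous.intervalIntegrable (by fun_prop) _ _
  have hftc := intervalIntegral.integral_eq_sub_of_hasDerivAt (fun s _ => hd s) hint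
  have hval : (1 : ℝ) * α ((1 : ℝ) • k.1, k.2) w - 0 * α ((0 : ℝ) • k.1, k.2) w = α k w := by
    simp
  rw [hval] at hftc
  rw [← hftc]
  refine intervalIntegral.integral_congr fun s hs => ?_
  rw [uIcc_of_le zero_le_one] at hs
  have h3 := hk s hs k.1 w
  simp only [hfd]
  simp only [f', c, smul_apply, smul_eq_mul]
  linear_combination s * h3

/-- Differentiating `α = d_H g + x^m γ` along `H` removes `g` and gives `x^m d_H γ = x^m ∂ₓβ`. The
factor is cancelled off `x = 0`, and continuity does the rest. -/
theorem eventually_differential_of_mod_pow {m : ℕ} {α : H × ℝ → H →L[ℝ] ℝ} (hα : ContDiff ℝ ∞ α)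
    {β : H × ℝ → H →L[ℝ] H →L[ℝ] ℝ} (hβ : ContDiff ℝ ∞ β)
    (h : ∀ᶠ k in 𝓝 (0 : H × ℝ), ∀ u w, fderiv ℝ α k (u, 0) w - fderiv ℝ α k (w, 0) u =
      k.2 ^ m * fderiv ℝ β k (0, 1) u w)
    {g : H × ℝ → ℝ} {γ : H × ℝ → H →L[ℝ] ℝ} (hg : ContDiff ℝ ∞ g) (hγ : ContDiff ℝ ∞ γ)
    (hgγ : ∀ᶠ k in 𝓝 (0 : H × ℝ), ∀ w, α k w = fderiv ℝ g k (w, 0) + k.2 ^ m * γ k w) :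
    ∀ᶠ k in 𝓝 (0 : H × ℝ), ∀ u w, fderiv ℝ γ k (u, 0) w - fderiv ℝ γ k (w, 0) u =
      fderiv ℝ β k (0, 1) u w := by
  have hβd := hβ.continuous_fderiv (by simp)
  let D : H × ℝ → H →L[ℝ] H →L[ℝ] ℝ := fun k =>
    (fderiv ℝ γ k).comp (ContinuousLinearMap.inl ℝ H ℝ) -
      ((fderiv ℝ γ k).comp (ContinuousLinearMap.inl ℝ H ℝ)).flip
  have hD : Continuous D := by
    refine ContDiff.continuous (𝕜 := ℝ) (n := ∞)
      (contDiff_clm_apply_iff.2 fun u => contDiff_clm_apply_iff.2 fun w => ?_)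
    change ContDiff ℝ ∞ fun k => fderiv ℝ γ k (u, 0) w - fderiv ℝ γ k (w, 0) u
    have hd := hγ.fderiv_right (m := ∞) (by simp)
    exact ((hd.clm_apply contDiff_const).clm_apply contDiff_const).sub
      ((hd.clm_apply contDiff_const).clm_apply contDiff_const)
  have key := eventually_eq_of_eventually_off_hyperplane (f := D)
    (g := fun k => fderiv ℝ β k (0, 1)) hD (hβd.clm_apply continuous_const)
    (l := ContinuousLinearMap.snd ℝ H ℝ) (w := (0, 1)) (by simp) (a := 0) (by
      filter_upwards [h, hgγ.eventually_nhds] with k hk hk' hx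
      have hx' : k.2 ^ m ≠ 0 := pow_ne_zero m hx
      refine ContinuousLinearMap.ext fun u => ContinuousLinearMap.ext fun w => ?_
      change fderiv ℝ γ k (u, 0) w - fderiv ℝ γ k (w, 0) u = _
      have hs : ∀ u w, fderiv ℝ (fderiv ℝ g) k u w = fderiv ℝ (fderiv ℝ g) k w u :=
        (hg.contDiffAt (x := k)).isSymmSndFDerivAt
          (by simp; exact WithTop.coe_le_coe.2 (le_top : (2 : ℕ∞) ≤ ⊤))
      have e : ∀ u w : H, fderiv ℝ α k (u, 0) w =
          fderiv ℝ (fderiv ℝ g) k (u, 0) (w, 0) + k.2 ^ m * fderiv ℝ γ k (u, 0) w := by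
        intro u w
        have h1 : HasFDerivAt (fun k => α k w) _ k :=
          ((hα.differentiable (by simp) k).hasFDerivAt).clm_apply (hasFDerivAt_const w k)
        have h2 : HasFDerivAt (fun k => fderiv ℝ g k (w, 0) + k.2 ^ m * γ k w) _ k :=
          ((((hg.fderiv_right (m := ∞) (by simp)).differentiable (by simp) k).hasFDerivAt).clm_apply
            (hasFDerivAt_const (w, (0 : ℝ)) k)).add
          ((hasFDerivAt_snd.pow m).mul
            (((hγ.differentiable (by simp) k).hasFDerivAt).clm_apply (hasFDerivAt_const w k)))
        have h3 := h1.unique (h2.congr_of_eventuallyEq (hk'.mono fun k hk => hk w))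
        have h4 := DFunLike.congr_fun h3 (u, 0)
        simpa using h4
      have h5 := hk u w
      rw [e, e, hs] at h5
      have h6 : k.2 ^ m * (fderiv ℝ γ k (u, 0) w - fderiv ℝ γ k (w, 0) u) =
          k.2 ^ m * fderiv ℝ β k (0, 1) u w := by linear_combination h5
      exact mul_left_cancel₀ hx' h6)
  filter_upwards [key] with k hk u w
  exact DFunLike.congr_fun (DFunLike.congr_fun hk u) w

/-- The two-form `dx ∧ γ + β` on `H × ℝ`. -/
noncomputable def cylinderForm (γ : H × ℝ → H →L[ℝ] ℝ) (β : H × ℝ → H →L[ℝ] H →L[ℝ] ℝ)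
    (k : H × ℝ) : (H × ℝ) →L[ℝ] (H × ℝ) →L[ℝ] ℝ :=
  (ContinuousLinearMap.snd ℝ H ℝ).smulRight ((γ k).comp (ContinuousLinearMap.fst ℝ H ℝ)) -
    ((γ k).comp (ContinuousLinearMap.fst ℝ H ℝ)).smulRight (ContinuousLinearMap.snd ℝ H ℝ) +
    (((ContinuousLinearMap.compL ℝ (H × ℝ) H ℝ).flip (ContinuousLinearMap.fst ℝ H ℝ)).comp
      (β k)).comp (ContinuousLinearMap.fst ℝ H ℝ)

theorem cylinderForm_apply (γ : H × ℝ → H →L[ℝ] ℝ) (β : H × ℝ → H →L[ℝ] H →L[ℝ] ℝ)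
    (k p q : H × ℝ) : cylinderForm γ β k p q =
      p.2 * γ k q.1 - q.2 * γ k p.1 + β k p.1 q.1 := by
  simp [cylinderForm, mul_comm]

theorem contDiff_cylinderForm {γ : H × ℝ → H →L[ℝ] ℝ} (hγ : ContDiff ℝ ∞ γ)
    {β : H × ℝ → H →L[ℝ] H →L[ℝ] ℝ} (hβ : ContDiff ℝ ∞ β) :
    ContDiff ℝ ∞ (cylinderForm γ β) := by
  refine contDiff_clm_apply_iff.2 fun p => contDiff_clm_apply_iff.2 fun q => ?_
  simp only [cylinderForm_apply]
  exact ((contDiff_const.mul (hγ.clm_apply contDiff_const)).sub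
    (contDiff_const.mul (hγ.clm_apply contDiff_const))).add
    ((hβ.clm_apply contDiff_const).clm_apply contDiff_const)

/-- The exterior derivative is `d_H β + dx ∧ (∂ₓβ - d_H γ)`; the derivative of `γ` in `x` is killed
by `dx ∧ dx`. -/
theorem isClosedFormAt_cylinderForm {γ : H × ℝ → H →L[ℝ] ℝ} (hγ : ContDiff ℝ ∞ γ)
    {β : H × ℝ → H →L[ℝ] H →L[ℝ] ℝ} (hβ : ContDiff ℝ ∞ β) {k : H × ℝ}
    (halt : ∀ k u v, β k u v = -β k v u)
    (h1 : ∀ u v w, fderiv ℝ β k (u, 0) v w + fderiv ℝ β k (v, 0) w u +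
      fderiv ℝ β k (w, 0) u v = 0)
    (h2 : ∀ u w, fderiv ℝ γ k (u, 0) w - fderiv ℝ γ k (w, 0) u = fderiv ℝ β k (0, 1) u w) :
    IsClosedFormAt (cylinderForm γ β) k := by
  have hγ' := (hγ.differentiable (by simp) k).hasFDerivAt
  have hβ' := hβ.differentiable (by simp) k
  have hβalt : ∀ p u v, fderiv ℝ β k p u v = -fderiv ℝ β k p v u := fun p u v => by
    rw [← fderiv_bilin_apply hβ', ← fderiv_bilin_apply hβ',
      show (fun k => β k u v) = fun k => -β k v u from funext fun k => halt k u v, fderiv_fun_neg]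
    rfl
  have key : ∀ p q r, fderiv ℝ (cylinderForm γ β) k p q r =
      q.2 * fderiv ℝ γ k p r.1 - r.2 * fderiv ℝ γ k p q.1 + fderiv ℝ β k p q.1 r.1 := by
    intro p q r
    rw [← fderiv_bilin_apply ((contDiff_cylinderForm hγ hβ).differentiable (by simp) k)]
    simp only [cylinderForm_apply]
    have e1 := fun w => hγ'.clm_apply (hasFDerivAt_const w k)
    have e2 := ((hβ'.hasFDerivAt).clm_apply (hasFDerivAt_const q.1 k)).clm_apply
      (hasFDerivAt_const r.1 k)
    have e3 := (((e1 r.1).const_mul q.2).sub ((e1 q.1).const_mul r.2)).add e2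
    refine (DFunLike.congr_fun e3.fderiv p).trans ?_
    simp
  have e1 : ∀ q : H × ℝ, q = (q.1, 0) + q.2 • (0, 1) := fun q => by ext <;> simp
  have eγ : ∀ q w, fderiv ℝ γ k q w = fderiv ℝ γ k (q.1, 0) w + q.2 * fderiv ℝ γ k (0, 1) w :=
    fun q w => by conv_lhs => rw [e1 q, map_add, map_smul]; simp
  have eβ : ∀ q u w, fderiv ℝ β k q u w =
      fderiv ℝ β k (q.1, 0) u w + q.2 * fderiv ℝ β k (0, 1) u w :=
    fun q u w => by conv_lhs => rw [e1 q, map_add, map_smul]; simp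
  intro p q r
  rw [key, key, key]
  simp only [eγ p, eγ q, eγ r, eβ p, eβ q, eβ r, ← h2]
  linear_combination h1 p.1 q.1 r.1

end Homotopy

/-! ### `b^m`-forms on a normed space, and their normal form when the Hamiltonian field is `∂ₜ` -/

section BmLocal

variable {E F : Type} [NormedAddCommGroup E] [NormedSpace ℝ E]
  [NormedAddCommGroup F] [NormedSpace ℝ F]

/-- The map `v ↦ (v, dX(v) / X^m)` into the `b^m`-tangent space off the zero set of `X`. -/
noncomputable def bmLiftAt (X : E → ℝ) (m : ℕ) (z : E) : E →L[ℝ] E × ℝ :=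
  (ContinuousLinearMap.id ℝ E).prod ((X z ^ m)⁻¹ • fderiv ℝ X z)

/-- The two-form on the complement of the zero set of `X` defined by a `b^m`-form. -/
noncomputable def bmRestrict (X : E → ℝ) (m : ℕ) (Ω : E → (E × ℝ) →L[ℝ] (E × ℝ) →L[ℝ] ℝ) (z : E) :
    E →L[ℝ] E →L[ℝ] ℝ :=
  (((ContinuousLinearMap.compL ℝ E (E × ℝ) ℝ).flip (bmLiftAt X m z)).comp (Ω z)).comp
    (bmLiftAt X m z)

theorem bmRestrict_apply (X : E → ℝ) (m : ℕ) (Ω : E → (E × ℝ) →L[ℝ] (E × ℝ) →L[ℝ] ℝ)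
    (z u v : E) : bmRestrict X m Ω z u v =
      Ω z (u, (X z ^ m)⁻¹ * fderiv ℝ X z u) (v, (X z ^ m)⁻¹ * fderiv ℝ X z v) := rfl

theorem differentiableAt_bmLiftAt {X : E → ℝ} (hX : ContDiff ℝ ∞ X) {m : ℕ} {z : E}
    (hz : X z ≠ 0) : DifferentiableAt ℝ (bmLiftAt X m) z := by
  have h1 : DifferentiableAt ℝ (fun z => (X z ^ m)⁻¹ • fderiv ℝ X z) z :=
    (((hX.differentiable (by simp) z).pow m).inv (pow_ne_zero m hz)).smul
      ((hX.fderiv_right (m := ∞) (by simp)).differentiable (by simp) z)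
  have h2 := (ContinuousLinearMap.compL ℝ E ℝ (E × ℝ)
    (ContinuousLinearMap.inr ℝ E ℝ)).differentiableAt.comp z h1
  have h3 : bmLiftAt X m = fun z => ContinuousLinearMap.inl ℝ E ℝ +
      (ContinuousLinearMap.inr ℝ E ℝ).comp ((X z ^ m)⁻¹ • fderiv ℝ X z) := by
    funext z
    ext v <;> simp [bmLiftAt]
  rw [h3]
  exact h2.const_add _

theorem differentiableAt_bmRestrict {X : E → ℝ} (hX : ContDiff ℝ ∞ X) {m : ℕ}
    {Ω : E → (E × ℝ) →L[ℝ] (E × ℝ) →L[ℝ] ℝ} (hΩ : ContDiff ℝ ∞ Ω) {z : E} (hz : X z ≠ 0) :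
    DifferentiableAt ℝ (bmRestrict X m Ω) z := by
  have hl := differentiableAt_bmLiftAt hX (m := m) hz
  exact (((ContinuousLinearMap.differentiableAt _).comp z hl).clm_comp
    (hΩ.differentiable (by simp) z)).clm_comp hl

/-- The `b^m`-form `Ω` has the Darboux normal form near `a`, with `X` as first coordinate. -/
def IsBmDarboux (k : ℕ) (X : E → ℝ) (m : ℕ) (Ω : E → (E × ℝ) →L[ℝ] (E × ℝ) →L[ℝ] ℝ) (a : E) :
    Prop :=
  ∃ (y₀ : E → ℝ) (x y : Fin k → E → ℝ), ContDiff ℝ ∞ y₀ ∧ (∀ i, ContDiff ℝ ∞ (x i)) ∧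
    (∀ i, ContDiff ℝ ∞ (y i)) ∧ ∀ᶠ z in 𝓝 a, ∀ e e' : E × ℝ,
      fderiv ℝ X z e.1 = X z ^ m * e.2 → fderiv ℝ X z e'.1 = X z ^ m * e'.2 →
      Ω z e e' = wedgeEval Prod.snd (fun e : E × ℝ => fderiv ℝ y₀ z e.1) e e' +
        ∑ i, wedgeEval (fderiv ℝ (x i) z) (fderiv ℝ (y i) z) e.1 e'.1

/-- The pullback of a `b^m`-form, given by its extension to the ambient bundle. -/
noncomputable def pullbackBm (Φ : E → F) (Ω : F → (F × ℝ) →L[ℝ] (F × ℝ) →L[ℝ] ℝ) (z : E) :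
    (E × ℝ) →L[ℝ] (E × ℝ) →L[ℝ] ℝ :=
  (((ContinuousLinearMap.compL ℝ (E × ℝ) (F × ℝ) ℝ).flip
    ((fderiv ℝ Φ z).prodMap (ContinuousLinearMap.id ℝ ℝ))).comp (Ω (Φ z))).comp
    ((fderiv ℝ Φ z).prodMap (ContinuousLinearMap.id ℝ ℝ))

theorem pullbackBm_apply (Φ : E → F) (Ω : F → (F × ℝ) →L[ℝ] (F × ℝ) →L[ℝ] ℝ) (z : E)
    (e e' : E × ℝ) : pullbackBm Φ Ω z e e' =
      Ω (Φ z) (fderiv ℝ Φ z e.1, e.2) (fderiv ℝ Φ z e'.1, e'.2) := rfl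

theorem contDiff_pullbackBm [FiniteDimensional ℝ E] {Φ : E → F}
    {Ω : F → (F × ℝ) →L[ℝ] (F × ℝ) →L[ℝ] ℝ} (hΦ : ContDiff ℝ ∞ Φ) (hΩ : ContDiff ℝ ∞ Ω) :
    ContDiff ℝ ∞ (pullbackBm Φ Ω) := by
  have h := hΦ.fderiv_right (m := ∞) (by simp)
  refine contDiff_clm_apply_iff.2 fun e => contDiff_clm_apply_iff.2 fun e' => ?_
  exact ((hΩ.comp hΦ).clm_apply ((h.clm_apply contDiff_const).prodMk contDiff_const)).clm_apply
    ((h.clm_apply contDiff_const).prodMk contDiff_const)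

theorem bmRestrict_pullbackBm {Φ : E → F} (hΦ : ContDiff ℝ ∞ Φ) {X : F → ℝ}
    (hX : ContDiff ℝ ∞ X) (m : ℕ) (Ω : F → (F × ℝ) →L[ℝ] (F × ℝ) →L[ℝ] ℝ) :
    bmRestrict (X ∘ Φ) m (pullbackBm Φ Ω) = pullbackForm Φ (bmRestrict X m Ω) := by
  funext z
  refine ContinuousLinearMap.ext fun u => ContinuousLinearMap.ext fun v => ?_
  rw [pullbackForm_apply, bmRestrict_apply, bmRestrict_apply, pullbackBm_apply,
    fderiv_comp z (hX.differentiable (by simp) _) (hΦ.differentiable (by simp) _)]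
  rfl

theorem IsBmDarboux.pullback {k m : ℕ} {X : F → ℝ} (hX : ContDiff ℝ ∞ X)
    {Ω : F → (F × ℝ) →L[ℝ] (F × ℝ) →L[ℝ] ℝ} {Φ : E → F}
    (hΦ : ContDiff ℝ ∞ Φ) {a : E} (h : IsBmDarboux k X m Ω (Φ a)) :
    IsBmDarboux k (X ∘ Φ) m (pullbackBm Φ Ω) a := by
  obtain ⟨y₀, x, y, hy₀, hx, hy, hxy⟩ := h
  refine ⟨y₀ ∘ Φ, fun i => x i ∘ Φ, fun i => y i ∘ Φ, hy₀.comp hΦ, fun i => (hx i).comp hΦ,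
    fun i => (hy i).comp hΦ, ?_⟩
  filter_upwards [hΦ.continuous.continuousAt.eventually hxy] with z hz e e' he he'
  have hc : ∀ f : F → ℝ, ContDiff ℝ ∞ f → fderiv ℝ (f ∘ Φ) z =
      (fderiv ℝ f (Φ z)).comp (fderiv ℝ Φ z) := fun f hf =>
    fderiv_comp z (hf.differentiable (by simp) _) (hΦ.differentiable (by simp) _)
  rw [hc _ hX] at he he'
  rw [pullbackBm_apply, hz (fderiv ℝ Φ z e.1, e.2) (fderiv ℝ Φ z e'.1, e'.2) he he', hc _ hy₀]
  congr 1
  refine Finset.sum_congr rfl fun i _ => ?_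
  rw [hc _ (hx i), hc _ (hy i)]
  rfl

theorem IsBmDarboux.congr {k m : ℕ} {X X' : E → ℝ} {Ω Ω' : E → (E × ℝ) →L[ℝ] (E × ℝ) →L[ℝ] ℝ}
    {a : E} (h : IsBmDarboux k X m Ω a) (hX : X' =ᶠ[𝓝 a] X)
    (hΩ : ∀ᶠ z in 𝓝 a, Ω' z = Ω z) : IsBmDarboux k X' m Ω' a := by
  obtain ⟨y₀, x, y, hy₀, hx, hy, hxy⟩ := h
  refine ⟨y₀, x, y, hy₀, hx, hy, ?_⟩
  filter_upwards [hxy, hX.eventually_nhds, hΩ] with z h1 h2 h3 e e' he he'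
  have h4 : X' z = X z := h2.self_of_nhds
  have h5 : fderiv ℝ X' z = fderiv ℝ X z := Filter.EventuallyEq.fderiv_eq h2
  rw [h4, h5] at he he'
  rw [h3]
  exact h1 e e' he he'

variable {H : Type} [NormedAddCommGroup H] [NormedSpace ℝ H] [FiniteDimensional ℝ H]

/-- The projection `((w, x), t) ↦ x`. -/
noncomputable def xProj (H : Type) [NormedAddCommGroup H] [NormedSpace ℝ H] :
    ((H × ℝ) × ℝ) →L[ℝ] ℝ :=
  (ContinuousLinearMap.snd ℝ H ℝ).comp (ContinuousLinearMap.fst ℝ (H × ℝ) ℝ)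

@[simp] theorem xProj_apply (g : (H × ℝ) × ℝ) : xProj H g = g.1.2 := rfl

/-- The inclusion of `H` in the ambient bundle. -/
noncomputable def ambientInl (H : Type) [NormedAddCommGroup H] [NormedSpace ℝ H] :
    H →L[ℝ] ((H × ℝ) × ℝ) × ℝ :=
  (ContinuousLinearMap.inl ℝ ((H × ℝ) × ℝ) ℝ).comp
    ((ContinuousLinearMap.inl ℝ (H × ℝ) ℝ).comp (ContinuousLinearMap.inl ℝ H ℝ))

@[simp] theorem ambientInl_apply (w : H) : ambientInl H w = (((w, 0), 0), 0) := rfl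

/-- The contraction of a `b^m`-form with `x^m ∂ₓ`, restricted to `H`. -/
noncomputable def bmAlpha (m : ℕ)
    (Ω : (H × ℝ) × ℝ → (((H × ℝ) × ℝ) × ℝ) →L[ℝ] (((H × ℝ) × ℝ) × ℝ) →L[ℝ] ℝ)
    (g : (H × ℝ) × ℝ) : H →L[ℝ] ℝ :=
  (Ω g (((0, g.1.2 ^ m), 0), 1)).comp (ambientInl H)

/-- The restriction of a `b^m`-form to `H`. -/
noncomputable def bmBeta
    (Ω : (H × ℝ) × ℝ → (((H × ℝ) × ℝ) × ℝ) →L[ℝ] (((H × ℝ) × ℝ) × ℝ) →L[ℝ] ℝ)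
    (g : (H × ℝ) × ℝ) : H →L[ℝ] H →L[ℝ] ℝ :=
  (((ContinuousLinearMap.compL ℝ H (((H × ℝ) × ℝ) × ℝ) ℝ).flip (ambientInl H)).comp (Ω g)).comp
    (ambientInl H)

variable {m : ℕ} {Ω : (H × ℝ) × ℝ → (((H × ℝ) × ℝ) × ℝ) →L[ℝ] (((H × ℝ) × ℝ) × ℝ) →L[ℝ] ℝ}

theorem bmAlpha_apply (g : (H × ℝ) × ℝ) (w : H) :
    bmAlpha m Ω g w = Ω g (((0, g.1.2 ^ m), 0), 1) (((w, 0), 0), 0) := rfl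

theorem bmBeta_apply (g : (H × ℝ) × ℝ) (u w : H) :
    bmBeta Ω g u w = Ω g (((u, 0), 0), 0) (((w, 0), 0), 0) := rfl

theorem contDiff_bmAlpha (hΩ : ContDiff ℝ ∞ Ω) : ContDiff ℝ ∞ (bmAlpha m Ω) :=
  (hΩ.clm_apply (by fun_prop)).clm_comp contDiff_const

theorem contDiff_bmBeta (hΩ : ContDiff ℝ ∞ Ω) : ContDiff ℝ ∞ (bmBeta Ω) :=
  contDiff_clm_apply_iff.2 fun _ => contDiff_clm_apply_iff.2 fun _ =>
    (hΩ.clm_apply contDiff_const).clm_apply contDiff_const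

/-- The differential equations relating the components `α`, `β` of a closed `b^m`-form
`dx / x^m ∧ α + β` that does not depend on `t`. -/
def BmStructureEquations (m : ℕ) (α : (H × ℝ) × ℝ → H →L[ℝ] ℝ)
    (β : (H × ℝ) × ℝ → H →L[ℝ] H →L[ℝ] ℝ) (g : (H × ℝ) × ℝ) : Prop :=
  (fderiv ℝ α g (0, 1) = 0 ∧ fderiv ℝ β g (0, 1) = 0) ∧
  (∀ u v w, fderiv ℝ β g ((u, 0), 0) v w + fderiv ℝ β g ((v, 0), 0) w u +
    fderiv ℝ β g ((w, 0), 0) u v = 0) ∧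
  ∀ u w, fderiv ℝ α g ((u, 0), 0) w - fderiv ℝ α g ((w, 0), 0) u =
    g.1.2 ^ m * fderiv ℝ β g ((0, 1), 0) u w

/-- The differential equations satisfied by the components of a closed `b^m`-form for which
`∂ₜ` is the Hamiltonian vector field of `dx / x^m`. -/
theorem bm_structure_equations (hΩ : ContDiff ℝ ∞ Ω) (halt : ∀ g e e', Ω g e e' = -Ω g e' e)
    {g : (H × ℝ) × ℝ} (hg : g.1.2 ≠ 0)
    (hT : ∀ᶠ g in 𝓝 g, ∀ e, e.1.1.2 = g.1.2 ^ m * e.2 → Ω g (((0, 0), 1), 0) e = e.2)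
    (hcl : IsClosedFormAt (bmRestrict (xProj H) m Ω) g) :
    BmStructureEquations m (bmAlpha m Ω) (bmBeta Ω) g := by
  set ζ := bmRestrict (xProj H) m Ω
  have hζ : DifferentiableAt ℝ ζ g := differentiableAt_bmRestrict (xProj H).contDiff hΩ hg
  have hx : fderiv ℝ (xProj H) = fun _ => xProj H := funext fun _ => (xProj H).fderiv
  have hζv : ∀ g u v, ζ g u v = Ω g (u, (g.1.2 ^ m)⁻¹ * u.1.2) (v, (g.1.2 ^ m)⁻¹ * v.1.2) := by
    intro g u v
    rw [bmRestrict_apply, hx]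
    rfl
  have hζ_swap : ∀ a u v, fderiv ℝ ζ g a u v = -fderiv ℝ ζ g a v u := fun a u v => by
    rw [← fderiv_bilin_apply hζ, ← fderiv_bilin_apply hζ,
      show (fun g => ζ g u v) = fun g => -ζ g v u from funext fun g => halt _ _ _, fderiv_fun_neg]
    rfl
  have hne : ∀ᶠ g' in 𝓝 g, g'.1.2 ≠ 0 :=
    (by fun_prop : Continuous fun g : (H × ℝ) × ℝ => g.1.2).continuousAt.eventually_ne hg
  have hα := (contDiff_bmAlpha (m := m) hΩ).differentiable (by simp) g
  have hβ := (contDiff_bmBeta hΩ).differentiable (by simp) g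
  -- derivatives of the components of `ζ`
  have hc : HasFDerivAt (fun g : (H × ℝ) × ℝ => (g.1.2 ^ m)⁻¹)
      ((deriv (fun s : ℝ => (s ^ m)⁻¹) g.1.2) • xProj H) g := by
    have h1 : DifferentiableAt ℝ (fun s : ℝ => (s ^ m)⁻¹) g.1.2 :=
      (differentiableAt_pow m).inv (pow_ne_zero m hg)
    exact HasDerivAt.comp_hasFDerivAt (h₂ := fun s : ℝ => (s ^ m)⁻¹) (f := xProj H) g
      h1.hasDerivAt (xProj H).hasFDerivAt
  have hHH : ∀ a (u w : H), fderiv ℝ ζ g a ((u, 0), 0) ((w, 0), 0) =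
      fderiv ℝ (bmBeta Ω) g a u w := fun a u w => by
    rw [← fderiv_bilin_apply hζ, ← fderiv_bilin_apply hβ]
    congr 2
    funext g
    rw [hζv]
    simp [bmBeta_apply]
  -- Only directions that fix `x` are needed; for them the singular factor `x^(-m)` is constant.
  have hxH : ∀ a : (H × ℝ) × ℝ, a.1.2 = 0 → ∀ w : H, fderiv ℝ ζ g a ((0, 1), 0) ((w, 0), 0) =
      (g.1.2 ^ m)⁻¹ * fderiv ℝ (bmAlpha m Ω) g a w := fun a ha w => by
    rw [← fderiv_bilin_apply hζ]
    have h1 : (fun g => ζ g ((0, 1), 0) ((w, 0), 0)) =ᶠ[𝓝 g] fun g =>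
        (g.1.2 ^ m)⁻¹ * bmAlpha m Ω g w := by
      filter_upwards [hne] with g' hg'
      have e : ((((0, 1), 0), (g'.1.2 ^ m)⁻¹ * 1) : ((H × ℝ) × ℝ) × ℝ) =
          (g'.1.2 ^ m)⁻¹ • (((0, g'.1.2 ^ m), 0), 1) := by
        simp [inv_mul_cancel₀ (pow_ne_zero m hg')]
      rw [hζv, e, map_smul]
      simp [bmAlpha_apply]
    have h2 := hc.mul (hα.hasFDerivAt.clm_apply (hasFDerivAt_const w g))
    rw [h1.fderiv_eq]
    refine (DFunLike.congr_fun h2.fderiv a).trans ?_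
    simp [ha]
  have htH : ∀ a (w : H), fderiv ℝ ζ g a (0, 1) ((w, 0), 0) = 0 := fun a w => by
    rw [← fderiv_bilin_apply hζ, fderiv_eq_zero_of_eventually]
    · rfl
    · filter_upwards [hT] with g' hg'
      rw [hζv]
      simp only [Prod.snd_zero, mul_zero]
      exact hg' (((w, 0), 0), 0) (by simp)
  have htx : ∀ a : (H × ℝ) × ℝ, a.1.2 = 0 → fderiv ℝ ζ g a (0, 1) ((0, 1), 0) = 0 := fun a ha => by
    rw [← fderiv_bilin_apply hζ]
    have h1 : (fun g => ζ g (0, 1) ((0, 1), 0)) =ᶠ[𝓝 g] fun g => (g.1.2 ^ m)⁻¹ := by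
      filter_upwards [hT, hne] with g' h2 h3
      rw [hζv]
      simp only [Prod.snd_zero, mul_zero, mul_one]
      exact h2 (((0, 1), 0), (g'.1.2 ^ m)⁻¹) (by simp [mul_inv_cancel₀ (pow_ne_zero m h3)])
    rw [h1.fderiv_eq, hc.fderiv]
    simp [ha]
  have hx' : g.1.2 ^ m ≠ 0 := pow_ne_zero m hg
  -- The four equations are closedness on the triples `(∂ₜ, ∂ₓ, w)`, `(∂ₜ, u, w)`, `(u, v, w)` and
  -- `(∂ₓ, u, w)`, with `u, v, w` in `H`.
  refine ⟨⟨?_, ?_⟩, ?_, ?_⟩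
  · refine ContinuousLinearMap.ext fun w => ?_
    have h1 := hcl (0, 1) ((0, 1), 0) ((w, 0), 0)
    rw [hζ_swap _ _ (0, 1), htH, hxH _ rfl, htx _ rfl] at h1
    simpa [hg] using h1
  · refine ContinuousLinearMap.ext fun u => ContinuousLinearMap.ext fun w => ?_
    have h1 := hcl (0, 1) ((u, 0), 0) ((w, 0), 0)
    rw [hζ_swap _ _ (0, 1), htH, htH, hHH] at h1
    simpa using h1
  · intro u v w
    have h1 := hcl ((u, 0), 0) ((v, 0), 0) ((w, 0), 0)
    rwa [hHH, hHH, hHH] at h1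
  · intro u w
    have h1 := hcl ((0, 1), 0) ((u, 0), 0) ((w, 0), 0)
    rw [hζ_swap _ _ ((0, 1), 0), hxH _ rfl, hxH _ rfl, hHH] at h1
    field_simp at h1
    linear_combination -h1

theorem contDiff_slice {G : Type} [NormedAddCommGroup G] [NormedSpace ℝ G] {f : E × ℝ → G}
    (hf : ContDiff ℝ ∞ f) : ContDiff ℝ ∞ fun k => f (k, 0) :=
  hf.comp (contDiff_id.prodMk contDiff_const)

theorem tendsto_slice : Tendsto (fun k : E => (k, (0 : ℝ))) (𝓝 0) (𝓝 0) :=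
  (Continuous.prodMk continuous_id continuous_const).tendsto (0 : E)

/-- On `b^m`-tangent vectors the form is `dx/x^m ∧ (α - dt) + β`. Substituting `α = d_H f + x^m γ`
splits it into `dx/x^m ∧ d(f - t)` and the smooth closed form `dx ∧ γ + β` on `H × ℝ`, to which the
odd Darboux theorem applies. -/
theorem isBmDarboux_of_flow_box {k : ℕ} (hm : 0 < m) (hdim : Module.finrank ℝ H = 2 * k)
    (hΩ : ContDiff ℝ ∞ Ω) (halt : ∀ g e e', Ω g e e' = -Ω g e' e)
    (hT : ∀ᶠ g in 𝓝 (0 : (H × ℝ) × ℝ), ∀ e, e.1.1.2 = g.1.2 ^ m * e.2 →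
      Ω g (((0, 0), 1), 0) e = e.2)
    (hcl : ∀ᶠ g in 𝓝 (0 : (H × ℝ) × ℝ), g.1.2 ≠ 0 →
      IsClosedFormAt (bmRestrict (xProj H) m Ω) g)
    (hnd : ∀ e : ((H × ℝ) × ℝ) × ℝ, e.1.1.2 = 0 →
      (∀ e' : ((H × ℝ) × ℝ) × ℝ, e'.1.1.2 = 0 → Ω 0 e e' = 0) → e = 0) :
    IsBmDarboux k (xProj H) m Ω 0 := by
  have hα := contDiff_bmAlpha (m := m) hΩ
  have hβ := contDiff_bmBeta hΩ
  have hαd := hα.continuous_fderiv (by simp)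
  have hβd := hβ.continuous_fderiv (by simp)
  have hs : ∀ᶠ g in 𝓝 (0 : (H × ℝ) × ℝ), xProj H g ≠ 0 →
      BmStructureEquations m (bmAlpha m Ω) (bmBeta Ω) g := by
    filter_upwards [hT.eventually_nhds, hcl] with g h1 h2 h3
    exact bm_structure_equations hΩ halt h3 h1 (h2 h3)
  have hp : xProj H ((0, 1), 0) ≠ 0 := by simp
  -- The structure equations are known only off `x = 0`; both sides are continuous, so they persist
  -- on the hypersurface.
  have hαt := eventually_eq_of_eventually_off_hyperplane
    (f := fun g => fderiv ℝ (bmAlpha m Ω) g (0, 1)) (g := fun _ => 0)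
    (hαd.clm_apply continuous_const) continuous_const hp (hs.mono fun g h h0 => (h h0).1.1)
  have hβt := eventually_eq_of_eventually_off_hyperplane
    (f := fun g => fderiv ℝ (bmBeta Ω) g (0, 1)) (g := fun _ => 0)
    (hβd.clm_apply continuous_const) continuous_const hp (hs.mono fun g h h0 => (h h0).1.2)
  have hα0 := eventually_eq_of_fderiv_snd_eq_zero hα hαt
  have hβ0 := eventually_eq_of_fderiv_snd_eq_zero hβ hβt
  set α : H × ℝ → H →L[ℝ] ℝ := fun k => bmAlpha m Ω (k, 0)
  set β : H × ℝ → H →L[ℝ] H →L[ℝ] ℝ := fun k => bmBeta Ω (k, 0)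
  have hα' : ContDiff ℝ ∞ α := contDiff_slice hα
  have hβ' : ContDiff ℝ ∞ β := contDiff_slice hβ
  have hβalt : ∀ k u v, β k u v = -β k v u := fun k u v => halt _ _ _
  have hαs : ∀ k h, fderiv ℝ α k h = fderiv ℝ (bmAlpha m Ω) (k, 0) (h, 0) := fderiv_slice hα
  have hβs : ∀ k h, fderiv ℝ β k h = fderiv ℝ (bmBeta Ω) (k, 0) (h, 0) := fderiv_slice hβ
  have hα'd := hα'.continuous_fderiv (by simp)
  have hβ'd := hβ'.continuous_fderiv (by simp)
  have hs' := tendsto_slice.eventually hs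
  have hp' : ContinuousLinearMap.snd ℝ H ℝ (0, 1) ≠ 0 := by simp
  have hβc : ∀ᶠ k in 𝓝 (0 : H × ℝ), ∀ u v w, fderiv ℝ β k (u, 0) v w +
      fderiv ℝ β k (v, 0) w u + fderiv ℝ β k (w, 0) u v = 0 := by
    -- Values in a function space treat all triples of vectors at once, so that one neighbourhood
    -- serves them all.
    have h1 := eventually_eq_of_eventually_off_hyperplane
      (f := fun k (q : H × H × H) => fderiv ℝ β k (q.1, 0) q.2.1 q.2.2 +
        fderiv ℝ β k (q.2.1, 0) q.2.2 q.1 + fderiv ℝ β k (q.2.2, 0) q.1 q.2.1)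
      (g := fun _ _ => 0) (continuous_pi fun q => by fun_prop) (continuous_pi fun q => by fun_prop) hp' (hs'.mono fun k hk h0 => by
        funext q
        simp only [hβs]
        exact (hk h0).2.1 q.1 q.2.1 q.2.2)
    filter_upwards [h1] with k hk u v w using congrFun hk (u, v, w)
  have hαβ : ∀ᶠ k in 𝓝 (0 : H × ℝ), ∀ u w, fderiv ℝ α k (u, 0) w - fderiv ℝ α k (w, 0) u =
      k.2 ^ m * fderiv ℝ β k (0, 1) u w := by
    have h1 := eventually_eq_of_eventually_off_hyperplane
      (f := fun k (q : H × H) => fderiv ℝ α k (q.1, 0) q.2 - fderiv ℝ α k (q.2, 0) q.1)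
      (g := fun k (q : H × H) => k.2 ^ m * fderiv ℝ β k (0, 1) q.1 q.2)
      (continuous_pi fun q => by fun_prop) (continuous_pi fun q => by fun_prop) hp' (hs'.mono fun k hk h0 => by
        funext q
        simp only [hαs, hβs]
        exact (hk h0).2.2 q.1 q.2)
    filter_upwards [h1] with k hk u w using congrFun hk (u, w)
  obtain ⟨f, γ, hf, hγ, hγ0, hfγ⟩ := exists_primitive_mod_pow m hα' hβ' hαβ
  have hγβ := eventually_differential_of_mod_pow hα' hβ' hαβ hf hγ hfγ
  let η := cylinderForm γ β
  have hηcl : ∀ᶠ k in 𝓝 0, IsClosedFormAt η k := by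
    filter_upwards [hβc, hγβ] with k h1 h2
    exact isClosedFormAt_cylinderForm hγ hβ' hβalt h1 h2
  -- expansion of `Ω` on the `b^m`-tangent space
  have hexp : ∀ g, (∀ e : ((H × ℝ) × ℝ) × ℝ, e.1.1.2 = g.1.2 ^ m * e.2 →
      Ω g (((0, 0), 1), 0) e = e.2) →
      ∀ e e' : ((H × ℝ) × ℝ) × ℝ, e.1.1.2 = g.1.2 ^ m * e.2 → e'.1.1.2 = g.1.2 ^ m * e'.2 →
      Ω g e e' = e.2 * (bmAlpha m Ω g e'.1.1.1 - e'.1.2) - e'.2 * (bmAlpha m Ω g e.1.1.1 - e.1.2) +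
        bmBeta Ω g e.1.1.1 e'.1.1.1 := by
    intro g hg e e' he he'
    have hdec : ∀ e : ((H × ℝ) × ℝ) × ℝ, e.1.1.2 = g.1.2 ^ m * e.2 →
        e = e.2 • (((0, g.1.2 ^ m), 0), 1) + ambientInl H e.1.1.1 + e.1.2 • (((0, 0), 1), 0) := by
      rintro ⟨⟨⟨w, x⟩, t⟩, c⟩ he
      have he : x = g.1.2 ^ m * c := he
      subst he
      ext <;> simp [mul_comm]
    have halt0 : ∀ e, Ω g e e = 0 := fun e => by linarith [halt g e e]
    have hTP : Ω g (((0, 0), 1), 0) (((0, g.1.2 ^ m), 0), 1) = 1 := hg _ (by simp)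
    have hTH : ∀ w, Ω g (((0, 0), 1), 0) (ambientInl H w) = 0 := fun w => hg _ (by simp)
    have hPT : Ω g (((0, g.1.2 ^ m), 0), 1) (((0, 0), 1), 0) = -1 := by rw [halt, hTP]
    have hHT : ∀ w, Ω g (ambientInl H w) (((0, 0), 1), 0) = 0 := fun w => by
      rw [halt, hTH, neg_zero]
    have hPH : ∀ w, Ω g (((0, g.1.2 ^ m), 0), 1) (ambientInl H w) = bmAlpha m Ω g w := fun w => rfl
    have hHP : ∀ w, Ω g (ambientInl H w) (((0, g.1.2 ^ m), 0), 1) = -bmAlpha m Ω g w := fun w => by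
      rw [halt, hPH]
    have hHH : ∀ u w, Ω g (ambientInl H u) (ambientInl H w) = bmBeta Ω g u w := fun _ _ => rfl
    conv_lhs => rw [hdec e he, hdec e' he']
    simp only [map_add, map_smul, add_apply, smul_apply, smul_eq_mul, hTP, hTH, hPT, hHT, hPH, hHP,
      hHH, halt0]
    ring
  have hD := darbouxOdd k (H × ℝ) (η := η) (a := 0) (by simp [hdim])
    (contDiff_cylinderForm hγ hβ')
    (fun z u v => by
      simp only [η, cylinderForm_apply]
      rw [hβalt]
      ring) hηcl (w := (0, 1)) (by simp)
    (fun v => by simp [η, cylinderForm_apply, hγ0])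
    (by
      intro p hp
      refine ⟨p.2, ?_⟩
      have hβp : ∀ w, β 0 p.1 w = 0 := fun w => by
        have := hp (w, 0)
        simpa [η, cylinderForm_apply, hγ0] using this
      have h0 : (0 : (H × ℝ) × ℝ).1.2 ^ m = 0 := by simp [hm.ne']
      -- The `t`-component is chosen to cancel `α - dt`. Since `β` also annihilates `p.1`, this
      -- vector lies in the kernel of `Ω` on the `b^m`-tangent space.
      have h1 := hnd (((p.1, 0), bmAlpha m Ω 0 p.1), 0) rfl fun e' he' => by
        rw [hexp 0 hT.self_of_nhds _ _ (by simp [hm.ne']) (by simp [hm.ne', he'])]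
        have : bmBeta Ω 0 p.1 e'.1.1.1 = 0 := hβp _
        simp [this]
      have h2 : p.1 = 0 := congrArg (fun e => e.1.1.1) h1
      ext <;> simp [h2])
  obtain ⟨x, y, hx, hy, hxy⟩ := hD
  refine ⟨fun g => f g.1 - g.2, fun i g => x i g.1, fun i g => y i g.1,
    (hf.comp contDiff_fst).sub contDiff_snd, fun i => (hx i).comp contDiff_fst,
    fun i => (hy i).comp contDiff_fst, ?_⟩
  have hfst : Tendsto (fun g : (H × ℝ) × ℝ => g.1) (𝓝 0) (𝓝 0) := continuous_fst.tendsto 0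
  filter_upwards [hT, hα0, hβ0, hfst.eventually hfγ, hfst.eventually hxy] with g h1 h2 h3 h4 h5
    e e' he he'
  rw [(xProj H).fderiv] at he he'
  change e.1.1.2 = g.1.2 ^ m * e.2 at he
  change e'.1.1.2 = g.1.2 ^ m * e'.2 at he'
  have hfd : ∀ φ : H × ℝ → ℝ, ContDiff ℝ ∞ φ → ∀ v, fderiv ℝ (fun g : (H × ℝ) × ℝ => φ g.1) g v =
      fderiv ℝ φ g.1 v.1 := fun φ hφ v => by
    have : HasFDerivAt (fun g : (H × ℝ) × ℝ => φ g.1) _ g :=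
      ((hφ.differentiable (by simp) g.1).hasFDerivAt).comp g hasFDerivAt_fst
    rw [this.fderiv]
    rfl
  have hfd₀ : ∀ v, fderiv ℝ (fun g : (H × ℝ) × ℝ => f g.1 - g.2) g v =
      fderiv ℝ f g.1 v.1 - v.2 := fun v => by
    have : HasFDerivAt (fun g : (H × ℝ) × ℝ => f g.1 - g.2) _ g :=
      (((hf.differentiable (by simp) g.1).hasFDerivAt).comp g hasFDerivAt_fst).sub hasFDerivAt_snd
    rw [this.fderiv]
    rfl
  have hsum := h5 e.1.1 e'.1.1
  simp only [η, cylinderForm_apply] at hsum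
  have hf1 : ∀ p : H × ℝ, fderiv ℝ f g.1 p = fderiv ℝ f g.1 (p.1, 0) + p.2 * fderiv ℝ f g.1 (0, 1) :=
    fun p => by
      have e1 : p = (p.1, 0) + p.2 • (0, 1) := by ext <;> simp
      conv_lhs => rw [e1, map_add, map_smul, smul_eq_mul]
  rw [hexp g h1 e e' he he', h2, h3]
  simp only [wedgeEval, hfd _ (hx _), hfd _ (hy _), hfd₀]
  simp only [wedgeEval] at hsum
  rw [← hsum, hf1 e.1.1, hf1 e'.1.1, he, he']
  change e.2 * (α g.1 e'.1.1.1 - e'.1.2) - e'.2 * (α g.1 e.1.1.1 - e.1.2) +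
    β g.1 e.1.1.1 e'.1.1.1 = _
  rw [h4, h4]
  ring

end BmLocal

/-! ### The Hamiltonian field of `dX / X^m` and the local theorem on a normed space -/

section BmDarboux

variable {E H : Type} [NormedAddCommGroup E] [NormedSpace ℝ E] [FiniteDimensional ℝ E]
  [NormedAddCommGroup H] [NormedSpace ℝ H] [FiniteDimensional ℝ H]

/-- Linear coordinates adapted to a nonzero linear form and a nonzero vector in its kernel. -/
theorem exists_equiv_adapted (hdim : Module.finrank ℝ E = Module.finrank ℝ H + 2) {l : E →L[ℝ] ℝ}
    (hl : l ≠ 0) {w : E} (hw : w ≠ 0) (hlw : l w = 0) :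
    ∃ e : E ≃L[ℝ] (H × ℝ) × ℝ, (∀ v, (e v).1.2 = l v) ∧ e w = (0, 1) := by
  obtain ⟨e₁, he₁⟩ := exists_equiv_prod_symm (F := H × ℝ) (by simp [hdim]) hw
  let l' : H × ℝ →L[ℝ] ℝ := l.comp
    ((e₁.symm : (H × ℝ) × ℝ →L[ℝ] E).comp (ContinuousLinearMap.inl ℝ (H × ℝ) ℝ))
  have hl' : ∀ v, l' (e₁ v).1 = l v := fun v => by
    have h1 : v = e₁.symm ((e₁ v).1, 0) + (e₁ v).2 • w := by
      have h2 : w = e₁.symm (0, 1) := by rw [← he₁, e₁.symm_apply_apply]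
      conv_rhs => rw [h2]
      rw [← map_smul, ← map_add]
      simp
    conv_rhs => rw [h1, map_add, map_smul, hlw, smul_zero, add_zero]
    rfl
  have hl0 : l' ≠ 0 := by
    rintro h
    refine hl (ContinuousLinearMap.ext fun v => ?_)
    rw [← hl', h]
    rfl
  obtain ⟨e₂, he₂⟩ := exists_equiv_prod_snd (F := H) (by simp) hl0
  refine ⟨e₁.trans (e₂.prodCongr (ContinuousLinearEquiv.refl ℝ ℝ)), fun v => ?_, ?_⟩
  · change (e₂ (e₁ v).1).2 = _
    rw [he₂, hl']
  · change (e₂ (e₁ w).1, (e₁ w).2) = _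
    rw [he₁]
    simp

theorem IsClosedFormAt.congr {η ζ : E → E →L[ℝ] E →L[ℝ] ℝ} {z : E} (h : IsClosedFormAt η z)
    (he : ζ =ᶠ[𝓝 z] η) : IsClosedFormAt ζ z := by
  intro u v w
  rw [he.fderiv_eq]
  exact h u v w

theorem bmRestrict_congr {X X' : E → ℝ} {z : E} (h : X =ᶠ[𝓝 z] X') (m : ℕ)
    (Ω : E → (E × ℝ) →L[ℝ] (E × ℝ) →L[ℝ] ℝ) : bmRestrict X m Ω z = bmRestrict X' m Ω z := by
  unfold bmRestrict bmLiftAt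
  rw [h.fderiv_eq, h.eq_of_nhds]

/-- The Hamiltonian vector field of `dX / X^m`. -/
theorem exists_bm_field {m : ℕ} (hm : 0 < m) {X : E → ℝ} (hX : ContDiff ℝ ∞ X) {a : E}
    (hXa : X a = 0) (hdX : fderiv ℝ X a ≠ 0) {Ω : E → (E × ℝ) →L[ℝ] (E × ℝ) →L[ℝ] ℝ}
    (hΩ : ContDiff ℝ ∞ Ω) (halt : ∀ z e e', Ω z e e' = -Ω z e' e)
    (hnd : ∀ e : E × ℝ, fderiv ℝ X a e.1 = 0 →
      (∀ e' : E × ℝ, fderiv ℝ X a e'.1 = 0 → Ω a e e' = 0) → e = 0) :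
    ∃ W : E → E, ContDiff ℝ ∞ W ∧ W a ≠ 0 ∧ ∀ᶠ z in 𝓝 a, fderiv ℝ X z (W z) = 0 ∧
      ∀ e : E × ℝ, fderiv ℝ X z e.1 = X z ^ m * e.2 → Ω z (W z, 0) e = e.2 := by
  -- The kernel of `l z` is the `b^m`-tangent space. Bordering `Ω` by `l`, with a multiplier `μ`,
  -- turns inversion on this varying subspace into inversion on a fixed space.
  let l : E → (E × ℝ) →L[ℝ] ℝ := fun z =>
    (fderiv ℝ X z).comp (ContinuousLinearMap.fst ℝ E ℝ) - X z ^ m • ContinuousLinearMap.snd ℝ E ℝ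
  have hl : ∀ z e, l z e = fderiv ℝ X z e.1 - X z ^ m * e.2 := fun z e => rfl
  have hla : ∀ e, l a e = fderiv ℝ X a e.1 := fun e => by simp [hl, hXa, hm.ne']
  have hls : ContDiff ℝ ∞ l := contDiff_clm_apply_iff.2 fun e => by
    simp only [hl]
    exact ((hX.fderiv_right (m := ∞) (by simp)).clm_apply contDiff_const).sub
      ((hX.pow m).mul contDiff_const)
  let A : E → ((E × ℝ) × ℝ) →L[ℝ] ((E × ℝ) →L[ℝ] ℝ) × ℝ := fun z =>
    ((Ω z).comp (ContinuousLinearMap.fst ℝ (E × ℝ) ℝ) +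
      (ContinuousLinearMap.snd ℝ (E × ℝ) ℝ).smulRight (l z)).prod
    ((l z).comp (ContinuousLinearMap.fst ℝ (E × ℝ) ℝ))
  have hA : ContDiff ℝ ∞ A := contDiff_clm_apply_iff.2 fun q => by
    change ContDiff ℝ ∞ fun z => (Ω z q.1 + q.2 • l z, l z q.1)
    exact ((hΩ.clm_apply contDiff_const).add (hls.const_smul q.2)).prodMk
      (hls.clm_apply contDiff_const)
  have halt0 : ∀ z u, Ω z u u = 0 := fun z u => by linarith [halt z u u]
  have hinj : ∀ q, A a q = 0 → q = 0 := by
    rintro ⟨e, μ⟩ h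
    have h1 : Ω a e + μ • l a = 0 := congrArg Prod.fst h
    have h2 : l a e = 0 := congrArg Prod.snd h
    have h1' : ∀ e', Ω a e e' + μ * l a e' = 0 := fun v => DFunLike.congr_fun h1 v
    have he : e = 0 := by
      refine hnd e (by rw [← hla, h2]) fun e' he' => ?_
      have := h1' e'
      rwa [hla, he', mul_zero, add_zero] at this
    subst he
    obtain ⟨v, hv⟩ : ∃ v, fderiv ℝ X a v ≠ 0 := by
      by_contra! h0
      exact hdX (ContinuousLinearMap.ext h0)
    have h3 := h1' (v, 0)
    rw [map_zero, zero_apply, zero_add, hla] at h3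
    have : μ = 0 := (mul_eq_zero.1 h3).resolve_right hv
    rw [this]
    rfl
  obtain ⟨s, hs, hsA⟩ := exists_smooth_solution (by simp [finrank_continuousDual]) hA hinj
    (contDiff_const (c := (ContinuousLinearMap.snd ℝ E ℝ, (0 : ℝ))))
  have hsA' : ∀ z, A z (s z) = (ContinuousLinearMap.snd ℝ E ℝ, 0) →
      fderiv ℝ X z (s z).1.1 = 0 ∧ ∀ e : E × ℝ, fderiv ℝ X z e.1 = X z ^ m * e.2 →
        Ω z ((s z).1.1, 0) e = e.2 := by
    intro z h
    have h1 : Ω z (s z).1 + (s z).2 • l z = ContinuousLinearMap.snd ℝ E ℝ := congrArg Prod.fst h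
    have h2 : l z (s z).1 = 0 := congrArg Prod.snd h
    have h1' : ∀ e, Ω z (s z).1 e + (s z).2 * l z e = e.2 := fun v => DFunLike.congr_fun h1 v
    -- Pairing the solution with itself gives zero on the left and its `ℝ`-component on the right;
    -- therefore `dX(W) = 0`.
    have h3 : (s z).1.2 = 0 := by
      have := h1' (s z).1
      rw [halt0, h2] at this
      linarith
    have h4 : (s z).1 = ((s z).1.1, 0) := Prod.ext rfl h3
    refine ⟨?_, fun e he => ?_⟩
    · rw [hl, h3] at h2
      linarith
    · rw [← h4]
      have := h1' e
      rw [hl, he] at this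
      linarith
  refine ⟨fun z => (s z).1.1, contDiff_fst.comp (contDiff_fst.comp hs), fun h0 => ?_, ?_⟩
  · have h1 := (hsA' a hsA.self_of_nhds).2 (0, 1) (by simp [hXa, hm.ne'])
    rw [show (s a).1.1 = 0 from h0, show ((0, 0) : E × ℝ) = 0 from rfl, map_zero] at h1
    exact zero_ne_one h1
  · filter_upwards [hsA] with z hz using hsA' z hz

/-- A section transverse to `w` along which `X` is the last coordinate. -/
theorem exists_adapted_section {X : E → ℝ} (hX : ContDiff ℝ ∞ X) {a : E} (hXa : X a = 0)
    (e : E ≃L[ℝ] (H × ℝ) × ℝ) (he : ∀ v, (e v).1.2 = fderiv ℝ X a v) :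
    ∃ σ : H × ℝ → E, ContDiff ℝ ∞ σ ∧ σ 0 = a ∧ (∀ k, fderiv ℝ σ 0 k = e.symm (k, 0)) ∧
      ∀ᶠ k in 𝓝 (0 : H × ℝ), X (σ k) = k.2 := by
  -- The linear coordinate `x` is replaced by `X`; the derivative at `a` is still `e`, and the
  -- section is a slice of the local inverse.
  let f : E → (H × ℝ) × ℝ := fun z => (((e (z - a)).1.1, X z), (e (z - a)).2)
  have hes : ContDiff ℝ ∞ fun z => e (z - a) := e.contDiff.comp (contDiff_id.sub contDiff_const)
  have hf : ContDiff ℝ ∞ f :=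
    ((contDiff_fst.comp (contDiff_fst.comp hes)).prodMk hX).prodMk (contDiff_snd.comp hes)
  have hed : HasFDerivAt (fun z => e (z - a)) (e : E →L[ℝ] (H × ℝ) × ℝ) a :=
    ((e : E →L[ℝ] (H × ℝ) × ℝ).hasFDerivAt.comp a ((hasFDerivAt_id a).sub_const a))
  have hfd : HasFDerivAt f (e : E →L[ℝ] (H × ℝ) × ℝ) a := by
    have h1 := (hed.fst.fst.prodMk (hX.differentiable (by simp) a).hasFDerivAt).prodMk hed.snd
    refine h1.congr_fderiv (ContinuousLinearMap.ext fun v => ?_)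
    exact Prod.ext (Prod.ext rfl (he v).symm) rfl
  have hfa : f a = 0 := by simp [f, hXa]
  obtain ⟨S, hS⟩ := exists_germInverse hf e hfd
  rw [hfa] at hS
  have hSd : ∀ v, fderiv ℝ S 0 v = e.symm v := fun v => by
    have h1 : e (fderiv ℝ S 0 v) = v := by
      have := hS.fderiv_comp_base v
      rwa [hfd.fderiv] at this
    conv_rhs => rw [← h1, e.symm_apply_apply]
  refine ⟨fun k => S (k, 0), contDiff_slice hS.smooth_inv, hS.inv_base, fun k => ?_, ?_⟩
  · rw [fderiv_slice hS.smooth_inv]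
    exact hSd _
  · filter_upwards [tendsto_slice.eventually hS.right_inv] with k hk
    exact congrArg (fun q => q.1.2) hk

/-- The local `b^m`-Darboux theorem on a normed space. -/
theorem isBmDarboux_of_isClosed_of_nondegenerate {k m : ℕ} (hm : 0 < m)
    (hdim : Module.finrank ℝ E = 2 * k + 2) {X : E → ℝ} (hX : ContDiff ℝ ∞ X) {a : E}
    (hXa : X a = 0) (hdX : fderiv ℝ X a ≠ 0) {Ω : E → (E × ℝ) →L[ℝ] (E × ℝ) →L[ℝ] ℝ}
    (hΩ : ContDiff ℝ ∞ Ω) (halt : ∀ z e e', Ω z e e' = -Ω z e' e)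
    (hcl : ∀ᶠ z in 𝓝 a, X z ≠ 0 → IsClosedFormAt (bmRestrict X m Ω) z)
    (hnd : ∀ e : E × ℝ, fderiv ℝ X a e.1 = 0 →
      (∀ e' : E × ℝ, fderiv ℝ X a e'.1 = 0 → Ω a e e' = 0) → e = 0) :
    IsBmDarboux k X m Ω a := by
  obtain ⟨W, hW, hWa, hWΩ⟩ := exists_bm_field hm hX hXa hdX hΩ halt hnd
  let H := EuclideanSpace ℝ (Fin (2 * k))
  obtain ⟨e, he, heW⟩ := exists_equiv_adapted (H := H) (by simp [H, hdim]) hdX hWa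
    hWΩ.self_of_nhds.1
  obtain ⟨τ, hτ, hτ0, hτd, hτX⟩ := exists_adapted_section hX hXa e he
  obtain ⟨Ψ, Θ, hΨ, hΨτ, hΨt⟩ := exists_flow_box hW hτ e hτd (by rw [hτ0, heW])
  rw [hτ0] at hΨ
  -- The function `X` is constant along the flow, since `dX(W) = 0`, and equals the coordinate `x`
  -- on the section.
  have hXΨ : X ∘ Ψ =ᶠ[𝓝 0] xProj H := by
    have h1 : ∀ᶠ p in 𝓝 (0 : (H × ℝ) × ℝ), fderiv ℝ (X ∘ Ψ) p (0, 1) = 0 := by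
      filter_upwards [hΨt, hΨ.tendsto.eventually hWΩ] with p h1 h2
      rw [fderiv_comp p (hX.differentiable (by simp) _) (hΨ.smooth.differentiable (by simp) _),
        ContinuousLinearMap.comp_apply, h1, h2.1]
    have hfst : Tendsto (fun g : (H × ℝ) × ℝ => g.1) (𝓝 0) (𝓝 0) := continuous_fst.tendsto 0
    filter_upwards [eventually_eq_of_fderiv_snd_eq_zero (hX.comp hΨ.smooth) h1,
      hfst.eventually hΨτ, hfst.eventually hτX] with p h1 h2 h3
    rw [h1, Function.comp_apply, h2, h3]
    rfl
  have hXd : ∀ᶠ g in 𝓝 (0 : (H × ℝ) × ℝ), X (Ψ g) = g.1.2 ∧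
      ∀ v, fderiv ℝ X (Ψ g) (fderiv ℝ Ψ g v) = v.1.2 := by
    filter_upwards [hXΨ.eventuallyEq_nhds] with g hg
    refine ⟨hg.eq_of_nhds, fun v => ?_⟩
    have h1 := hg.fderiv_eq (𝕜 := ℝ)
    rw [fderiv_comp g (hX.differentiable (by simp) _) (hΨ.smooth.differentiable (by simp) _),
      (xProj H).fderiv] at h1
    exact DFunLike.congr_fun h1 v
  let Ω' := pullbackBm Ψ Ω
  have hΩ' : ContDiff ℝ ∞ Ω' := contDiff_pullbackBm hΨ.smooth hΩ
  have hmain : IsBmDarboux k (xProj H) m Ω' 0 := by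
    refine isBmDarboux_of_flow_box hm (by simp [H]) hΩ' (fun _ _ _ => halt _ _ _) ?_ ?_ ?_
    · filter_upwards [hΨt, hΨ.tendsto.eventually hWΩ, hXd] with g h1 h2 h3 q hq
      have h4 : fderiv ℝ Ψ g ((0, 0), 1) = W (Ψ g) := h1
      rw [pullbackBm_apply, h4]
      exact h2.2 (fderiv ℝ Ψ g q.1, q.2) (by rw [h3.1, h3.2, hq])
    · filter_upwards [hΨ.tendsto.eventually hcl, hXd, hXΨ.eventuallyEq_nhds] with g h1 h2 h3 h4
      have hne : X (Ψ g) ≠ 0 := by rwa [h2.1]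
      have h5 : IsClosedFormAt (pullbackForm Ψ (bmRestrict X m Ω)) g :=
        (h1 hne).pullback hΨ.smooth (differentiableAt_bmRestrict hX hΩ hne)
          (fun _ _ => halt _ _ _)
      rw [← bmRestrict_pullbackBm hΨ.smooth hX] at h5
      refine h5.congr ?_
      filter_upwards [h3.eventuallyEq_nhds] with g' hg'
      exact bmRestrict_congr hg'.symm m Ω'
    · intro q hq h
      have hX0 := hXd.self_of_nhds.2
      rw [hΨ.map_base] at hX0
      have h1 := hnd (fderiv ℝ Ψ 0 q.1, q.2) (by rw [hX0, hq]) fun q' hq' => by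
        have h2 := h (fderiv ℝ Θ a q'.1, q'.2) (by
          rw [← hX0, hΨ.fderiv_comp_base, hq'])
        rwa [pullbackBm_apply, hΨ.map_base, hΨ.fderiv_comp_base] at h2
      have h2 : fderiv ℝ Ψ 0 q.1 = 0 := congrArg Prod.fst h1
      have h3 : q.2 = 0 := congrArg Prod.snd h1
      have h4 := hΨ.symm.fderiv_comp_base q.1
      rw [h2, map_zero] at h4
      exact Prod.ext h4.symm h3
  have hback : IsBmDarboux k (xProj H ∘ Θ) m (pullbackBm Θ Ω') a := by
    refine IsBmDarboux.pullback (xProj H).contDiff hΨ.smooth_inv ?_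
    rw [hΨ.inv_base]
    exact hmain
  refine hback.congr ?_ ?_
  · filter_upwards [hΨ.symm.tendsto.eventually hXΨ, hΨ.right_inv] with z h1 h2
    rw [Function.comp_apply, ← h1, Function.comp_apply, h2]
  · filter_upwards [hΨ.right_inv, hΨ.fderiv_comp] with z h1 h2
    refine ContinuousLinearMap.ext fun q => ContinuousLinearMap.ext fun q' => ?_
    simp only [Ω', pullbackBm_apply, h1, h2]

end BmDarboux

/-! ### From forms on the manifold to bilinear forms in a chart -/

section Charts

/-- The bilinear form of an alternating form of degree two. -/
noncomputable def toBilin {F : Type} [NormedAddCommGroup F] [NormedSpace ℝ F]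
    (A : F [⋀^Fin 2]→L[ℝ] ℝ) : F →L[ℝ] F →L[ℝ] ℝ :=
  ((ContinuousAlternatingMap.ofSubsingletonLIE (𝕜 := ℝ) (E := F) (F := ℝ)
    (0 : Fin 1)).symm.toContinuousLinearEquiv :
    (F [⋀^Fin 1]→L[ℝ] ℝ) →L[ℝ] F →L[ℝ] ℝ).comp A.curryLeft

theorem toBilin_apply {F : Type} [NormedAddCommGroup F] [NormedSpace ℝ F]
    (A : F [⋀^Fin 2]→L[ℝ] ℝ) (u v : F) : toBilin A u v = A ![u, v] := by
  change A (Matrix.vecCons u fun _ => v) = _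
  congr 1
  ext i
  fin_cases i <;> rfl

theorem toBilin_swap {F : Type} [NormedAddCommGroup F] [NormedSpace ℝ F]
    (A : F [⋀^Fin 2]→L[ℝ] ℝ) (u v : F) : toBilin A u v = -toBilin A v u := by
  rw [toBilin_apply, toBilin_apply]
  have h : A (![v, u] ∘ Equiv.swap 0 1) = -A ![v, u] :=
    A.toAlternatingMap.map_swap ![v, u] (i := 0) (j := 1) (by simp)
  rw [← h]
  congr 1
  ext i
  fin_cases i <;> simp

theorem contDiff_toBilin {E F : Type} [NormedAddCommGroup E] [NormedSpace ℝ E]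
    [NormedAddCommGroup F] [NormedSpace ℝ F] [FiniteDimensional ℝ F]
    {A : E → F [⋀^Fin 2]→L[ℝ] ℝ} (hA : ContDiff ℝ ∞ A) : ContDiff ℝ ∞ fun z => toBilin (A z) := by
  refine contDiff_clm_apply_iff.2 fun u => contDiff_clm_apply_iff.2 fun v => ?_
  simp only [toBilin_apply]
  exact (ContinuousAlternatingMap.apply ℝ F ℝ ![u, v]).contDiff.comp hA

/-- The alternating sum over omitted arguments becomes the cyclic sum after one transposition in the
middle term. -/
theorem isClosedFormAt_of_extDeriv_eq_zero {E : Type} [NormedAddCommGroup E] [NormedSpace ℝ E]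
    [FiniteDimensional ℝ E] {X : E → ℝ} (hX : ContDiff ℝ ∞ X) {m : ℕ}
    {A : E → (E × ℝ) [⋀^Fin 2]→L[ℝ] ℝ} (hA : ContDiff ℝ ∞ A) {z : E} (hz : X z ≠ 0)
    (h : extDeriv (fun z => (A z).compContinuousLinearMap (bmLiftAt X m z)) z = 0) :
    IsClosedFormAt (bmRestrict X m fun z => toBilin (A z)) z := by
  have hd : DifferentiableAt ℝ (fun z => (A z).compContinuousLinearMap (bmLiftAt X m z)) z :=
    ((hA.differentiable (by simp) z).hasFDerivAt.continuousAlternatingMapCompContinuousLinearMap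
      (differentiableAt_bmLiftAt hX hz).hasFDerivAt).differentiableAt
  have hb := differentiableAt_bmRestrict hX (m := m) (contDiff_toBilin hA) hz
  have key : ∀ u v w, fderiv ℝ (bmRestrict X m fun z => toBilin (A z)) z u v w =
      fderiv ℝ (fun z => (A z).compContinuousLinearMap (bmLiftAt X m z) ![v, w]) z u := by
    intro u v w
    rw [← fderiv_bilin_apply hb]
    congr 2
    funext y
    change toBilin (A y) (bmLiftAt X m y v) (bmLiftAt X m y w) = _
    rw [toBilin_apply]
    change _ = A y _
    congr 1
    ext i
    · fin_cases i <;> rfl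
    · fin_cases i <;> rfl
  have hswap : ∀ u v w, fderiv ℝ (bmRestrict X m fun z => toBilin (A z)) z u v w =
      -fderiv ℝ (bmRestrict X m fun z => toBilin (A z)) z u w v := by
    intro u v w
    rw [← fderiv_bilin_apply hb, ← fderiv_bilin_apply hb,
      show (fun y => bmRestrict X m (fun z => toBilin (A z)) y v w) =
        fun y => -bmRestrict X m (fun z => toBilin (A z)) y w v from
        funext fun y => toBilin_swap _ _ _, fderiv_fun_neg]
    rfl
  intro u v w
  have h1 := extDeriv_apply hd ![u, v, w]
  rw [h, Fin.sum_univ_three] at h1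
  have e0 : (0 : Fin 3).removeNth ![u, v, w] = ![v, w] := by ext i; fin_cases i <;> rfl
  have e1 : (1 : Fin 3).removeNth ![u, v, w] = ![u, w] := by ext i; fin_cases i <;> rfl
  have e2 : (2 : Fin 3).removeNth ![u, v, w] = ![u, v] := by ext i; fin_cases i <;> rfl
  rw [e0, e1, e2] at h1
  simp only [Matrix.cons_val_zero, Matrix.cons_val_one, Matrix.cons_val_two, Matrix.head_cons,
    Matrix.tail_cons, ← key] at h1
  rw [hswap v w u]
  simp at h1
  linarith

variable {d : ℕ} {M : Type*} [TopologicalSpace M] [ChartedSpace (EuclideanSpace ℝ (Fin d)) M]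
  [IsManifold (𝓡 d) ∞ M] {φ : OpenPartialHomeomorph M (EuclideanSpace ℝ (Fin d))}

theorem mdifferentiable_of_mem_maximalAtlas (hφ : φ ∈ IsManifold.maximalAtlas (𝓡 d) ∞ M) :
    φ.MDifferentiable (𝓡 d) (𝓡 d) :=
  ⟨(contMDiffOn_of_mem_maximalAtlas hφ).mdifferentiableOn (by simp),
    (contMDiffOn_symm_of_mem_maximalAtlas hφ).mdifferentiableOn (by simp)⟩

theorem dAt_congr {f g : M → ℝ} {q : M} (h : f =ᶠ[𝓝 q] g) : dAt d f q = dAt d g q :=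
  Filter.EventuallyEq.mfderiv_eq h

theorem dAt_comp_chart (hφ : φ ∈ IsManifold.maximalAtlas (𝓡 d) ∞ M) {q : M} (hq : q ∈ φ.source)
    {g : EuclideanSpace ℝ (Fin d) → ℝ} (hg : DifferentiableAt ℝ g (φ q))
    (v : TangentSpace (𝓡 d) q) :
    dAt d (fun r => g (φ r)) q v = fderiv ℝ g (φ q) (mfderiv (𝓡 d) (𝓡 d) φ q v) := by
  have h1 := mfderiv_comp q hg.mdifferentiableAt
    ((mdifferentiable_of_mem_maximalAtlas hφ).mdifferentiableAt hq)
  change mfderiv (𝓡 d) 𝓘(ℝ, ℝ) (g ∘ φ) q v = _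
  rw [h1, mfderiv_eq_fderiv]
  rfl

theorem contDiffOn_comp_symm {x : M → ℝ} (hx : ContMDiff (𝓡 d) 𝓘(ℝ, ℝ) ∞ x)
    (hφ : φ ∈ IsManifold.maximalAtlas (𝓡 d) ∞ M) : ContDiffOn ℝ ∞ (x ∘ φ.symm) φ.target :=
  contMDiffOn_iff_contDiffOn.1
    (hx.comp_contMDiffOn (contMDiffOn_symm_of_mem_maximalAtlas hφ))

theorem dAt_eq_of_chart {x : M → ℝ} (hφ : φ ∈ IsManifold.maximalAtlas (𝓡 d) ∞ M) {q : M}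
    (hq : q ∈ φ.source) {X : EuclideanSpace ℝ (Fin d) → ℝ}
    (hX : DifferentiableAt ℝ X (φ q)) (hXx : X =ᶠ[𝓝 (φ q)] x ∘ φ.symm)
    (v : TangentSpace (𝓡 d) q) :
    dAt d x q v = fderiv ℝ X (φ q) (mfderiv (𝓡 d) (𝓡 d) φ q v) := by
  rw [← dAt_comp_chart hφ hq hX]
  refine DFunLike.congr_fun (dAt_congr ?_) v
  filter_upwards [(φ.continuousAt hq).eventually hXx, φ.open_source.mem_nhds hq] with r hr hr'
  rw [hr, Function.comp_apply, φ.left_inv hr']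

/-- The ordinary two-form defined by a smooth `b^m`-form, in a chart. -/
theorem inChart_eq {x : M → ℝ} {m : ℕ} {σ : BmForm d x m 2}
    (hφ : φ ∈ IsManifold.maximalAtlas (𝓡 d) ∞ M)
    {A : EuclideanSpace ℝ (Fin d) → (EuclideanSpace ℝ (Fin d) × ℝ) [⋀^Fin 2]→L[ℝ] ℝ}
    {z : EuclideanSpace ℝ (Fin d)} (hz : z ∈ φ.target)
    (hA : ∀ e : Fin 2 → BmTangent d x m (φ.symm z), σ (φ.symm z) e =
      A z (fun i => (mfderiv (𝓡 d) (𝓡 d) φ (φ.symm z) (e i).1.1, (e i).1.2)))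
    {X : EuclideanSpace ℝ (Fin d) → ℝ} (hX : DifferentiableAt ℝ X z)
    (hXx : X =ᶠ[𝓝 z] x ∘ φ.symm) (hXz : X z ≠ 0) :
    σ.inChart φ z = (A z).compContinuousLinearMap (bmLiftAt X m z) := by
  have hxz : X z = x (φ.symm z) := hXx.eq_of_nhds
  have hne : x (φ.symm z) ≠ 0 := by rwa [← hxz]
  have hd := mdifferentiable_of_mem_maximalAtlas hφ
  have hinv : ∀ v, mfderiv (𝓡 d) (𝓡 d) φ (φ.symm z) (mfderiv (𝓡 d) (𝓡 d) φ.symm z v) = v :=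
    fun v => DFunLike.congr_fun (hd.comp_symm_deriv hz) v
  have hr := φ.right_inv hz
  ext v
  rw [BmForm.inChart, dif_pos hne]
  change σ (φ.symm z) _ = A z _
  rw [hA]
  congr 1
  funext i
  have hi := hinv (v i)
  have h2 : dAt d x (φ.symm z) (mfderiv (𝓡 d) (𝓡 d) φ.symm z (v i)) = fderiv ℝ X z (v i) := by
    rw [dAt_eq_of_chart hφ (φ.map_target hz) (X := X) (by rwa [hr]) (by rwa [hr])]
    exact (congrArg (fderiv ℝ X _) hi).trans (by rw [hr])
  refine Prod.ext hi ?_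
  change (x (φ.symm z) ^ m)⁻¹ * dAt d x (φ.symm z) (mfderiv (𝓡 d) (𝓡 d) φ.symm z (v i)) =
    (X z ^ m)⁻¹ * fderiv ℝ X z (v i)
  rw [h2, hxz]

end Charts

/-! ### Local representatives of a `b^m`-form and changes of chart -/

section Coordinates

/-- The domain is cut down to an open set where `P` holds and the derivative stays invertible, so
that the inverse is smooth on the entire target. -/
theorem exists_openPartialHomeomorph_of_injective_fderiv {E : Type} [NormedAddCommGroup E]
    [NormedSpace ℝ E] [FiniteDimensional ℝ E] {f : E → E} (hf : ContDiff ℝ ∞ f) {a : E}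
    (hinj : ∀ v, fderiv ℝ f a v = 0 → v = 0) {P : E → Prop} (hP : ∀ᶠ z in 𝓝 a, P z) :
    ∃ ψ : OpenPartialHomeomorph E E, (∀ z, ψ z = f z) ∧ a ∈ ψ.source ∧ (∀ z ∈ ψ.source, P z) ∧
      ContDiffOn ℝ ∞ ψ.symm ψ.target := by
  have := FiniteDimensional.complete ℝ E
  have hinj' : Function.Injective (fderiv ℝ f a : E →ₗ[ℝ] E) :=
    (injective_iff_map_eq_zero _).2 hinj
  let e : E ≃L[ℝ] E := (LinearEquiv.ofInjectiveEndo _ hinj').toContinuousLinearEquiv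
  have he' : (e : E →L[ℝ] E) = fderiv ℝ f a := by
    ext v
    rfl
  have he : HasFDerivAt f (e : E →L[ℝ] E) a := by
    rw [he']
    exact (hf.differentiable (by simp) a).hasFDerivAt
  have hopen : ∀ᶠ z in 𝓝 a, ∃ e' : E ≃L[ℝ] E, (e' : E →L[ℝ] E) = fderiv ℝ f z := by
    have hc := (hf.continuous_fderiv (by simp)).tendsto a
    rw [← he'] at hc
    exact hc (ContinuousLinearEquiv.nhds e)
  obtain ⟨N, hN, hNo, haN⟩ := eventually_nhds_iff.1 (hP.and hopen)
  have hfa := hf.contDiffAt (x := a)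
  let φ := hfa.toOpenPartialHomeomorph f he (by simp)
  have ha : a ∈ φ.source := hfa.mem_toOpenPartialHomeomorph_source he (by simp)
  have hsrc : (φ.restrOpen N hNo).source = φ.source ∩ N := φ.restrOpen_source N hNo
  refine ⟨φ.restrOpen N hNo, fun z => rfl, ?_, ?_, ?_⟩
  · rw [hsrc]
    exact ⟨ha, haN⟩
  · intro z hz
    rw [hsrc] at hz
    exact (hN z hz.2).1
  · intro z hz
    have hz' := (φ.restrOpen N hNo).map_target hz
    rw [hsrc] at hz'
    obtain ⟨e', h'⟩ := (hN _ hz'.2).2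
    refine ((φ.restrOpen N hNo).contDiffAt_symm (f₀' := e') hz ?_ hf.contDiffAt).contDiffWithinAt
    rw [h']
    exact (hf.differentiable (by simp) _).hasFDerivAt

variable {d : ℕ} {M : Type*} [TopologicalSpace M] [ChartedSpace (EuclideanSpace ℝ (Fin d)) M]
  [IsManifold (𝓡 d) ∞ M]

theorem trans_mem_maximalAtlas {φ : OpenPartialHomeomorph M (EuclideanSpace ℝ (Fin d))}
    (hφ : φ ∈ IsManifold.maximalAtlas (𝓡 d) ∞ M)
    {ψ : OpenPartialHomeomorph (EuclideanSpace ℝ (Fin d)) (EuclideanSpace ℝ (Fin d))}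
    (h1 : ContDiffOn ℝ ∞ ψ ψ.source) (h2 : ContDiffOn ℝ ∞ ψ.symm ψ.target) :
    φ.trans ψ ∈ IsManifold.maximalAtlas (𝓡 d) ∞ M := by
  apply OpenPartialHomeomorph.mem_maximalAtlas_of_contMDiffOn
  · rw [OpenPartialHomeomorph.trans_source]
    exact h1.contMDiffOn.comp ((contMDiffOn_of_mem_maximalAtlas hφ).mono inter_subset_left)
      inter_subset_right
  · rw [OpenPartialHomeomorph.trans_target]
    exact (contMDiffOn_symm_of_mem_maximalAtlas hφ).comp (h2.contMDiffOn.mono inter_subset_left)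
      inter_subset_right

/-- In the chart `φ` and at the point `z`, the defining function is `X` and the `b^m`-form `σ` is
the restriction of the form `A` on the ambient bundle. -/
structure RepresentsAt {x : M → ℝ} {m : ℕ} (σ : BmForm d x m 2)
    (φ : OpenPartialHomeomorph M (EuclideanSpace ℝ (Fin d)))
    (X : EuclideanSpace ℝ (Fin d) → ℝ)
    (A : EuclideanSpace ℝ (Fin d) → (EuclideanSpace ℝ (Fin d) × ℝ) [⋀^Fin 2]→L[ℝ] ℝ)
    (z : EuclideanSpace ℝ (Fin d)) : Prop where
  mem_target : z ∈ φ.target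
  germ : X =ᶠ[𝓝 z] x ∘ φ.symm
  form : ∀ q ∈ φ.source, φ q = z → ∀ e : Fin 2 → BmTangent d x m q,
    σ q e = A z (fun i => (mfderiv (𝓡 d) (𝓡 d) φ q (e i).1.1, (e i).1.2))

theorem exists_representsAt {x : M → ℝ} (hx : ContMDiff (𝓡 d) 𝓘(ℝ, ℝ) ∞ x) {m : ℕ}
    {σ : BmForm d x m 2} (hσ : σ.SmoothOn univ) (p : M) :
    ∃ φ ∈ IsManifold.maximalAtlas (𝓡 d) ∞ M, p ∈ φ.source ∧
      ∃ (X : EuclideanSpace ℝ (Fin d) → ℝ)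
        (A : EuclideanSpace ℝ (Fin d) → (EuclideanSpace ℝ (Fin d) × ℝ) [⋀^Fin 2]→L[ℝ] ℝ),
        ContDiff ℝ ∞ X ∧ ContDiff ℝ ∞ A ∧ ∀ᶠ z in 𝓝 (φ p), RepresentsAt σ φ X A z := by
  obtain ⟨φ, hφ, hp, -, Ω, hΩ, hσΩ⟩ := hσ p trivial
  have hev : ∀ᶠ z in 𝓝 (φ p), z ∈ φ.target := φ.open_target.mem_nhds (φ.map_source hp)
  obtain ⟨X, hX, hXe⟩ := exists_contDiff_eventuallyEq (f := x ∘ φ.symm) (a := φ p)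
    (hev.mono fun z hz =>
      (contDiffOn_comp_symm hx hφ).contDiffAt (φ.open_target.mem_nhds hz))
  obtain ⟨A, hA, hAe⟩ := exists_contDiff_eventuallyEq (f := Ω) (a := φ p)
    (hev.mono fun z hz => hΩ.contDiffAt (φ.open_target.mem_nhds hz))
  refine ⟨φ, hφ, hp, X, A, hX, hA, ?_⟩
  filter_upwards [hev, hXe.eventually_nhds, hAe] with z hz hz1 hz2
  refine ⟨hz, hz1, fun q hq hqz e => ?_⟩
  rw [hz2, hσΩ q hq e, hqz]

variable {x : M → ℝ} {m : ℕ} {σ : BmForm d x m 2}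
  {φ : OpenPartialHomeomorph M (EuclideanSpace ℝ (Fin d))} {X : EuclideanSpace ℝ (Fin d) → ℝ}
  {A : EuclideanSpace ℝ (Fin d) → (EuclideanSpace ℝ (Fin d) × ℝ) [⋀^Fin 2]→L[ℝ] ℝ}

theorem RepresentsAt.apply {q : M} (h : RepresentsAt σ φ X A (φ q)) (hq : q ∈ φ.source) :
    X (φ q) = x q := by
  rw [h.germ.eq_of_nhds, Function.comp_apply, φ.left_inv hq]

theorem RepresentsAt.dAt_eq (hφ : φ ∈ IsManifold.maximalAtlas (𝓡 d) ∞ M) (hX : ContDiff ℝ ∞ X)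
    {q : M} (h : RepresentsAt σ φ X A (φ q)) (hq : q ∈ φ.source) (v : TangentSpace (𝓡 d) q) :
    dAt d x q v = fderiv ℝ X (φ q) (mfderiv (𝓡 d) (𝓡 d) φ q v) :=
  dAt_eq_of_chart hφ hq (hX.differentiable (by simp) _) h.germ v

theorem RepresentsAt.form_eq {q : M} (h : RepresentsAt σ φ X A (φ q)) (hq : q ∈ φ.source)
    (e e' : BmTangent d x m q) :
    σ q ![e, e'] = toBilin (A (φ q)) (mfderiv (𝓡 d) (𝓡 d) φ q e.1.1, e.1.2)
      (mfderiv (𝓡 d) (𝓡 d) φ q e'.1.1, e'.1.2) := by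
  rw [toBilin_apply, h.form q hq rfl]
  congr 1
  funext i
  fin_cases i <;> rfl

/-- Near a point off the zero set, the ordinary form in the chart agrees with the lift of `A`, so
their exterior derivatives agree. -/
theorem isClosedFormAt_of_closed (hφ : φ ∈ IsManifold.maximalAtlas (𝓡 d) ∞ M) (hσ : σ.Closed)
    (hX : ContDiff ℝ ∞ X) (hA : ContDiff ℝ ∞ A) {z : EuclideanSpace ℝ (Fin d)}
    (h : ∀ᶠ y in 𝓝 z, RepresentsAt σ φ X A y) (hz : X z ≠ 0) :
    IsClosedFormAt (bmRestrict X m fun y => toBilin (A y)) z := by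
  refine isClosedFormAt_of_extDeriv_eq_zero hX hA hz ?_
  have hzz := h.self_of_nhds
  have hxz : x (φ.symm z) ≠ 0 := by
    have := hzz.germ.eq_of_nhds
    rwa [Function.comp_apply.symm.trans this.symm]
  rw [← hσ φ hφ z hzz.mem_target hxz]
  refine Filter.EventuallyEq.extDeriv_eq ?_
  filter_upwards [h, (hX.continuous.tendsto z).eventually_ne hz] with y hy hy0
  exact (inChart_eq hφ hy.mem_target
    (hy.form _ (φ.map_target hy.mem_target) (φ.right_inv hy.mem_target))
    (hX.differentiable (by simp) _) hy.germ hy0).symm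

theorem mfderiv_chart_surjective (hφ : φ ∈ IsManifold.maximalAtlas (𝓡 d) ∞ M) {q : M}
    (hq : q ∈ φ.source) (v : EuclideanSpace ℝ (Fin d)) :
    ∃ u : TangentSpace (𝓡 d) q, mfderiv (𝓡 d) (𝓡 d) φ q u = v :=
  (mdifferentiable_of_mem_maximalAtlas hφ).mfderiv_surjective hq v

theorem RepresentsAt.nondegenerate (hφ : φ ∈ IsManifold.maximalAtlas (𝓡 d) ∞ M) (hm : 0 < m)
    (hX : ContDiff ℝ ∞ X) {p : M} (h : RepresentsAt σ φ X A (φ p)) (hp : p ∈ φ.source)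
    (hxp : x p = 0) (hσ : ∀ e : BmTangent d x m p, (∀ e', σ p ![e, e'] = 0) → e = 0)
    (e : EuclideanSpace ℝ (Fin d) × ℝ) (he : fderiv ℝ X (φ p) e.1 = 0)
    (hee : ∀ e', fderiv ℝ X (φ p) e'.1 = 0 → toBilin (A (φ p)) e e' = 0) : e = 0 := by
  -- Since `x p = 0` and `m > 0`, the `b^m`-tangent space at `p` is the kernel of `dX` times `ℝ`;
  -- the chart carries test vectors back and forth.
  obtain ⟨u, hu⟩ := mfderiv_chart_surjective hφ hp e.1
  have hmem : ((u, e.2) : TangentSpace (𝓡 d) p × ℝ) ∈ BmTangent d x m p := by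
    change dAt d x p u = x p ^ m * e.2
    rw [h.dAt_eq hφ hX hp, hxp, zero_pow hm.ne', zero_mul]
    exact (congrArg _ hu).trans he
  have h0 := hσ ⟨(u, e.2), hmem⟩ fun e' => by
    rw [h.form_eq hp]
    have he' : fderiv ℝ X (φ p) (mfderiv (𝓡 d) (𝓡 d) φ p e'.1.1) = 0 := by
      rw [← h.dAt_eq hφ hX hp]
      have := e'.2
      change dAt d x p e'.1.1 = x p ^ m * e'.1.2 at this
      rw [this, hxp, zero_pow hm.ne', zero_mul]
    have h3 := hee (mfderiv (𝓡 d) (𝓡 d) φ p e'.1.1, e'.1.2) he'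
    have hu' : ((mfderiv (𝓡 d) (𝓡 d) φ p u, e.2) : EuclideanSpace ℝ (Fin d) × ℝ) = e :=
      Prod.ext hu rfl
    exact (congrArg (fun w => toBilin (A (φ p)) w (mfderiv (𝓡 d) (𝓡 d) φ p e'.1.1, e'.1.2))
      hu').trans h3
  have h1 : u = 0 := congrArg (fun w : BmTangent d x m p => w.1.1) h0
  have h2 : e.2 = 0 := congrArg (fun w : BmTangent d x m p => w.1.2) h0
  refine Prod.ext ?_ h2
  rw [← hu, h1, map_zero]
  rfl

end Coordinates

/-! ### Assembling the Darboux functions into a coordinate map -/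

section Interleave

/-- The list `a₁, b₁, …, aₙ, bₙ`. -/
def interleave {n : ℕ} {α : Type*} (a b : Fin n → α) (j : Fin (2 * n)) : α :=
  if j.val % 2 = 0 then a ⟨j.val / 2, by omega⟩ else b ⟨j.val / 2, by omega⟩

theorem interleave_xIdx {n : ℕ} {α : Type*} (a b : Fin n → α) (i : Fin n) :
    interleave a b (xIdx i) = a i := by
  have h : (xIdx i).val % 2 = 0 := by simp [xIdx]
  rw [interleave, if_pos h]
  congr 1
  ext
  simp [xIdx]

theorem interleave_yIdx {n : ℕ} {α : Type*} (a b : Fin n → α) (i : Fin n) :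
    interleave a b (yIdx i) = b i := by
  have h : ¬ (yIdx i).val % 2 = 0 := by simp only [yIdx]; omega
  rw [interleave, if_neg h]
  congr 1
  ext
  simp only [yIdx]
  omega

/-- The map with components `a₁, b₁, …, aₙ, bₙ`, normalised to vanish at `z₀`. -/
noncomputable def coordinateMap {n : ℕ} {E : Type} (a b : Fin n → E → ℝ) (z₀ z : E) :
    EuclideanSpace ℝ (Fin (2 * n)) :=
  WithLp.toLp 2 fun j => interleave a b j z - interleave a b j z₀

variable {n : ℕ} {E : Type} [NormedAddCommGroup E] [NormedSpace ℝ E] {a b : Fin n → E → ℝ}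

theorem coordinateMap_xIdx (z₀ z : E) (i : Fin n) :
    coordinateMap a b z₀ z (xIdx i) = a i z - a i z₀ := by
  change interleave a b (xIdx i) z - interleave a b (xIdx i) z₀ = _
  rw [interleave_xIdx]

theorem coordinateMap_yIdx (z₀ z : E) (i : Fin n) :
    coordinateMap a b z₀ z (yIdx i) = b i z - b i z₀ := by
  change interleave a b (yIdx i) z - interleave a b (yIdx i) z₀ = _
  rw [interleave_yIdx]

theorem contDiff_coordinateMap (ha : ∀ i, ContDiff ℝ ∞ (a i)) (hb : ∀ i, ContDiff ℝ ∞ (b i))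
    (z₀ : E) : ContDiff ℝ ∞ (coordinateMap a b z₀) := by
  refine contDiff_euclidean.2 fun j => ?_
  change ContDiff ℝ ∞ fun z => interleave a b j z - interleave a b j z₀
  refine ContDiff.sub ?_ contDiff_const
  unfold interleave
  split_ifs
  exacts [ha _, hb _]

theorem fderiv_eq_zero_of_coordinateMap (ha : ∀ i, ContDiff ℝ ∞ (a i))
    (hb : ∀ i, ContDiff ℝ ∞ (b i)) {z₀ z v : E} (h : fderiv ℝ (coordinateMap a b z₀) z v = 0)
    (i : Fin n) : fderiv ℝ (a i) z v = 0 ∧ fderiv ℝ (b i) z v = 0 := by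
  have hd := ((contDiff_coordinateMap ha hb z₀).differentiable (by simp) z).hasFDerivAt
  have key : ∀ j, fderiv ℝ (fun y => coordinateMap a b z₀ y j) z v = 0 := by
    intro j
    let π : EuclideanSpace ℝ (Fin (2 * n)) →L[ℝ] ℝ := EuclideanSpace.proj j
    have h1 := π.hasFDerivAt.comp z hd
    refine (DFunLike.congr_fun h1.fderiv v).trans ?_
    change π (fderiv ℝ (coordinateMap a b z₀) z v) = 0
    rw [h, map_zero]
  constructor
  · have h1 := key (xIdx i)
    simp only [coordinateMap_xIdx] at h1
    rwa [fderiv_sub_const] at h1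
  · have h1 := key (yIdx i)
    simp only [coordinateMap_yIdx] at h1
    rwa [fderiv_sub_const] at h1

/-- The functions are independent because of nondegeneracy: if all their differentials kill `v`,
then `(v, 0)` is `b^m`-tangent and the normal form shows that it lies in the kernel of `Ω`. -/
theorem exists_darboux_functions [FiniteDimensional ℝ E] {m : ℕ} (hn : 0 < n) (hm : 0 < m)
    (hdim : Module.finrank ℝ E = 2 * n)
    {X : E → ℝ} (hX : ContDiff ℝ ∞ X) {z₀ : E} (hXa : X z₀ = 0) (hdX : fderiv ℝ X z₀ ≠ 0)
    {Ω : E → (E × ℝ) →L[ℝ] (E × ℝ) →L[ℝ] ℝ} (hΩ : ContDiff ℝ ∞ Ω)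
    (halt : ∀ z e e', Ω z e e' = -Ω z e' e)
    (hcl : ∀ᶠ z in 𝓝 z₀, X z ≠ 0 → IsClosedFormAt (bmRestrict X m Ω) z)
    (hnd : ∀ e : E × ℝ, fderiv ℝ X z₀ e.1 = 0 →
      (∀ e', fderiv ℝ X z₀ e'.1 = 0 → Ω z₀ e e' = 0) → e = 0) :
    ∃ a b : Fin n → E → ℝ, (∀ i, ContDiff ℝ ∞ (a i)) ∧ (∀ i, ContDiff ℝ ∞ (b i)) ∧
      a ⟨0, hn⟩ = X ∧ (∀ v, fderiv ℝ (coordinateMap a b z₀) z₀ v = 0 → v = 0) ∧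
      ∀ᶠ z in 𝓝 z₀, ∀ e e' : E × ℝ,
        fderiv ℝ X z e.1 = X z ^ m * e.2 → fderiv ℝ X z e'.1 = X z ^ m * e'.2 →
        Ω z e e' = wedgeEval Prod.snd (fun e => fderiv ℝ (b ⟨0, hn⟩) z e.1) e e' +
          ∑ i : Fin n with i ≠ ⟨0, hn⟩,
            wedgeEval (fderiv ℝ (a i) z) (fderiv ℝ (b i) z) e.1 e'.1 := by
  obtain ⟨k, rfl⟩ : ∃ k, n = k + 1 := ⟨n - 1, by omega⟩
  obtain ⟨y₀, x, y, hy₀, hx, hy, h⟩ := isBmDarboux_of_isClosed_of_nondegenerate hm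
    (by rw [hdim]; ring : Module.finrank ℝ E = 2 * k + 2) hX hXa hdX hΩ halt hcl hnd
  have ha : ∀ i, ContDiff ℝ ∞ ((Fin.cons X x : Fin (k + 1) → E → ℝ) i) :=
    Fin.cases hX hx
  have hb : ∀ i, ContDiff ℝ ∞ ((Fin.cons y₀ y : Fin (k + 1) → E → ℝ) i) :=
    Fin.cases hy₀ hy
  refine ⟨Fin.cons X x, Fin.cons y₀ y, ha, hb, rfl, fun v hv => ?_, ?_⟩
  · have hz := fderiv_eq_zero_of_coordinateMap ha hb hv
    have h0 := hz 0
    have h1 : ((v, 0) : E × ℝ) = 0 := by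
      refine hnd _ h0.1 fun e' he' => ?_
      rw [h.self_of_nhds (v, 0) e' (by rw [hXa, zero_pow hm.ne', zero_mul]; exact h0.1)
        (by rw [hXa, zero_pow hm.ne', zero_mul]; exact he')]
      have hy0 : fderiv ℝ y₀ z₀ v = 0 := h0.2
      have hxi : ∀ i, fderiv ℝ (x i) z₀ v = 0 := fun i => (hz i.succ).1
      have hyi : ∀ i, fderiv ℝ (y i) z₀ v = 0 := fun i => (hz i.succ).2
      simp [wedgeEval, hy0, hxi, hyi]
    exact congrArg Prod.fst h1
  · filter_upwards [h] with z hz e e' he he'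
    rw [hz e e' he he', Finset.sum_filter, Fin.sum_univ_succ]
    simp [Fin.ext_iff]

end Interleave

theorem mainTheorem5 (n : ℕ) (hn : 0 < n) (m : ℕ) (hm : 0 < m)
    {M : Type*} [TopologicalSpace M] [ChartedSpace (EuclideanSpace ℝ (Fin (2 * n))) M]
    [IsManifold (𝓡 (2 * n)) ∞ M]
    (x : M → ℝ) (Z : Set M) (hx : IsDefiningFunction (d := 2 * n) x Z)
    (σ : BmForm (2 * n) x m 2) (hσ : IsBmSymplectic σ) (p : M) (hp : p ∈ Z) :
    ∃ φ ∈ IsManifold.maximalAtlas (𝓡 (2 * n)) ∞ M,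
      p ∈ φ.source ∧ φ p = 0 ∧
      (∀ q ∈ φ.source, q ∈ Z ↔ φ q (xIdx ⟨0, hn⟩) = 0) ∧
      -- `θ` is the smooth `b^m`-form `dx_1 / x_1^m` on the domain of the chart
      ∃ θ : BmForm (2 * n) x m 1, θ.SmoothOn φ.source ∧
        (∀ q ∈ φ.source, q ∉ Z → ∀ e : BmTangent (2 * n) x m q,
          θ q ![e] = bmDiff (2 * n) x m (fun r => φ r (xIdx ⟨0, hn⟩)) q e
            / φ q (xIdx ⟨0, hn⟩) ^ m) ∧
        ∀ q ∈ φ.source, ∀ e e' : BmTangent (2 * n) x m q,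
          σ q ![e, e'] =
            wedgeEval (fun u => θ q ![u])
              (bmDiff (2 * n) x m (fun r => φ r (yIdx ⟨0, hn⟩)) q) e e' +
            ∑ i : Fin n with i ≠ ⟨0, hn⟩,
              wedgeEval (bmDiff (2 * n) x m (fun r => φ r (xIdx i)) q)
                (bmDiff (2 * n) x m (fun r => φ r (yIdx i)) q) e e' := by
  have hZ : ∀ q, q ∈ Z ↔ x q = 0 := fun q => by rw [hx.zero_set]; rfl
  have hxp : x p = 0 := (hZ p).1 hp
  obtain ⟨φ, hφ, hpφ, X, A, hX, hA, hrep⟩ := exists_representsAt hx.smooth hσ.smooth p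
  have hrp := hrep.self_of_nhds
  have hXp : X (φ p) = 0 := (hrp.apply hpφ).trans hxp
  have hdX : fderiv ℝ X (φ p) ≠ 0 := by
    intro h0
    refine hx.regular p hxp (ContinuousLinearMap.ext fun v => ?_)
    have h1 := hrp.dAt_eq hφ hX hpφ v
    rw [h0] at h1
    exact h1
  obtain ⟨a, b, ha, hb, ha0, hinj, hdb⟩ := exists_darboux_functions hn hm (by simp) hX hXp hdX
    (contDiff_toBilin hA) (fun z => toBilin_swap (A z))
    (hrep.eventually_nhds.mono fun z hz => isClosedFormAt_of_closed hφ hσ.closed hX hA hz)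
    (hrp.nondegenerate hφ hm hX hpφ hxp (hσ.nondegenerate p))
  -- The domain is shrunk so that the representation of `σ` and the normal form hold at each of its
  -- points, not only near `p`.
  obtain ⟨ψ, hψ, hpψ, hψP, hψs⟩ := exists_openPartialHomeomorph_of_injective_fderiv
    (contDiff_coordinateMap ha hb (φ p)) hinj (hrep.and hdb)
  have hψf : (ψ : _ → _) = coordinateMap a b (φ p) := funext hψ
  have hmem : φ.trans ψ ∈ IsManifold.maximalAtlas (𝓡 (2 * n)) ∞ M :=
    trans_mem_maximalAtlas hφ (hψf ▸ (contDiff_coordinateMap ha hb (φ p)).contDiffOn) hψs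
  have hsrc : ∀ q ∈ (φ.trans ψ).source, q ∈ φ.source ∧ φ q ∈ ψ.source := fun q hq => by
    rwa [OpenPartialHomeomorph.trans_source] at hq
  have hval : ∀ q, (φ.trans ψ) q = coordinateMap a b (φ p) (φ q) := fun q => hψ _
  have hxv : ∀ q i, (φ.trans ψ) q (xIdx i) = a i (φ q) - a i (φ p) := fun q i => by
    rw [hval, coordinateMap_xIdx]
  have hyv : ∀ q i, (φ.trans ψ) q (yIdx i) = b i (φ q) - b i (φ p) := fun q i => by
    rw [hval, coordinateMap_yIdx]
  -- The first coordinate is exactly `x`: the normalising constant `X (φ p)` is zero.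
  have hx0 : ∀ q ∈ (φ.trans ψ).source, (φ.trans ψ) q (xIdx ⟨0, hn⟩) = x q := fun q hq => by
    rw [hxv, ha0, hXp, sub_zero, (hψP _ (hsrc q hq).2).1.apply (hsrc q hq).1]
  have hdiff : ∀ (c : EuclideanSpace ℝ (Fin (2 * n)) → ℝ) (t : ℝ), ContDiff ℝ ∞ c →
      ∀ q ∈ (φ.trans ψ).source, ∀ e : BmTangent (2 * n) x m q,
      bmDiff (2 * n) x m (fun r => c (φ r) - t) q e =
        fderiv ℝ c (φ q) (mfderiv (𝓡 (2 * n)) (𝓡 (2 * n)) φ q e.1.1) := by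
    intro c t hc q hq e
    have h1 := dAt_comp_chart hφ (hsrc q hq).1 (g := fun z => c z - t)
      ((hc.differentiable (by simp) _).sub_const t) e.1.1
    rw [fderiv_sub_const] at h1
    exact h1
  have htan : ∀ q ∈ (φ.trans ψ).source, ∀ e : BmTangent (2 * n) x m q,
      fderiv ℝ X (φ q) (mfderiv (𝓡 (2 * n)) (𝓡 (2 * n)) φ q e.1.1) = X (φ q) ^ m * e.1.2 := by
    intro q hq e
    have hr := (hψP _ (hsrc q hq).2).1
    rw [← hr.dAt_eq hφ hX (hsrc q hq).1, hr.apply (hsrc q hq).1]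
    exact e.2
  -- As `x₁ = x`, the form `θ` is the canonical section `(v, c) ↦ c`, whose ambient extension is
  -- constant and hence smooth.
  refine ⟨φ.trans ψ, hmem, ?_, ?_, ?_, fun q => ContinuousAlternatingMap.ofSubsingleton ℝ _ _ 0
    ((ContinuousLinearMap.snd ℝ _ ℝ).comp (BmTangent (2 * n) x m q).subtypeL), ?_, ?_, ?_⟩
  · rw [OpenPartialHomeomorph.trans_source]
    exact ⟨hpφ, hpψ⟩
  · rw [hval]
    ext j
    exact sub_self _
  · intro q hq
    rw [hx0 q hq, hZ]
  · intro q hq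
    exact ⟨φ.trans ψ, hmem, hq, subset_rfl, fun _ => ContinuousAlternatingMap.ofSubsingleton ℝ _ _ 0
      (ContinuousLinearMap.snd ℝ _ ℝ), contDiffOn_const, fun q hq e => rfl⟩
  · intro q hq hqZ e
    rw [hx0 q hq]
    simp only [hxv]
    rw [hdiff _ _ (ha _) q hq, ha0, htan q hq e, (hψP _ (hsrc q hq).2).1.apply (hsrc q hq).1]
    exact (mul_div_cancel_left₀ _ (pow_ne_zero m fun h => hqZ ((hZ q).2 h))).symm
  · intro q hq e e'
    obtain ⟨hr, hd⟩ := hψP _ (hsrc q hq).2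
    rw [hr.form_eq (hsrc q hq).1, hd _ _ (htan q hq e) (htan q hq e')]
    simp only [hxv, hyv, wedgeEval, hdiff _ _ (ha _) q hq, hdiff _ _ (hb _) q hq]
    rfl
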